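/- Let $G$ be a finite simple graph on the vertex set $[n]$ with complement $\overline{G}$, and let $K$ be a field. The stable set polytope $\mathcal{Q}_G\subset\mathbb{R}^n$ is the convex hull of the indicator vectors of the stable (independent) sets of $G$, including the empty set. Its toric ring $K[\mathcal{Q}_G]$ is the $K$-subalgebra of $K[x_1^{\pm1},\dots,x_n^{\pm1},t]$ generated by the monomials $X^{\mathbf a}t$ with $\mathbf a\in\mathcal{Q}_G\cap\mathbb{Z}^n$, graded so that every generator $X^{\mathbf a}t$ has degree $1$, and its toric ideal $I_{\mathcal{Q}_G}$ is the kernel of the surjection $K[y_{\mathbf a}:\mathbf a\in\mathcal{Q}_G\cap\mathbb{Z}^n]\to K[\mathcal{Q}_G]$, $y_{\mathbf a}\mapsto X^{\mathbf a}t$. Let $\mu(I_{\mathcal{Q}_G})$ denote the maximum degree of the binomials in a minimal set of binomial generators of $I_{\mathcal{Q}_G}$ (which does not depend on the minimal set), with $\mu(I_{\mathcal{Q}_G})=0$ if $I_{\mathcal{Q}_G}=\{0\}$. Suppose that $\overline{G}$ is bipartite. Then $$\mu(I_{\mathcal{Q}_G})=\begin{cases}0&\text{if }\overline{G}\text{ has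 no edges (i.e., }G\text{ is complete)},\\ k&\text{if }\overline{G}\text{ has a cycle},\\ 2&\text{otherwise,}\end{cases}$$ where in the second case $2k$ is the maximum length of an induced cycle of $\overline{G}$. Moreover, the following conditions are equivalent: (i) $\mu(I_{\mathcal{Q}_G})\le 2$, i.e., $I_{\mathcal{Q}_G}$ is generated by quadratic binomials (the zero ideal being generated by the empty set); (ii) $K[\mathcal{Q}_G]$ is Koszul, i.e., its residue field $K$ has a linear graded free resolution over $K[\mathcal{Q}_G]$; (iii) $I_{\mathcal{Q}_G}$ has a Gröbner basis consisting of quadratic forms with respect to some monomial order; (iv) every induced cycle of $\overline{G}$ has length $4$ (which holds vacuously if $\overline{G}$ has no cycle). -/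

import Mathlib

noncomputable section

namespace StableSetToric

universe u v

/-! ### Lattice polytopes, toric rings and toric ideals -/

section Toric

variable {V : Type u}

/-- The integer points `P ∩ ℤ^V` of a subset `P` of `ℝ^V`. -/
def latticePoints (P : Set (V → ℝ)) : Set (V → ℤ) :=
  {a | (fun i => (a i : ℝ)) ∈ P}

/-- The ring `K[X, X⁻¹, t]`, Laurent in the variables `x_i` (`i ∈ V`) and polynomial in `t`. -/
abbrev LaurentRing (K : Type v) [Field K] (V : Type u) : Type (max u v) :=
  AddMonoidAlgebra K ((V → ℤ) × ℕ)

/-- The monomial `X^a t`. -/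
def laurentMonomial (K : Type v) [Field K] (a : V → ℤ) : LaurentRing K V :=
  AddMonoidAlgebra.single (a, 1) 1

/-- The toric ring `K[P]`, generated over `K` by the monomials `X^a t` with `a ∈ P ∩ ℤ^V`. -/
def toricRing (K : Type v) [Field K] (P : Set (V → ℝ)) : Subalgebra K (LaurentRing K V) :=
  Algebra.adjoin K (laurentMonomial K '' latticePoints P)

/-- The surjection `π : K[y_a : a ∈ P ∩ ℤ^V] → K[P]`, `y_a ↦ X^a t`. -/
def toricMap (K : Type v) [Field K] (P : Set (V → ℝ)) :
    MvPolynomial (latticePoints P) K →ₐ[K] toricRing K P :=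
  MvPolynomial.aeval fun a =>
    ⟨laurentMonomial K a.1, Algebra.subset_adjoin (Set.mem_image_of_mem _ a.2)⟩

/-- The toric ideal `I_P`. -/
def toricIdeal (K : Type v) [Field K] (P : Set (V → ℝ)) :
    Ideal (MvPolynomial (latticePoints P) K) :=
  RingHom.ker (toricMap K P)

/-- The graded pieces of `K[P]`: the degree of a monomial is its exponent of `t`, so that every
generator `X^a t` has degree one. -/
def toricGrading (K : Type v) [Field K] (P : Set (V → ℝ)) (d : ℕ) :
    Submodule K (toricRing K P) :=
  (AddMonoidAlgebra.gradeBy K (AddMonoidHom.snd (V → ℤ) ℕ) d).comap (toricRing K P).val.toLinearMap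

instance toricGrading_gradedMonoid (K : Type v) [Field K] (P : Set (V → ℝ)) :
    SetLike.GradedMonoid (toricGrading K P) where
  one_mem := SetLike.GradedOne.one_mem
    (A := AddMonoidAlgebra.gradeBy K (AddMonoidHom.snd (V → ℤ) ℕ))
  mul_mem _ _ _ _ hx hy := SetLike.GradedMul.mul_mem
    (A := AddMonoidAlgebra.gradeBy K (AddMonoidHom.snd (V → ℤ) ℕ)) hx hy

theorem toricGrading_isInternal (K : Type v) [Field K] (P : Set (V → ℝ)) :
    DirectSum.IsInternal (toricGrading K P) := by
  rw [DirectSum.isInternal_submodule_iff_iSupIndep_and_iSup_eq_top]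
  constructor
  · have h := (AddMonoidAlgebra.gradeBy.isInternal (R := K)
      (AddMonoidHom.snd (V → ℤ) ℕ)).submodule_iSupIndep
    rw [iSupIndep_def] at h ⊢
    intro i
    rw [Submodule.disjoint_def]
    intro x hx hx'
    apply Subtype.ext
    refine Submodule.disjoint_def.1 (h i) x.1 hx ?_
    have := Submodule.mem_map_of_mem (f := (toricRing K P).val.toLinearMap) hx'
    simp only [Submodule.map_iSup] at this
    exact iSup₂_mono (fun j _ => Submodule.map_comap_le _ _) this
  · rw [eq_top_iff]
    rintro ⟨x, hx⟩ -
    have key : ∀ y ∈ Submonoid.closure (laurentMonomial K '' latticePoints P),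
        ∃ d, y ∈ AddMonoidAlgebra.gradeBy K (AddMonoidHom.snd (V → ℤ) ℕ) d := by
      intro y hy
      induction hy using Submonoid.closure_induction with
      | mem z hz =>
        obtain ⟨a, -, rfl⟩ := hz
        exact ⟨1, AddMonoidAlgebra.single_mem_gradeBy (AddMonoidHom.snd (V → ℤ) ℕ) (a, 1) 1⟩
      | one => exact ⟨0, SetLike.GradedOne.one_mem⟩
      | mul z w _ _ hz hw =>
        obtain ⟨d, hd⟩ := hz
        obtain ⟨e, he⟩ := hw
        exact ⟨d + e, SetLike.GradedMul.mul_mem hd he⟩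
    have hx' : x ∈ Submodule.span K
        (Submonoid.closure (laurentMonomial K '' latticePoints P) : Set (LaurentRing K V)) := by
      rw [← Algebra.adjoin_eq_span]; exact hx
    have : ∀ z ∈ Submodule.span K
        (Submonoid.closure (laurentMonomial K '' latticePoints P) : Set (LaurentRing K V)),
        z ∈ (⨆ d, toricGrading K P d).map (toricRing K P).val.toLinearMap := by
      intro z hz
      refine (Submodule.span_le.2 ?_) hz
      intro y hy
      obtain ⟨d, hd⟩ := key y hy
      have hyR : y ∈ toricRing K P := by
        have : y ∈ Submodule.span K (Submonoid.closure
          (laurentMonomial K '' latticePoints P) : Set (LaurentRing K V)) :=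
          Submodule.subset_span hy
        rw [← Algebra.adjoin_eq_span] at this
        exact this
      exact ⟨⟨y, hyR⟩, Submodule.mem_iSup_of_mem d hd, rfl⟩
    obtain ⟨w, hw, hwx⟩ := this x hx'
    have : w = ⟨x, hx⟩ := Subtype.ext hwx
    exact this ▸ hw

instance toricGrading_gradedAlgebra (K : Type v) [Field K] (P : Set (V → ℝ)) :
    GradedAlgebra (toricGrading K P) where
  toDecomposition := (toricGrading_isInternal K P).chooseDecomposition

end Toric

/-! ### Binomials, generators and Gröbner bases -/

section Ideals

variable {σ : Type u} {K : Type v} [Field K]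

/-- A binomial is a difference `y^α - y^β` of two distinct monomials. -/
def IsBinomial (f : MvPolynomial σ K) : Prop :=
  ∃ α β : σ →₀ ℕ, α ≠ β ∧ f = MvPolynomial.monomial α 1 - MvPolynomial.monomial β 1

/-- `S` is a set of binomials generating `I`. -/
def IsBinomialGenerators (I : Ideal (MvPolynomial σ K)) (S : Set (MvPolynomial σ K)) : Prop :=
  (∀ f ∈ S, IsBinomial f) ∧ Ideal.span S = I

/-- `MuEq I d` says that `μ(I)` is defined and equal to `d`: either `I = 0` and `d = 0`, or
`I ≠ 0` has a minimal (with respect to inclusion) set of binomial generators, and in every such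
set the maximum of the degrees of its elements is `d`. -/
def MuEq (I : Ideal (MvPolynomial σ K)) (d : ℕ) : Prop :=
  (I = ⊥ ∧ d = 0) ∨
    (I ≠ ⊥ ∧ (∃ S, Minimal (IsBinomialGenerators I) S) ∧
      ∀ S, Minimal (IsBinomialGenerators I) S → IsGreatest (MvPolynomial.totalDegree '' S) d)

/-- `I` is generated by quadratic binomials (the zero ideal by the empty set). -/
def IsGeneratedByQuadraticBinomials (I : Ideal (MvPolynomial σ K)) : Prop :=
  ∃ S, IsBinomialGenerators I S ∧ ∀ f ∈ S, f.IsHomogeneous 2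

/-- `B` is a Gröbner basis of `I` with respect to the monomial order `m`: it is a finite subset
of `I` whose leading terms generate the initial ideal of `I`. -/
def IsGroebnerBasis (m : MonomialOrder.{u, u} σ) (I : Ideal (MvPolynomial σ K))
    (B : Set (MvPolynomial σ K)) : Prop :=
  B.Finite ∧ B ⊆ I ∧
    Ideal.span (m.leadingTerm '' B) = Ideal.span (m.leadingTerm '' (I : Set (MvPolynomial σ K)))

/-- With respect to some monomial order, `I` has a Gröbner basis consisting of quadratic forms. -/
def HasQuadraticGroebnerBasis (I : Ideal (MvPolynomial σ K)) : Prop :=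
  ∃ (m : MonomialOrder.{u, u} σ) (B : Set (MvPolynomial σ K)),
    IsGroebnerBasis m I B ∧ ∀ f ∈ B, f.IsHomogeneous 2

end Ideals

/-! ### Koszul algebras -/

/-- A graded `K`-algebra `R = ⨁ 𝒜 d` (finitely generated, with `𝒜 0 = K`) is Koszul if its residue
field `R ⧸ R₊` has a linear free resolution
`⋯ → R(-2)^(b 2) → R(-1)^(b 1) → R^(b 0) → R ⧸ R₊ → 0` over `R`, that is, one in which all the
entries of the matrices of the differentials `δ i` lie in `𝒜 1`. -/
def IsKoszul {K : Type v} {R : Type u} [Field K] [CommRing R] [Algebra K R]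
    (𝒜 : ℕ → Submodule K R) [GradedAlgebra 𝒜] : Prop :=
  𝒜 0 = 1 ∧
  ∃ (b : ℕ → ℕ)
    (ε : (Fin (b 0) → R) →ₗ[R] R ⧸ (HomogeneousIdeal.irrelevant 𝒜).toIdeal)
    (δ : ∀ i : ℕ, (Fin (b (i + 1)) → R) →ₗ[R] (Fin (b i) → R)),
    Function.Surjective ε ∧ Function.Exact (δ 0) ε ∧
    (∀ i, Function.Exact (δ (i + 1)) (δ i)) ∧
    ∀ i j k, δ i (Pi.single j 1) k ∈ 𝒜 1

/-! ### Stable set polytopes and induced cycles -/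

section Graphs

variable {V : Type u}

/-- The stable set polytope `Q_G`: the convex hull of the indicator vectors of the stable sets. -/
def stableSetPolytope (G : SimpleGraph V) : Set (V → ℝ) :=
  convexHull ℝ {x | ∃ W : Set V, G.IsIndepSet W ∧ x = W.indicator (fun _ => 1)}

/-- The set of lengths of the induced cycles of `H`. -/
def inducedCycleLengths (H : SimpleGraph V) : Set ℕ :=
  {l | 3 ≤ l ∧ (SimpleGraph.cycleGraph l).IsIndContained H}

end Graphs

end StableSetToric

end

/-!
Let `H` be the complement of `G`, with color classes `p` and `¬ p`. The stable sets of `G` are the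
cliques of `H`, that is, the empty set, the vertices and the edges of `H`. Adding a vertex `none`
to each color class, joined to all vertices of the other class, turns them into the edges of a
bipartite graph `stableGraph G p`, and the toric ideal of the stable set polytope into the toric
ideal of the edge ring of that graph: two monomials have the same image if and only if, as
multisets of edges, they have the same degree at every vertex (`exponent_eq_iff_sameFiber`). A
chordless cycle of length at least five of the extended graph avoids the vertices `none`, so it is
an induced cycle of `H` (`mem_inducedCycleLengths_of_isChordlessCycle`).

*The formula for `μ`.* Two multisets of edges with the same degrees contain an alternating cycle.
If it is not everything, or if it has a chord, then a smaller move makes the multisets share an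
edge; so the ideal is generated by binomials of degree at most `k` if there are no chordless
cycles longer than `2 * k` (`le_span_binomial_of_not_isChordlessCycle`). Conversely, the two
perfect matchings of an induced cycle of length `2 * k` are a fiber of their own, in which the two
monomials have no common variable, so their binomial is not generated in lower degree
(`not_le_span_of_chordless`).

*Gröbner bases.* If all induced cycles of `H` have length four, then the extended graph is chordal
bipartite, and a doubly lexical ordering of its biadjacency matrix contains no submatrix with rows
`1 1` and `1 0` (`exists_gammaFree`). For such an ordering, sorting pairs of edges is a
terminating rewriting process with a unique normal form in every fiber, that is, a quadratic
Gröbner basis for a lexicographic order (`hasQuadraticGroebnerBasis_of_gammaFree`).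

*Koszulness.* A quadratic Gröbner basis makes the standard monomials a basis of the toric ring
with quadratic straightening relations. From these, the linear resolution of the residue field is
built one step at a time as in Schreyer's theorem: the syzygies of generators with leading terms
`y_x e_k` have leading terms `y_z (y_x e_k)` that are again linear
(`QuadraticStraightening.isKoszul`). Conversely, the first two steps of a linear resolution show
that the relations of a Koszul algebra are generated in degree two (`IsKoszul.ker_le_span`), which
closes the circle by the lower bound for `μ`.
-/

noncomputable section

namespace StableSetToric

universe u v w

open Finsupp (single mapDomain)

/-! ### Linear resolutions from quadratic straightening laws -/

section Resolution

open Finsupp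

variable {K : Type v} {R : Type u} {σ : Type w} [Field K] [CommRing R] [Algebra K R]

/-- The product `∏ i, y i ^ a i`: the value at `y` of the monomial with exponent `a`. -/
def mon (y : σ → R) (a : σ →₀ ℕ) : R := a.prod fun i n => y i ^ n

variable (K) in
/-- A quadratic straightening law for generators `y` of the `K`-algebra `R`: a basis of `R` formed
by the standard monomials, that is, those not divisible by certain monomials of degree two, such
that every monomial is a combination of standard monomials of the same degree that are not larger.
-/
structure QuadraticStraightening (m : MonomialOrder σ) (y : σ → R) where
  /-- The exponents of the standard monomials. -/
  std : Set (σ →₀ ℕ)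
  /-- The standard monomials form a `K`-basis of `R`. -/
  basis : Module.Basis std K R
  basis_apply : ∀ a : std, basis a = mon y a.1
  std_of_le : ∀ a b, b ∈ std → a ≤ b → a ∈ std
  /-- Every monomial that is not standard is divisible by one of degree two. -/
  exists_quadratic : ∀ a, a ∉ std →
    ∃ i j, single i 1 + single j 1 ≤ a ∧ single i 1 + single j 1 ∉ std
  straighten : ∀ a, mon y a ∈ Submodule.span K
    {r | ∃ c ∈ std, m.toSyn c ≤ m.toSyn a ∧ c.degree = a.degree ∧ r = mon y c}

theorem mon_add (y : σ → R) (a b : σ →₀ ℕ) : mon y (a + b) = mon y a * mon y b :=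
  Finsupp.prod_add_index' (fun _ => pow_zero _) fun _ _ _ => pow_add _ _ _

theorem mon_single (y : σ → R) (i : σ) : mon y (single i 1) = y i := by
  simp [mon]

theorem mon_zero (y : σ → R) : mon y 0 = 1 := by
  simp [mon]

variable {m : MonomialOrder σ} {y : σ → R} (P : QuadraticStraightening K m y)

namespace QuadraticStraightening

theorem zero_mem_std : (0 : σ →₀ ℕ) ∈ P.std := by
  by_contra h
  obtain ⟨i, j, hij, -⟩ := P.exists_quadratic 0 h
  have := hij i
  simp at this

/-- The `K`-span of the basis vectors `y^c e_k` of the free module `R^b` with `c` standard and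
`T k c`. -/
def monSpan {b : ℕ} (T : Fin b → (σ →₀ ℕ) → Prop) : Submodule K (Fin b → R) :=
  Submodule.span K {f | ∃ k c, c ∈ P.std ∧ T k c ∧ f = Pi.single k (mon y c)}

variable {P} in
theorem monSpan_mono {b : ℕ} {T T' : Fin b → (σ →₀ ℕ) → Prop}
    (h : ∀ k c, c ∈ P.std → T k c → T' k c) : P.monSpan T ≤ P.monSpan T' :=
  Submodule.span_mono fun _ ⟨k, c, hc, hT, hf⟩ => ⟨k, c, hc, h k c hc hT, hf⟩

variable {P} in
theorem single_mem_monSpan {b : ℕ} {T : Fin b → (σ →₀ ℕ) → Prop} {k : Fin b} {c : σ →₀ ℕ}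
    (hc : c ∈ P.std) (h : T k c) : Pi.single k (mon y c) ∈ P.monSpan T :=
  Submodule.subset_span ⟨k, c, hc, h, rfl⟩

/-- The vectors `y^c e_k` with `c` standard being a basis, such a vector is in `monSpan T` only if
`T k c`. -/
theorem of_single_mem_monSpan {b : ℕ} {T : Fin b → (σ →₀ ℕ) → Prop} {k : Fin b} {c : σ →₀ ℕ}
    (hc : c ∈ P.std) (h : Pi.single k (mon y c) ∈ P.monSpan T) : T k c := by
  classical
  let E := Pi.basis fun _ : Fin b => P.basis
  have hE : ∀ k (c : P.std), E ⟨k, c⟩ = Pi.single k (mon y c.1) := fun k c => by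
    rw [Pi.basis_apply, P.basis_apply]
  have hT : {f | ∃ k c, c ∈ P.std ∧ T k c ∧ f = Pi.single k (mon y c)}
      = E '' {p | T p.1 p.2.1} := by
    ext f
    constructor
    · rintro ⟨k, c, hc, h, rfl⟩
      exact ⟨⟨k, c, hc⟩, h, hE _ _⟩
    · rintro ⟨⟨k, c⟩, h, rfl⟩
      exact ⟨k, c.1, c.2, h, hE _ _⟩
  rw [monSpan, hT, ← hE k ⟨c, hc⟩, Module.Basis.mem_span_image] at h
  have : (⟨k, ⟨c, hc⟩⟩ : Σ _ : Fin b, P.std) ∈ (E.repr (E ⟨k, ⟨c, hc⟩⟩)).support := by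
    simp
  exact h this

theorem monSpan_true {b : ℕ} : P.monSpan (fun (_ : Fin b) _ => True) = ⊤ := by
  classical
  rw [eq_top_iff, ← (Pi.basis fun _ : Fin b => P.basis).span_eq, Submodule.span_le]
  rintro _ ⟨⟨k, c⟩, rfl⟩
  rw [Pi.basis_apply, P.basis_apply]
  exact single_mem_monSpan c.2 trivial

/-- Straightening in one coordinate of a free module. -/
theorem single_mon_mem {b : ℕ} (k : Fin b) (a : σ →₀ ℕ) :
    Pi.single k (mon y a) ∈ P.monSpan fun l c =>
      l = k ∧ m.toSyn c ≤ m.toSyn a ∧ c.degree = a.degree := by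
  have h := Submodule.mem_map_of_mem (f := LinearMap.single K (fun _ : Fin b => R) k)
    (P.straighten a)
  rw [Submodule.map_span] at h
  refine Submodule.span_mono ?_ h
  rintro _ ⟨_, ⟨c, hc, h1, h2, rfl⟩, rfl⟩
  exact ⟨k, c, hc, ⟨rfl, h1, h2⟩, rfl⟩

/-- Multiplying by a monomial and straightening does not increase monomials. -/
theorem mon_smul_mem {b : ℕ} {T T' : Fin b → (σ →₀ ℕ) → Prop} (a : σ →₀ ℕ)
    (h : ∀ k c, T k c → ∀ d, m.toSyn d ≤ m.toSyn (a + c) →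
      d.degree = a.degree + c.degree → T' k d)
    {f : Fin b → R} (hf : f ∈ P.monSpan T) : mon y a • f ∈ P.monSpan T' := by
  induction hf using Submodule.span_induction with
  | mem f hf =>
    obtain ⟨k, c, hc, hT, rfl⟩ := hf
    have : mon y a • (Pi.single k (mon y c) : Fin b → R) = Pi.single k (mon y (a + c)) := by
      rw [← Pi.single_smul, smul_eq_mul, mon_add]
    rw [this]
    refine monSpan_mono ?_ (P.single_mon_mem k (a + c))
    rintro l d - ⟨rfl, h1, h2⟩
    exact h _ c hT d h1 (by rw [h2, map_add])
  | zero => rw [smul_zero]; exact zero_mem _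
  | add f g _ _ hf hg => rw [smul_add]; exact add_mem hf hg
  | smul r f _ hf => rw [smul_comm]; exact Submodule.smul_mem _ _ hf

/-- The key by which vectors `y^c e_k` of a free module are compared, `a` being the sum of `c` and
the multidegree of `e_k`: first by the monomial order, then by the position `k`. -/
def key (m : MonomialOrder σ) {b : ℕ} (a : σ →₀ ℕ) (k : Fin b) : m.syn ×ₗ Fin b :=
  toLex (m.toSyn a, k)

theorem key_lt_key {b : ℕ} {a a' : σ →₀ ℕ} {k k' : Fin b} :
    key m a k < key m a' k' ↔ m.toSyn a < m.toSyn a' ∨ m.toSyn a = m.toSyn a' ∧ k < k' := by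
  simp [key, Prod.Lex.lt_iff]

theorem key_add_left {b : ℕ} {a a' d e : σ →₀ ℕ} {k k' : Fin b} (h : key m a k < key m a' k')
    (hd : m.toSyn d ≤ m.toSyn (e + a)) : key m d k < key m (e + a') k' := by
  rw [key_lt_key] at h ⊢
  simp only [map_add] at *
  rcases h with h | ⟨h, h'⟩
  · exact Or.inl (hd.trans_lt (by gcongr))
  · rcases hd.lt_or_eq with hd | hd
    · exact Or.inl (by rwa [h] at hd)
    · exact Or.inr ⟨by rw [hd, h], h'⟩

/-- A stage of the resolution: a free module `R^b`, the multidegrees `w k` of its basis vectors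
`e_k`, and the generators `g k x`, for `x ∈ W k`, of the image of the next differential. Each of
them is linear with leading term `y_x e_k`, and these leading terms generate all leading terms of
the image. -/
structure Stage where
  /-- the rank -/
  b : ℕ
  /-- the multidegrees of the basis vectors -/
  w : Fin b → σ →₀ ℕ
  /-- the variables `x` such that `y_x e_k` is a leading term -/
  W : Fin b → Set σ
  /-- the generators -/
  g : Fin b → σ → Fin b → R
  lead : ∀ k, ∀ x ∈ W k, g k x - Pi.single k (y x) ∈ P.monSpan fun l c =>
    c.degree = 1 ∧ key m (c + w l) l < key m (single x 1 + w k) k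
  /-- A nonzero element of the image has a term that is divisible by a leading term. -/
  indep : ∀ u ∈ Submodule.span R {f | ∃ k, ∃ x ∈ W k, f = g k x},
    u ∈ P.monSpan (fun l c => ∀ x ∈ W l, c x = 0) → u = 0

namespace Stage

variable {P}

/-- The submodule of `R^b` to be covered by the next differential. -/
def image (L : P.Stage) : Submodule R (Fin L.b → R) :=
  Submodule.span R {f | ∃ k, ∃ x ∈ L.W k, f = L.g k x}

section Next

variable (L : P.Stage) {b' : ℕ} (col : Fin b' → Fin L.b) (var : Fin b' → σ)

/-- The next differential, which maps the `n`-th basis vector to the generator with the index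
`(col n, var n)`. -/
def diff : (Fin b' → R) →ₗ[R] (Fin L.b → R) :=
  Fintype.linearCombination R fun n => L.g (col n) (var n)

theorem diff_single (n : Fin b') (r : R) :
    L.diff col var (Pi.single n r) = r • L.g (col n) (var n) := by
  classical
  simp [diff, Fintype.linearCombination_apply_single]

-- `col` and `var` enumerate the pairs `(k, x)` with `x ∈ W k` in lexicographic order.
variable [LinearOrder σ]
  (hmem : ∀ n, var n ∈ L.W (col n))
  (hsurj : ∀ k, ∀ x ∈ L.W k, ∃ n, col n = k ∧ var n = x)
  (hlt : ∀ n n', n < n' ↔ col n < col n' ∨ col n = col n' ∧ var n < var n')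

omit [LinearOrder σ] in
include hmem hsurj in
theorem range_diff : LinearMap.range (L.diff col var) = L.image := by
  rw [diff, Fintype.range_linearCombination, image]
  congr 1
  ext f
  constructor
  · rintro ⟨n, rfl⟩
    exact ⟨_, _, hmem n, rfl⟩
  · rintro ⟨k, x, hx, rfl⟩
    obtain ⟨n, rfl, rfl⟩ := hsurj k x hx
    exact ⟨n, rfl⟩

/-- The leading variables of the next stage. As in Schreyer's description of syzygies, `y_z` times
the generator with leading term `y_x e_k` can be rewritten if `z` precedes `x` in `W k`, since then
`y_z e_k` is a leading term too, or if `y_z y_x` is not standard. -/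
def nextW (n : Fin b') : Set σ :=
  {z | z ∈ L.W (col n) ∧ z < var n} ∪ {z | single z 1 + single (var n) 1 ∉ P.std}

/-- The multidegrees of the next stage: those of the leading terms of the generators. -/
def nextw (n : Fin b') : σ →₀ ℕ := single (var n) 1 + L.w (col n)

/-- The vector `y^c e_n` is normal if no leading term of the next stage divides it. -/
def Normal (n : Fin b') (c : σ →₀ ℕ) : Prop := ∀ z ∈ L.nextW col var n, c z = 0

variable {L col var}

/-- The leading term of the image of a normal vector is standard. -/
theorem Normal.add_mem_std {n : Fin b'} {c : σ →₀ ℕ} (h : L.Normal col var n c)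
    (hc : c ∈ P.std) : c + single (var n) 1 ∈ P.std := by
  classical
  by_contra hcon
  obtain ⟨i, j, hij, hn⟩ := P.exists_quadratic _ hcon
  by_cases hi : i = var n
  · subst hi
    have hj : single j 1 ≤ c := by
      rw [add_comm] at hij
      exact le_of_add_le_add_right hij
    have := h j (Or.inr (show single j 1 + single (var n) 1 ∉ P.std by rwa [add_comm]))
    have := hj j
    simp_all
  by_cases hj : j = var n
  · subst hj
    have hj : single i 1 ≤ c := le_of_add_le_add_right hij
    have := h i (Or.inr hn)
    have := hj i
    simp_all
  refine hn (P.std_of_le _ _ hc ?_)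
  intro k
  by_cases hk : k = var n
  · subst hk
    simp [hi, hj]
  · have := hij k
    simpa [Finsupp.single_apply, Ne.symm hk] using this

/-- The variable of `e_n` is the first variable of `W (col n)` that divides the leading term of the
image of a normal vector `y^c e_n`, so this leading term determines `n` and `c`. -/
theorem Normal.var_le {n : Fin b'} {c : σ →₀ ℕ} (h : L.Normal col var n c) {z : σ}
    (hz : z ∈ L.W (col n)) (hcz : (c + single (var n) 1 : σ →₀ ℕ) z ≠ 0) : var n ≤ z := by
  classical
  by_contra! hlt
  refine hcz ?_
  simp [h z (Or.inl ⟨hz, hlt⟩), hlt.ne']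

omit [LinearOrder σ] in
include hmem in
/-- The leading term of the image of a normal basis vector. -/
theorem diff_single_sub_mem (n : Fin b') (c : σ →₀ ℕ) :
    L.diff col var (Pi.single n (mon y c)) - Pi.single (col n) (mon y (c + single (var n) 1)) ∈
      P.monSpan fun l d => d.degree = c.degree + 1 ∧
        key m (d + L.w l) l < key m (c + L.nextw col var n) (col n) := by
  have h1 : L.diff col var (Pi.single n (mon y c))
      - Pi.single (col n) (mon y (c + single (var n) 1))
      = mon y c • (L.g (col n) (var n) - Pi.single (col n) (y (var n))) := by
    rw [diff_single, smul_sub, ← Pi.single_smul, mon_add, mon_single, smul_eq_mul]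
  rw [h1]
  refine P.mon_smul_mem c ?_ (L.lead (col n) (var n) (hmem n))
  rintro l e ⟨he, hk⟩ d hd hdeg
  refine ⟨by rw [hdeg, he], key_add_left hk ?_⟩
  rw [← add_assoc, map_add m.toSyn d, map_add m.toSyn (c + e)]
  gcongr

include hmem hsurj in
/-- Division by the generators: a vector `y^d e_l` is the sum of the image of a combination of
normal vectors, of leading terms not exceeding `y^d e_l`, and a remainder without terms divisible by
the leading terms of the generators. -/
theorem single_mem_sup (l : Fin L.b) (d : σ →₀ ℕ) (hd : d ∈ P.std) :
    Pi.single l (mon y d) ∈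
      (P.monSpan fun n c => L.Normal col var n c ∧ c.degree + 1 = d.degree ∧
        (key m (c + L.nextw col var n) (col n) < key m (d + L.w l) l ∨
          col n = l ∧ c + single (var n) 1 = d)).map ((L.diff col var).restrictScalars K) ⊔
      P.monSpan fun l c => ∀ x ∈ L.W l, c x = 0 := by
  classical
  induction hκ : key m (d + L.w l) l using WellFoundedLT.induction generalizing l d with
  | ind κ ih =>
  subst hκ
  by_cases hN : ∀ x ∈ L.W l, d x = 0
  · exact Submodule.mem_sup_right (single_mem_monSpan hd hN)
  push Not at hN
  have hfin : {x | x ∈ L.W l ∧ d x ≠ 0}.Finite :=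
    d.support.finite_toSet.subset fun x hx => by simpa using hx.2
  obtain ⟨x, ⟨hxW, hdx⟩, hxmin⟩ := hfin.exists_minimal hN
  have hxd : single x 1 ≤ d := by
    rw [Finsupp.single_le_iff]; omega
  obtain ⟨c, rfl⟩ : ∃ c, d = c + single x 1 := ⟨_, (tsub_add_cancel_of_le hxd).symm⟩
  obtain ⟨n, rfl, rfl⟩ := hsurj l x hxW
  have hc : c ∈ P.std := P.std_of_le _ _ hd (by simp)
  have hnorm : L.Normal col var n c := by
    rintro z (⟨hz, hlt⟩ | hz)
    · by_contra hcz
      exact hlt.not_ge (hxmin ⟨hz, by simp [hcz]⟩ hlt.le)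
    · by_contra hcz
      refine hz (P.std_of_le _ _ hd ?_)
      gcongr
      rw [Finsupp.single_le_iff]; omega
  have hlow := diff_single_sub_mem (L := L) hmem n c
  set S := (P.monSpan fun n' c' => L.Normal col var n' c' ∧
    c'.degree + 1 = (c + single (var n) 1).degree ∧
        (key m (c' + L.nextw col var n') (col n') <
            key m (c + single (var n) 1 + L.w (col n)) (col n) ∨
          col n' = col n ∧ c' + single (var n') 1 = c + single (var n) 1)).map
            ((L.diff col var).restrictScalars K) ⊔
      P.monSpan fun l c => ∀ x ∈ L.W l, c x = 0 with hS
  have h1 : L.diff col var (Pi.single n (mon y c)) ∈ S := by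
    exact Submodule.mem_sup_left
      ⟨_, single_mem_monSpan hc ⟨hnorm, by simp, Or.inr ⟨rfl, rfl⟩⟩, rfl⟩
  have h2 : L.diff col var (Pi.single n (mon y c))
      - Pi.single (col n) (mon y (c + single (var n) 1)) ∈ S := by
    refine Submodule.span_le.2 ?_ hlow
    rintro _ ⟨l, e, he, ⟨hdeg, hkey⟩, rfl⟩
    rw [nextw, ← add_assoc] at hkey
    refine (sup_le_sup_right (Submodule.map_mono (monSpan_mono ?_)) _ : _ ≤ S)
      (ih _ hkey l e he rfl)
    rintro n' c' hc' ⟨h, h', h''⟩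
    refine ⟨h, by rw [h', hdeg]; simp, Or.inl ?_⟩
    rcases h'' with h'' | ⟨rfl, rfl⟩
    · exact h''.trans hkey
    · rwa [nextw, ← add_assoc]
  simpa using sub_mem h1 h2

include hmem hlt in
/-- The differential is injective on the span of the normal basis vectors. -/
theorem eq_zero_of_diff_eq_zero {f : Fin b' → R} (hf : f ∈ P.monSpan (L.Normal col var))
    (h0 : L.diff col var f = 0) : f = 0 := by
  classical
  let E := Pi.basis fun _ : Fin b' => P.basis
  have hE : ∀ i, E i = Pi.single i.1 (mon y i.2.1) := fun i => by
    rw [Pi.basis_apply, P.basis_apply]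
  have hsupp : ∀ i ∈ (E.repr f).support, L.Normal col var i.1 i.2.1 := by
    have : P.monSpan (L.Normal col var) =
        Submodule.span K (E '' {i | L.Normal col var i.1 i.2.1}) := by
      rw [monSpan]
      congr 1
      ext f
      constructor
      · rintro ⟨k, c, hc, h, rfl⟩
        exact ⟨⟨k, c, hc⟩, h, hE _⟩
      · rintro ⟨⟨k, c⟩, h, rfl⟩
        exact ⟨k, c.1, c.2, h, hE _⟩
    rw [this, Module.Basis.mem_span_image] at hf
    exact fun i hi => hf hi
  by_contra hne
  have hnon : (E.repr f).support.Nonempty := by simpa using hne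
  -- the basis vector of `f` whose image has the largest leading term
  obtain ⟨i, hi, hmax⟩ := Finset.exists_max_image _
    (fun i : Σ _ : Fin b', P.std => key m (i.2.1 + L.nextw col var i.1) (col i.1)) hnon
  have hinj : ∀ j ∈ (E.repr f).support, j ≠ i →
      key m (j.2.1 + L.nextw col var j.1) (col j.1) <
        key m (i.2.1 + L.nextw col var i.1) (col i.1) := by
    intro j hj hji
    refine (hmax j hj).lt_of_ne fun h => hji ?_
    have hi' := hsupp i hi
    have hj' := hsupp j hj
    obtain ⟨n, c, hc⟩ := i
    obtain ⟨n', c', hc'⟩ := j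
    dsimp only at *
    have h' := congrArg ofLex h
    simp only [key, ofLex_toLex, Prod.mk.injEq, EmbeddingLike.apply_eq_iff_eq] at h'
    obtain ⟨h1, h2⟩ := h'
    rw [nextw, nextw, h2, ← add_assoc, ← add_assoc] at h1
    have h1 := add_right_cancel h1
    have hv : var n' = var n := by
      apply le_antisymm
      · refine hj'.var_le (h2 ▸ hmem n) ?_
        rw [h1]; simp
      · refine hi'.var_le (h2 ▸ hmem n') ?_
        rw [← h1]; simp
    have hn : n' = n := by
      rcases lt_trichotomy n' n with h | h | h
      · rw [hlt] at h; simp [h2, hv] at h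
      · exact h
      · rw [hlt] at h; simp [h2, hv] at h
    subst hn
    have := add_right_cancel h1
    subst this
    rfl
  set κ := key m (i.2.1 + L.nextw col var i.1) (col i.1) with hκ
  set S := P.monSpan fun l d => key m (d + L.w l) l < κ with hS
  have hlead : ∀ j, L.diff col var (E j) -
      Pi.single (col j.1) (mon y (j.2.1 + single (var j.1) 1)) ∈
      P.monSpan fun l d => key m (d + L.w l) l < key m (j.2.1 + L.nextw col var j.1) (col j.1) := by
    intro j
    rw [hE]
    exact monSpan_mono (fun _ _ _ h => h.2) (diff_single_sub_mem hmem j.1 j.2.1)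
  have hlow : ∀ j ∈ (E.repr f).support, j ≠ i → L.diff col var (E j) ∈ S := by
    intro j hj hji
    have h1 := hinj j hj hji
    have h2 : L.diff col var (E j)
        - Pi.single (col j.1) (mon y (j.2.1 + single (var j.1) 1)) ∈ S :=
      monSpan_mono (fun _ _ _ h => h.trans h1) (hlead j)
    have h3 : Pi.single (col j.1) (mon y (j.2.1 + single (var j.1) 1)) ∈ S := by
      refine single_mem_monSpan ((hsupp j hj).add_mem_std j.2.2) ?_
      rwa [nextw, ← add_assoc] at h1
    simpa using add_mem h2 h3
  have hsum : f = ∑ j ∈ (E.repr f).support, E.repr f j • E j :=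
    (E.linearCombination_repr f).symm
  have h1 : L.diff col var (E i) ∈ S := by
    have h2 : E.repr f i • L.diff col var (E i) ∈ S := by
      have h3 : ∑ j ∈ (E.repr f).support, E.repr f j • L.diff col var (E j) = 0 := by
        rw [← h0]
        conv_rhs => rw [hsum]
        rw [map_sum]
        exact Finset.sum_congr rfl fun j _ =>
          (((L.diff col var).restrictScalars K).map_smul _ _).symm
      rw [← Finset.add_sum_erase _ _ hi] at h3
      rw [eq_neg_of_add_eq_zero_left h3]
      refine neg_mem (Submodule.sum_mem _ fun j hj => Submodule.smul_mem _ _ ?_)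
      rw [Finset.mem_erase] at hj
      exact hlow j hj.2 hj.1
    exact (Submodule.smul_mem_iff _ (by simpa using hi)).1 h2
  have h2 : Pi.single (col i.1) (mon y (i.2.1 + single (var i.1) 1)) ∈ S := by
    simpa using sub_mem h1 (hlead i)
  have h3 := P.of_single_mem_monSpan ((hsupp i hi).add_mem_std i.2.2) h2
  rw [hκ, nextw, ← add_assoc] at h3
  exact lt_irrefl _ h3

include hmem hsurj hlt in
/-- The syzygies of the generators with prescribed leading terms: dividing `y_z` times a generator
by the generators leaves no remainder, and the quotients are linear. -/
theorem exists_linear_syzygy (n : Fin b') (z : σ) (hz : z ∈ L.nextW col var n) :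
    ∃ f : Fin b' → R, L.diff col var f = 0 ∧
      f - Pi.single n (y z) ∈ P.monSpan fun n' c => c.degree = 1 ∧
        key m (c + L.nextw col var n') n' < key m (single z 1 + L.nextw col var n) n := by
  classical
  set k := col n with hk
  set x := var n with hx
  set N := P.monSpan fun l c => ∀ x ∈ L.W l, c x = 0 with hN
  set T : Fin b' → (σ →₀ ℕ) → Prop := fun n' c => L.Normal col var n' c ∧ c.degree = 1 ∧
        key m (c + L.nextw col var n') n' < key m (single z 1 + L.nextw col var n) n with hT
  set S := (P.monSpan T).map ((L.diff col var).restrictScalars K) ⊔ N with hS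
  have hstep : ∀ l d, d ∈ P.std → d.degree = 2 →
      (key m (d + L.w l) l < key m (single z 1 + L.nextw col var n) k ∨
        l = k ∧ d = single z 1 + single x 1 ∧ z ∈ L.W k ∧ z < x) →
      Pi.single l (mon y d) ∈ S := by
    intro l d hd hdeg hor
    refine (sup_le_sup_right (Submodule.map_mono (monSpan_mono ?_)) _ : _ ≤ S)
      (single_mem_sup hmem hsurj l d hd)
    rintro n' c hc ⟨h1, h2, h3⟩
    refine ⟨h1, by omega, ?_⟩
    have hlt' : key m (c + L.nextw col var n') (col n') <
        key m (single z 1 + L.nextw col var n) k →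
        key m (c + L.nextw col var n') n' < key m (single z 1 + L.nextw col var n) n := by
      intro h
      rw [key_lt_key] at h ⊢
      refine h.imp_right fun h => ⟨h.1, ?_⟩
      rw [hlt]
      exact Or.inl h.2
    rcases hor with hor | ⟨rfl, rfl, hzW, hzx⟩
    · apply hlt'
      rcases h3 with h3 | ⟨rfl, rfl⟩
      · exact h3.trans hor
      · rwa [nextw, ← add_assoc]
    · rcases h3 with h3 | ⟨h3, h4⟩
      · apply hlt'
        have hw : single z 1 + L.nextw col var n = single z 1 + single x 1 + L.w k := by
          rw [nextw, ← add_assoc]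
        rwa [hw]
      · rw [key_lt_key]
        right
        constructor
        · rw [nextw, nextw, ← add_assoc, ← add_assoc, h4, h3]
        · rw [hlt]
          refine Or.inr ⟨h3, lt_of_le_of_lt (h1.var_le (h3 ▸ hzW) ?_) hzx⟩
          rw [h4]; simp
  have hlow : y z • (L.g k x - Pi.single k (y x)) ∈ S := by
    have h := P.mon_smul_mem (single z 1) (T' := fun l d => d.degree = 2 ∧
      key m (d + L.w l) l < key m (single z 1 + L.nextw col var n) k) ?_ (L.lead k x (hmem n))
    · rw [mon_single] at h
      refine Submodule.span_le.2 ?_ h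
      rintro _ ⟨l, d, hd, ⟨hdeg, hkey⟩, rfl⟩
      exact hstep l d hd hdeg (Or.inl hkey)
    · rintro l e ⟨he, hkey⟩ d hd hdeg
      refine ⟨by rw [hdeg, he]; simp, key_add_left hkey ?_⟩
      rw [← add_assoc, map_add m.toSyn d, map_add m.toSyn (_ + e)]
      gcongr
  have htop : Pi.single k (y z * y x) ∈ S := by
    have hyy : y z * y x = mon y (single z 1 + single x 1) := by
      rw [mon_add, mon_single, mon_single]
    rw [hyy]
    by_cases hstd : single z 1 + single x 1 ∈ P.std
    · refine hstep k _ hstd (by simp) (Or.inr ⟨rfl, rfl, ?_⟩)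
      rcases hz with hz | hz
      · exact hz
      · exact absurd hstd hz
    · refine Submodule.span_le.2 ?_ (P.single_mon_mem k _)
      rintro _ ⟨l, d, hd, ⟨rfl, hle, hdeg⟩, rfl⟩
      refine hstep _ d hd (by rw [hdeg]; simp) (Or.inl ?_)
      rw [key_lt_key, nextw, ← add_assoc, map_add, map_add m.toSyn (_ + _)]
      left
      gcongr
      refine hle.lt_of_ne fun h => hstd ?_
      rw [← m.toSyn.injective h]
      exact hd
  have hu : L.diff col var (Pi.single n (y z)) ∈ S := by
    have : L.diff col var (Pi.single n (y z))
        = y z • (L.g k x - Pi.single k (y x)) + Pi.single k (y z * y x) := by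
      rw [diff_single, smul_sub, ← Pi.single_smul, smul_eq_mul, sub_add_cancel]
    rw [this]
    exact add_mem hlow htop
  obtain ⟨_, ⟨p, hp, rfl⟩, ν, hν, hpν⟩ := Submodule.mem_sup.1 hu
  have hν0 : ν = 0 := by
    refine L.indep ν ?_ hν
    change ν ∈ L.image
    rw [← range_diff L col var hmem hsurj]
    refine ⟨Pi.single n (y z) - p, ?_⟩
    rw [map_sub, ← hpν]
    simp
  refine ⟨Pi.single n (y z) - p, ?_, ?_⟩
  · rw [map_sub, ← hpν, hν0]
    simp
  · rw [sub_sub_cancel_left]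
    exact neg_mem (monSpan_mono (fun _ _ _ h => h.2) hp)

end Next

/-- Every stage has a next one, and the differential between them is linear. -/
theorem exists_next [Finite σ] (L : P.Stage) :
    ∃ (L' : P.Stage) (δ : (Fin L'.b → R) →ₗ[R] (Fin L.b → R)),
      LinearMap.range δ = L.image ∧ LinearMap.ker δ = L'.image ∧
      ∀ j, δ (Pi.single j 1) ∈ P.monSpan fun _ c => c.degree = 1 := by
  classical
  let _ : LinearOrder σ := linearOrderOfSTO (WellOrderingRel (α := σ))
  have := Fintype.ofFinite σ
  let I := {p : Fin L.b ×ₗ σ // (ofLex p).2 ∈ L.W (ofLex p).1}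
  have : Fintype (Fin L.b ×ₗ σ) := inferInstanceAs (Fintype (Fin L.b × σ))
  let e := Fintype.orderIsoFinOfCardEq I rfl
  let col : Fin (Fintype.card I) → Fin L.b := fun n => (ofLex (e n).1).1
  let var : Fin (Fintype.card I) → σ := fun n => (ofLex (e n).1).2
  have hmem : ∀ n, var n ∈ L.W (col n) := fun n => (e n).2
  have hsurj : ∀ k, ∀ x ∈ L.W k, ∃ n, col n = k ∧ var n = x := fun k x hx =>
    ⟨e.symm ⟨toLex (k, x), hx⟩, by simp [col], by simp [var]⟩
  have hlt : ∀ n n', n < n' ↔ col n < col n' ∨ col n = col n' ∧ var n < var n' := by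
    intro n n'
    rw [← e.lt_iff_lt, ← Subtype.coe_lt_coe, Prod.Lex.lt_iff]
  choose! G hG0 hG using exists_linear_syzygy hmem hsurj hlt
  have hker : Submodule.span R {f | ∃ n, ∃ z ∈ L.nextW col var n, f = G n z}
      ≤ LinearMap.ker (L.diff col var) := by
    rw [Submodule.span_le]
    rintro _ ⟨n, z, hz, rfl⟩
    exact hG0 n z hz
  let L' : P.Stage :=
    { b := Fintype.card I
      w := L.nextw col var
      W := L.nextW col var
      g := G
      lead := hG
      indep := fun u hu hu' => eq_zero_of_diff_eq_zero hmem hlt hu' (hker hu) }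
  refine ⟨L', L.diff col var, range_diff L col var hmem hsurj, ?_, ?_⟩
  · refine le_antisymm (fun v hv => ?_) hker
    -- Divide `v` by the next syzygies; the remainder is normal and a cycle, hence zero.
    have : Fintype {p : Fin L'.b ×ₗ σ // (ofLex p).2 ∈ L'.W (ofLex p).1} := inferInstance
    let e' := Fintype.orderIsoFinOfCardEq {p : Fin L'.b ×ₗ σ // (ofLex p).2 ∈ L'.W (ofLex p).1} rfl
    have hmem' : ∀ n, (ofLex (e' n).1).2 ∈ L'.W (ofLex (e' n).1).1 := fun n => (e' n).2
    have hsurj' : ∀ k, ∀ x ∈ L'.W k, ∃ n, (ofLex (e' n).1).1 = k ∧ (ofLex (e' n).1).2 = x :=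
      fun k x hx => ⟨e'.symm ⟨toLex (k, x), hx⟩, by simp, by simp⟩
    have htop : v ∈ P.monSpan (fun (_ : Fin L'.b) _ => True) := by
      rw [monSpan_true]; trivial
    have hdiv : v ∈ (L'.image.restrictScalars K) ⊔
        P.monSpan fun l c => ∀ x ∈ L'.W l, c x = 0 := by
      refine Submodule.span_le.2 ?_ htop
      rintro _ ⟨l, d, hd, -, rfl⟩
      refine (sup_le_sup_right ?_ _ : _ ≤ (L'.image.restrictScalars K) ⊔
        P.monSpan fun l c => ∀ x ∈ L'.W l, c x = 0) (single_mem_sup hmem' hsurj' l d hd)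
      rintro _ ⟨p, -, rfl⟩
      rw [Submodule.restrictScalars_mem, ← range_diff L' _ _ hmem' hsurj']
      exact ⟨p, rfl⟩
    obtain ⟨p, hp, ν, hν, rfl⟩ := Submodule.mem_sup.1 hdiv
    have hp0 : L.diff col var p = 0 := hker hp
    have hν0 : ν = 0 := by
      refine eq_zero_of_diff_eq_zero hmem hlt hν ?_
      have := LinearMap.mem_ker.1 hv
      rwa [map_add, hp0, zero_add] at this
    rw [hν0, add_zero]
    exact hp
  · intro j
    rw [diff_single, one_smul]
    have h1 := monSpan_mono (T' := fun _ c => c.degree = 1) (fun _ _ _ h => h.1)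
      (L.lead (col j) (var j) (hmem j))
    have h2 : Pi.single (col j) (y (var j)) ∈
        P.monSpan (b := L.b) fun _ c => c.degree = 1 := by
      have := P.single_mon_mem (col j) (single (var j) 1)
      rw [mon_single] at this
      refine monSpan_mono ?_ this
      rintro _ _ - ⟨-, -, h⟩
      simpa using h
    simpa using add_mem h1 h2

variable (P) in
/-- The stage at which the resolved module is the residue field: the single basis vector of `R`,
with all the variables as leading terms. -/
def zero (hy : Ideal.span (Set.range y) ≠ ⊤) : P.Stage where
  b := 1
  w := 0
  W := fun _ => Set.univ
  g := fun _ x => Pi.single 0 (y x)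
  lead := by
    intro k x _
    rw [Subsingleton.elim k 0, sub_self]
    exact zero_mem _
  indep := by
    intro u hu hu'
    have h1 : u 0 ∈ Ideal.span (Set.range y) := by
      have := Submodule.mem_map_of_mem (f := LinearMap.proj (R := R) (φ := fun _ : Fin 1 => R) 0) hu
      rw [Submodule.map_span] at this
      refine Submodule.span_mono ?_ this
      rintro _ ⟨_, ⟨k, x, -, rfl⟩, rfl⟩
      exact ⟨x, by simp⟩
    have h2 : ∃ k : K, u 0 = algebraMap K R k := by
      refine Submodule.span_induction (p := fun u _ => ∃ k : K, u 0 = algebraMap K R k)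
        ?_ ?_ ?_ ?_ hu'
      · rintro _ ⟨k, c, -, h, rfl⟩
        have hc : c = 0 := by ext x; exact h x trivial
        refine ⟨1, ?_⟩
        rw [hc, mon_zero, Subsingleton.elim k 0]
        simp
      · exact ⟨0, by simp⟩
      · rintro f g - - ⟨a, ha⟩ ⟨b, hb⟩
        exact ⟨a + b, by simp [ha, hb]⟩
      · rintro r f - ⟨a, ha⟩
        exact ⟨r * a, by simp [ha, Algebra.smul_def]⟩
    obtain ⟨k, hk⟩ := h2
    have hk0 : k = 0 := by
      by_contra hk0
      refine hy (Ideal.eq_top_of_isUnit_mem _ (hk ▸ h1) ?_)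
      exact (IsUnit.mk0 k hk0).map (algebraMap K R)
    ext i
    rw [Subsingleton.elim i 0, hk, hk0]
    simp

variable (P) in
theorem mem_image_zero (hy : Ideal.span (Set.range y) ≠ ⊤) (f : Fin 1 → R) :
    f ∈ (zero P hy).image ↔ f 0 ∈ Ideal.span (Set.range y) := by
  change f ∈ Submodule.span R {g : Fin 1 → R | ∃ k : Fin 1, ∃ x ∈ Set.univ,
    g = Pi.single 0 (y x)} ↔ _
  constructor
  · intro hf
    have := Submodule.mem_map_of_mem (f := LinearMap.proj (R := R) (φ := fun _ : Fin 1 => R) 0) hf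
    rw [Submodule.map_span] at this
    refine Submodule.span_mono ?_ this
    rintro _ ⟨_, ⟨k, x, -, rfl⟩, rfl⟩
    exact ⟨x, by simp⟩
  · intro hf
    have hf' : f = LinearMap.single R (fun _ : Fin 1 => R) 0 (f 0) := by
      ext i
      rw [Subsingleton.elim i 0]
      simp
    rw [hf']
    have := Submodule.mem_map_of_mem (f := LinearMap.single R (fun _ : Fin 1 => R) 0) hf
    rw [Ideal.span, Submodule.map_span] at this
    refine Submodule.span_mono ?_ this
    rintro _ ⟨_, ⟨x, rfl⟩, rfl⟩
    exact ⟨0, x, trivial, rfl⟩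

end Stage

theorem mon_mem_grading (𝒜 : ℕ → Submodule K R) [GradedAlgebra 𝒜] (hy : ∀ i, y i ∈ 𝒜 1)
    (c : σ →₀ ℕ) : mon y c ∈ 𝒜 c.degree := by
  classical
  induction c using Finsupp.induction_linear with
  | zero => rw [mon_zero, map_zero]; exact SetLike.GradedOne.one_mem
  | add a b ha hb => rw [mon_add, map_add]; exact SetLike.GradedMul.mul_mem ha hb
  | single i n =>
    have : mon y (single i n) = y i ^ n := by simp [mon]
    rw [this, Finsupp.degree_single]
    simpa using SetLike.pow_mem_graded n (hy i)

include P in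
/-- Modulo the ideal generated by the variables, every element is a scalar. -/
theorem exists_sub_algebraMap_mem (r : R) :
    ∃ k : K, r - algebraMap K R k ∈ Ideal.span (Set.range y) := by
  have hr : r ∈ Submodule.span K (Set.range P.basis) := by
    rw [P.basis.span_eq]; trivial
  induction hr using Submodule.span_induction with
  | mem r hr =>
    obtain ⟨c, rfl⟩ := hr
    rw [P.basis_apply]
    by_cases hc : c.1 = 0
    · exact ⟨1, by rw [hc, mon_zero]; simp⟩
    · obtain ⟨i, hi⟩ := Finsupp.ne_iff.1 hc
      refine ⟨0, ?_⟩
      have hle : single i 1 ≤ c.1 := by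
        rw [Finsupp.single_le_iff]
        exact Nat.one_le_iff_ne_zero.2 hi
      rw [← tsub_add_cancel_of_le hle, mon_add, mon_single, map_zero, sub_zero]
      exact Ideal.mul_mem_left _ _ (Ideal.subset_span ⟨i, rfl⟩)
  | zero => exact ⟨0, by simp⟩
  | add r s _ _ hr hs =>
    obtain ⟨a, ha⟩ := hr
    obtain ⟨b, hb⟩ := hs
    refine ⟨a + b, ?_⟩
    rw [map_add, add_sub_add_comm]
    exact add_mem ha hb
  | smul a r _ hr =>
    obtain ⟨b, hb⟩ := hr
    refine ⟨a * b, ?_⟩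
    rw [map_mul, Algebra.smul_def, ← mul_sub]
    exact Ideal.mul_mem_left _ _ hb

include P in
/-- A standard graded algebra with a quadratic straightening law is Koszul. -/
theorem isKoszul [Finite σ] (𝒜 : ℕ → Submodule K R) [GradedAlgebra 𝒜] (hy : ∀ i, y i ∈ 𝒜 1) :
    IsKoszul 𝒜 := by
  classical
  set J := Ideal.span (Set.range y) with hJ
  set M := (HomogeneousIdeal.irrelevant 𝒜).toIdeal with hM
  have hmem : ∀ r, r ∈ M ↔ GradedRing.proj 𝒜 0 r = 0 := fun r =>
    HomogeneousIdeal.mem_irrelevant_iff 𝒜 r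
  have hJM : J ≤ M := by
    rw [hJ, Ideal.span_le]
    rintro _ ⟨i, rfl⟩
    rw [SetLike.mem_coe, hmem, GradedRing.proj_apply,
      DirectSum.decompose_of_mem_ne 𝒜 (hy i) one_ne_zero]
  have hzero : ∀ r ∈ 𝒜 0, r ∈ M → r = 0 := by
    intro r hr hrM
    rw [hmem, GradedRing.proj_apply, DirectSum.decompose_of_mem_same 𝒜 hr] at hrM
    exact hrM
  have hscal : ∀ k : K, algebraMap K R k ∈ 𝒜 0 := fun k =>
    SetLike.algebraMap_mem_graded 𝒜 k
  have hMJ : M ≤ J := by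
    intro r hr
    obtain ⟨k, hk⟩ := P.exists_sub_algebraMap_mem r
    have h1 : algebraMap K R k ∈ M := by
      have := sub_mem hr (hJM hk)
      simpa using this
    rw [hzero _ (hscal k) h1, sub_zero] at hk
    exact hk
  have hnt : Nontrivial R := by
    refine ⟨mon y 0, 0, ?_⟩
    have := P.basis.linearIndependent.ne_zero (R := K) ⟨0, P.zero_mem_std⟩
    rwa [P.basis_apply] at this
  have hJtop : J ≠ ⊤ := by
    intro h
    have h1 : (1 : R) ∈ M := hJM (h ▸ Submodule.mem_top)
    exact one_ne_zero (hzero 1 SetLike.GradedOne.one_mem h1)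
  refine ⟨le_antisymm ?_ ?_, ?_⟩
  · intro r hr
    obtain ⟨k, hk⟩ := P.exists_sub_algebraMap_mem r
    rw [Submodule.mem_one]
    exact ⟨k, (sub_eq_zero.1 (hzero _ (sub_mem hr (hscal k)) (hJM hk))).symm⟩
  · rw [Submodule.one_le]
    exact SetLike.GradedOne.one_mem
  choose next δ hrange hker hlin using fun L : P.Stage => L.exists_next
  let S : ℕ → P.Stage := fun n => Nat.rec (Stage.zero P hJtop) (fun _ => next) n
  refine ⟨fun n => (S n).b, (Submodule.mkQ M).comp (LinearMap.proj (0 : Fin 1)), fun n => δ (S n),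
    ?_, ?_, ?_, ?_⟩
  · exact (Submodule.mkQ_surjective M).comp (LinearMap.proj_surjective (0 : Fin 1))
  · rw [LinearMap.exact_iff, hrange]
    ext f
    change Submodule.Quotient.mk (p := M) (f (0 : Fin 1)) = 0 ↔ _
    rw [Submodule.Quotient.mk_eq_zero]
    rw [le_antisymm hMJ hJM]
    exact (Stage.mem_image_zero P hJtop f).symm
  · intro n
    rw [LinearMap.exact_iff, hrange, hker]
  · intro n j k
    have h := hlin (S n) j
    refine Submodule.span_induction (p := fun f _ => f k ∈ 𝒜 1) ?_ ?_ ?_ ?_ h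
    · rintro _ ⟨l, c, -, hc, rfl⟩
      by_cases hkl : k = l
      · subst hkl
        rw [Pi.single_eq_same, ← hc]
        exact mon_mem_grading 𝒜 hy c
      · rw [Pi.single_eq_of_ne hkl]
        exact zero_mem _
    · exact zero_mem _
    · exact fun f g _ _ hf hg => add_mem hf hg
    · exact fun r f _ hf => Submodule.smul_mem _ _ hf

end QuadraticStraightening
end Resolution

/-! ### Ideals of binomials -/

section BinomialIdeals

open MvPolynomial

variable {σ : Type u} {K : Type v} [Field K] {N : Type w} [AddCommMonoid N]

/-- `I` is the toric ideal of the map `e` on exponents: a polynomial belongs to `I` if and only if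
the sum of its coefficients over each fiber of `e` is zero. -/
def IsToricFor (I : Ideal (MvPolynomial σ K)) (e : (σ →₀ ℕ) →+ N) : Prop :=
  open Classical in ∀ f, f ∈ I ↔ ∀ a, ∑ b ∈ f.support with e b = e a, f.coeff b = 0

/-- The binomial `y^a - y^b`. -/
def binomial (K : Type v) [Field K] (a b : σ →₀ ℕ) : MvPolynomial σ K :=
  monomial a 1 - monomial b 1

theorem isHomogeneous_binomial {a b : σ →₀ ℕ} (h : a.degree = b.degree) :
    (binomial K a b).IsHomogeneous a.degree :=
  (isHomogeneous_monomial _ rfl).sub (isHomogeneous_monomial _ h.symm)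

theorem binomial_ne_zero {a b : σ →₀ ℕ} (h : a ≠ b) : binomial K a b ≠ 0 := by
  classical
  intro h0
  have := congrArg (coeff a) h0
  simp [binomial, coeff_monomial, h.symm] at this

theorem binomial_add_left (a b c : σ →₀ ℕ) :
    binomial K (c + a) (c + b) = monomial c 1 * binomial K a b := by
  simp [binomial, mul_sub, monomial_mul]

theorem binomial_add_binomial (a b c : σ →₀ ℕ) :
    binomial K a b + binomial K b c = binomial K a c := by
  simp [binomial]

namespace IsToricFor

variable {I : Ideal (MvPolynomial σ K)} {e : (σ →₀ ℕ) →+ N} (hI : IsToricFor I e)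
include hI

/-- An exponent of an element of a toric ideal is not alone in its fiber. -/
theorem exists_ne_mem_support {f : MvPolynomial σ K} (hf : f ∈ I) {a : σ →₀ ℕ}
    (ha : a ∈ f.support) : ∃ b ∈ f.support, b ≠ a ∧ e b = e a := by
  classical
  by_contra! h
  have h1 := (hI f).1 hf a
  have h2 : ({b ∈ f.support | e b = e a} : Finset _) = {a} := by
    ext b
    simp only [Finset.mem_filter, Finset.mem_singleton]
    constructor
    · rintro ⟨hb, he⟩
      by_contra hne
      exact h b hb hne he
    · rintro rfl
      exact ⟨ha, rfl⟩
  rw [h2, Finset.sum_singleton] at h1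
  exact (mem_support_iff.1 ha) h1

theorem binomial_mem_iff {a b : σ →₀ ℕ} : binomial K a b ∈ I ↔ e a = e b := by
  classical
  by_cases hab : a = b
  · simp [hab, binomial]
  have hsupp : (binomial K a b).support = {a, b} := by
    ext c
    simp only [binomial, mem_support_iff, coeff_sub, coeff_monomial, Finset.mem_insert,
      Finset.mem_singleton]
    by_cases hca : a = c
    · subst hca; simp [Ne.symm hab]
    · by_cases hcb : b = c
      · subst hcb; simp [hab]
      · simp [hca, hcb, Ne.symm hca, Ne.symm hcb]
  constructor
  · intro h
    obtain ⟨c, hc, hne, he⟩ := hI.exists_ne_mem_support h (a := a) (by rw [hsupp]; simp)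
    rw [hsupp, Finset.mem_insert, Finset.mem_singleton] at hc
    rcases hc with rfl | rfl
    · exact absurd rfl hne
    · exact he.symm
  · intro h
    rw [hI]
    intro c
    rw [hsupp, Finset.sum_filter, Finset.sum_pair hab, h]
    by_cases hc : e b = e c
    · simp [hc, binomial, coeff_monomial, hab, Ne.symm hab]
    · simp [hc]

/-- A toric ideal is spanned by its binomials. -/
theorem le_span_binomial :
    (I : Set (MvPolynomial σ K)) ⊆
      Submodule.span K {f | ∃ a b, a ≠ b ∧ e a = e b ∧ f = binomial K a b} := by
  classical
  intro f hf
  set S := Submodule.span K {f | ∃ a b, a ≠ b ∧ e a = e b ∧ f = binomial K a b}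
  -- `s z` is a fixed exponent in the fiber over `z`
  let s : N → σ →₀ ℕ := Function.invFun e
  have hs : ∀ a, e (s (e a)) = e a := fun a => Function.invFun_eq ⟨a, rfl⟩
  have hmem : ∀ a, (monomial a (1 : K) - monomial (s (e a)) 1) ∈ S := by
    intro a
    by_cases h : a = s (e a)
    · rw [← h, sub_self]; exact zero_mem _
    · exact Submodule.subset_span ⟨a, _, h, (hs a).symm, rfl⟩
  have h1 : f = ∑ a ∈ f.support, f.coeff a • (monomial a (1 : K) - monomial (s (e a)) 1)
      + ∑ a ∈ f.support, f.coeff a • monomial (s (e a)) (1 : K) := by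
    conv_lhs => rw [f.as_sum]
    rw [← Finset.sum_add_distrib]
    refine Finset.sum_congr rfl fun a _ => ?_
    rw [← smul_add, sub_add_cancel, smul_monomial, smul_eq_mul, mul_one]
  have h2 : ∑ a ∈ f.support, f.coeff a • monomial (s (e a)) (1 : K) = 0 := by
    rw [← Finset.sum_fiberwise_of_maps_to (g := e) (t := f.support.image e)
      fun a ha => Finset.mem_image_of_mem _ ha]
    refine Finset.sum_eq_zero fun z hz => ?_
    obtain ⟨a, -, rfl⟩ := Finset.mem_image.1 hz
    have : ∀ b ∈ f.support.filter (fun b => e b = e a),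
        f.coeff b • monomial (s (e b)) (1 : K) = f.coeff b • monomial (s (e a)) (1 : K) := by
      intro b hb
      rw [(Finset.mem_filter.1 hb).2]
    rw [Finset.sum_congr rfl this, ← Finset.sum_smul, (hI f).1 hf a, zero_smul]
  rw [h1, h2, add_zero]
  exact Submodule.sum_mem _ fun a _ => Submodule.smul_mem _ _ (hmem a)

/-- A toric ideal is generated by its binomials. -/
theorem span_binomial_eq :
    Ideal.span {f | ∃ a b, a ≠ b ∧ e a = e b ∧ f = binomial K a b} = I := by
  apply le_antisymm
  · rw [Ideal.span_le]
    rintro _ ⟨a, b, -, h, rfl⟩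
    exact hI.binomial_mem_iff.2 h
  · intro f hf
    exact Submodule.span_le_restrictScalars K _ _ (hI.le_span_binomial hf)

theorem exists_of_isBinomial {f : MvPolynomial σ K} (hf : IsBinomial f) (hfI : f ∈ I) :
    ∃ a b, a ≠ b ∧ e a = e b ∧ f = binomial K a b := by
  obtain ⟨a, b, hab, rfl⟩ := hf
  exact ⟨a, b, hab, hI.binomial_mem_iff.1 hfI, rfl⟩

/-- Homogeneous elements of `I` are combinations of homogeneous binomials in `I`. -/
theorem mem_span_binomial_of_isHomogeneous (he : ∀ a b, e a = e b → a.degree = b.degree)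
    {f : MvPolynomial σ K} (hf : f ∈ I) {d : ℕ} (hd : f.IsHomogeneous d) :
    f ∈ Submodule.span K
      {f | ∃ a b, a ≠ b ∧ e a = e b ∧ a.degree = d ∧ f = binomial K a b} := by
  have h1 := Submodule.mem_map_of_mem (f := homogeneousComponent d) (hI.le_span_binomial hf)
  rw [Submodule.map_span, homogeneousComponent_eq_self hd] at h1
  refine Submodule.span_le.2 ?_ h1
  rintro _ ⟨_, ⟨a, b, hab, h, rfl⟩, rfl⟩
  rw [homogeneousComponent_of_mem (isHomogeneous_binomial (he a b h))]
  split_ifs with hda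
  · exact Submodule.subset_span ⟨a, b, hab, h, hda.symm, rfl⟩
  · exact zero_mem _

end IsToricFor

/-- If `S` consists of homogeneous elements, then the homogeneous component of degree `d` of an
element of the ideal generated by `S` needs only the elements of `S` of degree at most `d`. -/
theorem homogeneousComponent_mem_span {S : Set (MvPolynomial σ K)}
    (hS : ∀ f ∈ S, f.IsHomogeneous f.totalDegree) {f : MvPolynomial σ K} (hf : f ∈ Ideal.span S)
    (d : ℕ) : homogeneousComponent d f ∈ Ideal.span {s ∈ S | s.totalDegree ≤ d} := by
  induction hf using Submodule.span_induction generalizing d with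
  | mem f hf =>
    rw [homogeneousComponent_of_mem (hS f hf)]
    split_ifs with h
    · exact Ideal.subset_span ⟨hf, h.ge⟩
    · exact zero_mem _
  | zero => rw [map_zero]; exact zero_mem _
  | add f g _ _ hf hg => rw [map_add]; exact add_mem (hf d) (hg d)
  | smul a f _ hf =>
    rw [smul_eq_mul]
    have h1 : a * f = ∑ i ∈ Finset.range (a.totalDegree + 1),
        ∑ j ∈ Finset.range (f.totalDegree + 1),
          homogeneousComponent i a * homogeneousComponent j f := by
      rw [← Finset.sum_mul_sum, sum_homogeneousComponent, sum_homogeneousComponent]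
    rw [h1, map_sum]
    refine Submodule.sum_mem _ fun i _ => ?_
    rw [map_sum]
    refine Submodule.sum_mem _ fun j _ => ?_
    rw [homogeneousComponent_of_mem ((homogeneousComponent_isHomogeneous i a).mul
      (homogeneousComponent_isHomogeneous j f))]
    split_ifs with h
    · refine Ideal.mul_mem_left _ _ (Ideal.span_mono ?_ (hf j))
      rintro s ⟨hs, hsj⟩
      exact ⟨hs, by omega⟩
    · exact zero_mem _

theorem exists_minimal_isBinomialGenerators [Finite σ] {I : Ideal (MvPolynomial σ K)}
    {S : Set (MvPolynomial σ K)} (hS : IsBinomialGenerators I S) :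
    ∃ S, Minimal (IsBinomialGenerators I) S := by
  have hfg : (Submodule.span (MvPolynomial σ K) S).FG := IsNoetherian.noetherian _
  rw [Submodule.fg_span_iff_fg_span_finset_subset] at hfg
  obtain ⟨T, hTS, hT⟩ := hfg
  obtain ⟨T', hT'⟩ := exists_minimal_of_wellFoundedLT
    (fun T : Finset (MvPolynomial σ K) => IsBinomialGenerators I T)
    ⟨T, fun f hf => hS.1 f (hTS hf), by rw [← hS.2]; exact hT.symm⟩
  refine ⟨T', hT'.1, fun U hU hUT => ?_⟩
  obtain ⟨U, rfl⟩ := (T'.finite_toSet.subset hUT).exists_finset_coe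
  exact_mod_cast hT'.2 hU (by exact_mod_cast hUT)

/-- The number `μ(I)` of a toric ideal is `d` if `I` is generated by binomials of degree at most
`d`, but not by elements of smaller degree. -/
theorem IsToricFor.muEq [Finite σ] {I : Ideal (MvPolynomial σ K)} {e : (σ →₀ ℕ) →+ N}
    (hI : IsToricFor I e) (he : ∀ a b, e a = e b → a.degree = b.degree) {d : ℕ}
    (hle : I ≤ Ideal.span {f | ∃ a b, e a = e b ∧ a.degree ≤ d ∧ f = binomial K a b})
    (hlt : ¬ I ≤ Ideal.span {f ∈ I | f.totalDegree < d}) : MuEq I d := by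
  have hdeg : ∀ {a b : σ →₀ ℕ}, a ≠ b → e a = e b → (binomial K a b).totalDegree = a.degree :=
    fun hab h => (isHomogeneous_binomial (he _ _ h)).totalDegree (binomial_ne_zero hab)
  refine Or.inr ⟨?_, ?_, ?_⟩
  · rintro rfl
    exact hlt bot_le
  · refine exists_minimal_isBinomialGenerators
      (S := {f | ∃ a b, a ≠ b ∧ e a = e b ∧ f = binomial K a b}) ⟨?_, hI.span_binomial_eq⟩
    rintro _ ⟨a, b, hab, -, rfl⟩
    exact ⟨a, b, hab, rfl⟩
  · intro S hS
    have hSI : ∀ f ∈ S, f ∈ I := fun f hf => by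
      rw [← hS.1.2]; exact Ideal.subset_span hf
    have hShom : ∀ f ∈ S, f.IsHomogeneous f.totalDegree := by
      intro f hf
      obtain ⟨a, b, hab, h, rfl⟩ := hI.exists_of_isBinomial (hS.1.1 f hf) (hSI f hf)
      rw [hdeg hab h]
      exact isHomogeneous_binomial (he a b h)
    have hSd : ∀ f ∈ S, f.totalDegree ≤ d := by
      have hT : IsBinomialGenerators I {f ∈ S | f.totalDegree ≤ d} := by
        refine ⟨fun f hf => hS.1.1 f hf.1, le_antisymm ?_ ?_⟩
        · rw [Ideal.span_le]
          exact fun f hf => hSI f hf.1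
        · refine hle.trans ?_
          rw [Ideal.span_le]
          rintro _ ⟨a, b, h, had, rfl⟩
          have h1 : binomial K a b ∈ Ideal.span S := by
            rw [hS.1.2]; exact hI.binomial_mem_iff.2 h
          have h2 := homogeneousComponent_mem_span hShom h1 a.degree
          rw [homogeneousComponent_eq_self (isHomogeneous_binomial (he a b h))] at h2
          refine Ideal.span_mono ?_ h2
          rintro s ⟨hs, hsa⟩
          exact ⟨hs, hsa.trans had⟩
      exact fun f hf => (hS.2 hT (fun f hf => hf.1) hf).2
    refine ⟨?_, ?_⟩
    · by_contra hcon
      refine hlt ?_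
      conv_lhs => rw [← hS.1.2]
      refine Ideal.span_mono fun f hf => ⟨hSI f hf, (hSd f hf).lt_of_ne fun h => hcon ⟨f, hf, h⟩⟩
    · rintro _ ⟨f, hf, rfl⟩
      exact hSd f hf

/-- A toric ideal has no elements of degree at most one if its variables lie in distinct fibers. -/
theorem IsToricFor.eq_zero_of_totalDegree_le_one {I : Ideal (MvPolynomial σ K)}
    {e : (σ →₀ ℕ) →+ N} (hI : IsToricFor I e) (he : ∀ a b, e a = e b → a.degree = b.degree)
    (hinj : ∀ i j, e (single i 1) = e (single j 1) → i = j)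
    {f : MvPolynomial σ K} (hf : f ∈ I) (hd : f.totalDegree < 2) : f = 0 := by
  by_contra hne
  obtain ⟨a, ha⟩ := Finset.nonempty_iff_ne_empty.2 (mt support_eq_empty.1 hne)
  obtain ⟨b, hb, hba, h⟩ := hI.exists_ne_mem_support hf ha
  have h1 : a.degree < 2 := (le_totalDegree ha).trans_lt hd
  have h2 := he _ _ h
  refine hba ?_
  rcases Nat.lt_succ_iff_lt_or_eq.1 h1 with h1 | h1
  · have ha0 : a = 0 := by rw [← Finsupp.degree_eq_zero_iff]; omega
    have hb0 : b = 0 := by rw [← Finsupp.degree_eq_zero_iff]; omega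
    rw [ha0, hb0]
  · have h3 : b.degree = 1 := h2.trans h1
    obtain ⟨i, rfl⟩ := (Set.ext_iff.1 Finsupp.range_single_one a).2 h1
    obtain ⟨j, rfl⟩ := (Set.ext_iff.1 Finsupp.range_single_one b).2 h3
    rw [hinj _ _ h]

end BinomialIdeals

/-! ### Quadratic Gröbner bases give quadratic straightening laws -/

section Groebner

open MvPolynomial

variable {σ : Type u} {K : Type v} [Field K] {R : Type w} [CommRing R] [Algebra K R]

theorem aeval_monomial_one (y : σ → R) (a : σ →₀ ℕ) :
    aeval y (monomial a (1 : K)) = mon y a := by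
  rw [aeval_monomial, map_one, one_mul, mon]

theorem exists_eq_add_of_degree_eq_two {a : σ →₀ ℕ} (ha : a.degree = 2) :
    ∃ i j, a = single i 1 + single j 1 := by
  have hne : a ≠ 0 := by rintro rfl; simp at ha
  obtain ⟨i, hi⟩ := Finsupp.ne_iff.1 hne
  have hle : single i 1 ≤ a := by
    rw [Finsupp.single_le_iff]; exact Nat.one_le_iff_ne_zero.2 hi
  obtain ⟨c, rfl⟩ := exists_add_of_le hle
  have hc : c.degree = 1 := by
    rw [map_add, Finsupp.degree_single] at ha; omega
  obtain ⟨j, rfl⟩ := (Set.ext_iff.1 Finsupp.range_single_one c).2 hc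
  exact ⟨i, j, rfl⟩

/-- An exponent divisible by the leading exponent of an element of `I` is divisible by the leading
exponent of an element of a Gröbner basis. -/
theorem IsGroebnerBasis.exists_degree_le {m : MonomialOrder.{u, u} σ}
    {I : Ideal (MvPolynomial σ K)} {B : Set (MvPolynomial σ K)} (hB : IsGroebnerBasis m I B)
    {f : MvPolynomial σ K} (hf : f ∈ I) (hf0 : f ≠ 0) :
    ∃ g ∈ B, g ≠ 0 ∧ m.degree g ≤ m.degree f := by
  classical
  have h1 : m.leadingTerm f ∈ Ideal.span (m.leadingTerm '' B) := by
    rw [hB.2.2]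
    exact Ideal.subset_span ⟨f, hf, rfl⟩
  have h2 : Ideal.span (m.leadingTerm '' B) ≤
      Ideal.span ((fun s => monomial s (1 : K)) '' (m.degree '' {g ∈ B | g ≠ 0})) := by
    rw [Ideal.span_le]
    rintro _ ⟨g, hg, rfl⟩
    by_cases hg0 : g = 0
    · simp [hg0, MonomialOrder.leadingTerm_zero]
    · have : m.leadingTerm g = C (m.leadingCoeff g) * monomial (m.degree g) 1 := by
        rw [C_mul_monomial, mul_one]; rfl
      rw [this]
      exact Ideal.mul_mem_left _ _ (Ideal.subset_span ⟨_, ⟨g, ⟨hg, hg0⟩, rfl⟩, rfl⟩)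
  have h3 := mem_ideal_span_monomial_image.1 (h2 h1) (m.degree f) (by
    rw [MonomialOrder.support_leadingTerm' hf0]; simp)
  obtain ⟨_, ⟨g, ⟨hg, hg0⟩, rfl⟩, hle⟩ := h3
  exact ⟨g, hg, hg0, hle⟩

/-- A quotient of a polynomial ring by an ideal with a Gröbner basis of quadratic forms has a
quadratic straightening law, whose standard monomials are those outside the initial ideal. -/
theorem IsGroebnerBasis.exists_quadraticStraightening {m : MonomialOrder.{u, u} σ} {y : σ → R}
    (hy : Function.Surjective (aeval (R := K) y)) {B : Set (MvPolynomial σ K)}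
    (hB : IsGroebnerBasis m (RingHom.ker (aeval (R := K) y)) B)
    (hB2 : ∀ f ∈ B, f.IsHomogeneous 2) : Nonempty (QuadraticStraightening K m y) := by
  classical
  set I := RingHom.ker (aeval (R := K) y) with hI
  let std : Set (σ →₀ ℕ) := {a | ∀ f ∈ I, f ≠ 0 → ¬ m.degree f ≤ a}
  have hdiv : ∀ a, a ∉ std → ∃ g ∈ B, g ≠ 0 ∧ m.degree g ≤ a := by
    intro a ha
    simp only [std, Set.mem_ofPred_eq, not_forall, not_not] at ha
    obtain ⟨f, hf, hf0, hfa⟩ := ha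
    obtain ⟨g, hg, hg0, hgf⟩ := hB.exists_degree_le hf hf0
    exact ⟨g, hg, hg0, hgf.trans hfa⟩
  have hdeg : ∀ g ∈ B, ∀ b ∈ g.support, b.degree = 2 := by
    intro g hg b hb
    by_contra h
    exact mem_support_iff.1 hb ((hB2 g hg).coeff_eq_zero h)
  have hstr : ∀ a, mon y a ∈ Submodule.span K
      {r | ∃ c ∈ std, m.toSyn c ≤ m.toSyn a ∧ c.degree = a.degree ∧ r = mon y c} := by
    intro a
    induction hκ : m.toSyn a using WellFoundedLT.induction generalizing a with
    | ind κ ih =>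
    subst hκ
    by_cases ha : a ∈ std
    · exact Submodule.subset_span ⟨a, ha, le_rfl, rfl, rfl⟩
    obtain ⟨g, hg, hg0, hga⟩ := hdiv a ha
    obtain ⟨c, rfl⟩ := exists_add_of_le hga
    set d := m.degree g with hd
    have hdg : d ∈ g.support := m.degree_mem_support hg0
    have h0 : mon y c * aeval y g = 0 := by
      have h : aeval y g = 0 := hB.2.1 hg
      rw [h, mul_zero]
    have h1 : ∑ b ∈ g.support, g.coeff b • mon y (b + c) = 0 := by
      rw [← h0]
      conv_rhs => rw [g.as_sum]
      rw [map_sum, Finset.mul_sum]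
      refine Finset.sum_congr rfl fun b _ => ?_
      have : monomial b (g.coeff b) = g.coeff b • monomial b (1 : K) := by
        rw [smul_monomial, smul_eq_mul, mul_one]
      rw [this, map_smul, aeval_monomial_one, mon_add, mul_smul_comm, mul_comm]
    rw [← Finset.add_sum_erase _ _ hdg] at h1
    refine (Submodule.smul_mem_iff _ (mem_support_iff.1 hdg)).1 ?_
    rw [eq_neg_of_add_eq_zero_left h1]
    refine neg_mem (Submodule.sum_mem _ fun b hb => Submodule.smul_mem _ _ ?_)
    rw [Finset.mem_erase] at hb
    have hlt : m.toSyn (b + c) < m.toSyn (d + c) := by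
      rw [map_add, map_add]
      gcongr
      exact (m.le_degree hb.2).lt_of_ne fun h => hb.1 (m.toSyn.injective h)
    refine Submodule.span_mono ?_ (ih _ hlt _ rfl)
    rintro _ ⟨e, he, h1, h2, rfl⟩
    exact ⟨e, he, h1.trans hlt.le, by
      rw [h2, map_add, map_add, hdeg g hg b hb.2, hdeg g hg d hdg], rfl⟩
  -- a linear relation of standard monomials would be an element of `I` with standard leading term
  have hli : LinearIndependent K fun a : std => mon y a.1 := by
    rw [linearIndependent_iff]
    intro l hl
    by_contra hl0
    let f : MvPolynomial σ K := l.sum fun a c => monomial a.1 c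
    have hcoeff : ∀ a : std, f.coeff a.1 = l a := by
      intro a
      simp only [f, Finsupp.sum, coeff_sum, coeff_monomial]
      rw [Finset.sum_eq_single a]
      · simp
      · intro b _ hb
        rw [if_neg fun h => hb (Subtype.ext h)]
      · intro ha
        simpa using ha
    have hsupp : ∀ a ∈ f.support, a ∈ std := by
      intro a ha
      by_contra hastd
      refine mem_support_iff.1 ha ?_
      simp only [f, Finsupp.sum, coeff_sum, coeff_monomial]
      refine Finset.sum_eq_zero fun b _ => if_neg ?_
      rintro rfl
      exact hastd b.2
    have hf0 : f ≠ 0 := by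
      obtain ⟨a, ha⟩ := Finsupp.ne_iff.1 hl0
      intro h
      refine ha ?_
      rw [← hcoeff a, h]
      simp
    have hfI : f ∈ I := by
      rw [hI, RingHom.mem_ker, ← hl, Finsupp.linearCombination_apply]
      simp only [f, Finsupp.sum, map_sum]
      refine Finset.sum_congr rfl fun a _ => ?_
      have : monomial a.1 (l a) = l a • monomial a.1 (1 : K) := by
        rw [smul_monomial, smul_eq_mul, mul_one]
      rw [this, map_smul, aeval_monomial_one]
    exact hsupp _ (m.degree_mem_support hf0) f hfI hf0 le_rfl
  have hspan : ⊤ ≤ Submodule.span K (Set.range fun a : std => mon y a.1) := by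
    rintro r -
    obtain ⟨f, rfl⟩ := hy r
    rw [f.as_sum, map_sum]
    refine Submodule.sum_mem _ fun a _ => ?_
    have : monomial a (f.coeff a) = f.coeff a • monomial a (1 : K) := by
      rw [smul_monomial, smul_eq_mul, mul_one]
    rw [this, map_smul, aeval_monomial_one]
    refine Submodule.smul_mem _ _ (Submodule.span_mono ?_ (hstr a))
    rintro _ ⟨c, hc, -, -, rfl⟩
    exact ⟨⟨c, hc⟩, rfl⟩
  exact ⟨{
    std := std
    basis := Module.Basis.mk hli hspan
    basis_apply := fun a => by rw [Module.Basis.mk_apply]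
    std_of_le := fun a b hb hab f hf hf0 h => hb f hf hf0 (h.trans hab)
    exists_quadratic := by
      intro a ha
      obtain ⟨g, hg, hg0, hga⟩ := hdiv a ha
      obtain ⟨i, j, hij⟩ :=
        exists_eq_add_of_degree_eq_two (hdeg g hg _ (m.degree_mem_support hg0))
      exact ⟨i, j, hij ▸ hga, fun h => h g (hB.2.1 hg) hg0 hij.le⟩
    straighten := hstr }⟩

end Groebner

/-! ### Ideals of relations of Koszul algebras -/

section KoszulRelations

open MvPolynomial

variable {σ : Type u} {K : Type v} [Field K] {R : Type w} [CommRing R] [Algebra K R]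
  (𝒜 : ℕ → Submodule K R) [GradedAlgebra 𝒜] {y : σ → R}

variable {𝒜} in
theorem aeval_mem_grading (hy : ∀ i, y i ∈ 𝒜 1) {f : MvPolynomial σ K} {d : ℕ}
    (hf : f.IsHomogeneous d) : aeval y f ∈ 𝒜 d := by
  rw [f.as_sum, map_sum]
  refine Submodule.sum_mem _ fun a ha => ?_
  have : monomial a (f.coeff a) = f.coeff a • monomial a (1 : K) := by
    rw [smul_monomial, smul_eq_mul, mul_one]
  rw [this, map_smul, aeval_monomial_one]
  have had : a.degree = d := by
    by_contra h
    exact mem_support_iff.1 ha (hf.coeff_eq_zero h)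
  exact had ▸ Submodule.smul_mem _ _ (QuadraticStraightening.mon_mem_grading 𝒜 hy a)

variable {𝒜} in
theorem exists_isHomogeneous_aeval_eq (hy : ∀ i, y i ∈ 𝒜 1)
    (hsurj : Function.Surjective (aeval (R := K) y)) {d : ℕ} {r : R} (hr : r ∈ 𝒜 d) :
    ∃ f : MvPolynomial σ K, f.IsHomogeneous d ∧ aeval y f = r := by
  classical
  obtain ⟨f, rfl⟩ := hsurj r
  refine ⟨homogeneousComponent d f, homogeneousComponent_isHomogeneous d f, ?_⟩
  have h1 : aeval y f =
      ∑ i ∈ Finset.range (f.totalDegree + 1), aeval y (homogeneousComponent i f) := by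
    rw [← map_sum, sum_homogeneousComponent]
  have h2 := DirectSum.decompose_of_mem_same 𝒜 hr
  rw [← h2, h1, DirectSum.decompose_sum, DFinsupp.finsetSum_apply, AddSubmonoidClass.coe_finsetSum]
  by_cases hd : d ∈ Finset.range (f.totalDegree + 1)
  · rw [Finset.sum_eq_single_of_mem d hd]
    · rw [DirectSum.decompose_of_mem_same 𝒜
        (aeval_mem_grading hy (homogeneousComponent_isHomogeneous d f))]
    · intro i _ hi
      rw [DirectSum.decompose_of_mem_ne 𝒜
        (aeval_mem_grading hy (homogeneousComponent_isHomogeneous i f)) hi]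
  · rw [Finset.sum_eq_zero, homogeneousComponent_eq_zero, map_zero]
    · simpa [Nat.lt_succ_iff] using hd
    · intro i hi
      rw [DirectSum.decompose_of_mem_ne 𝒜
        (aeval_mem_grading hy (homogeneousComponent_isHomogeneous i f))]
      rintro rfl
      exact hd hi

/-- If the linear forms `ℓ j` span all linear forms, then forms of positive degree are combinations
of the `ℓ j`. -/
theorem exists_eq_sum_mul {ι : Type*} [Fintype ι] {ℓ : ι → MvPolynomial σ K}
    (hℓ : ∀ i, X i ∈ Submodule.span K (Set.range ℓ)) {f : MvPolynomial σ K} {d : ℕ}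
    (hf : f.IsHomogeneous (d + 1)) :
    ∃ g : ι → MvPolynomial σ K, (∀ j, (g j).IsHomogeneous d) ∧ f = ∑ j, g j * ℓ j := by
  classical
  let T : Submodule K (MvPolynomial σ K) :=
    { carrier := {f | ∃ g : ι → MvPolynomial σ K, (∀ j, (g j).IsHomogeneous d) ∧
        f = ∑ j, g j * ℓ j}
      zero_mem' := ⟨0, fun _ => isHomogeneous_zero _ _ _, by simp⟩
      add_mem' := by
        rintro _ _ ⟨g, hg, rfl⟩ ⟨h, hh, rfl⟩
        exact ⟨g + h, fun j => (hg j).add (hh j), by simp [add_mul, Finset.sum_add_distrib]⟩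
      smul_mem' := by
        rintro c _ ⟨g, hg, rfl⟩
        refine ⟨c • g, fun j => ?_, by simp [Finset.smul_sum]⟩
        exact (homogeneousSubmodule σ K d).smul_mem c (hg j) }
  change f ∈ T
  rw [f.as_sum]
  refine Submodule.sum_mem _ fun a ha => ?_
  have had : a.degree = d + 1 := by
    by_contra h
    exact mem_support_iff.1 ha (hf.coeff_eq_zero h)
  have hne : a ≠ 0 := by rintro rfl; simp at had
  obtain ⟨i, hi⟩ := Finsupp.ne_iff.1 hne
  have hle : single i 1 ≤ a := by
    rw [Finsupp.single_le_iff]; exact Nat.one_le_iff_ne_zero.2 hi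
  obtain ⟨c, rfl⟩ := exists_add_of_le hle
  have hc : c.degree = d := by
    rw [map_add, Finsupp.degree_single] at had; omega
  obtain ⟨k, hk⟩ := (Submodule.mem_span_range_iff_exists_fun K).1 (hℓ i)
  have h1 : monomial (single i 1 + c) (f.coeff (single i 1 + c)) =
      f.coeff (single i 1 + c) • (monomial c 1 * X i) := by
    rw [X, monomial_mul, smul_monomial, smul_eq_mul, mul_one, mul_one, add_comm]
  rw [h1]
  refine T.smul_mem _ ⟨fun j => k j • monomial c 1, fun j => ?_, ?_⟩
  · exact (homogeneousSubmodule σ K d).smul_mem _ (isHomogeneous_monomial _ hc)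
  · rw [← hk, Finset.mul_sum]
    simp

/-- The relations of a Koszul algebra are generated in degree two: a relation `∑ g_j ℓ_j`, where the
`ℓ_j` generate the irrelevant ideal, gives a syzygy of the `ℓ_j`, which is a combination of linear
syzygies, and a linear syzygy gives a relation of degree two. -/
theorem IsKoszul.ker_le_span (hK : IsKoszul 𝒜) (hy : ∀ i, y i ∈ 𝒜 1)
    (hsurj : Function.Surjective (aeval (R := K) y))
    (hdeg : ∀ f ∈ RingHom.ker (aeval (R := K) y), f.totalDegree < 2 → f = 0)
    {f : MvPolynomial σ K} (hf : f ∈ RingHom.ker (aeval (R := K) y)) {d : ℕ}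
    (hd : f.IsHomogeneous d) :
    f ∈ Ideal.span {g | g ∈ RingHom.ker (aeval (R := K) y) ∧ g.IsHomogeneous 2} := by
  classical
  set I := RingHom.ker (aeval (R := K) y) with hI
  set Q := Ideal.span {g | g ∈ I ∧ g.IsHomogeneous 2} with hQ
  unfold IsKoszul at hK
  set M := (HomogeneousIdeal.irrelevant 𝒜).toIdeal with hM
  obtain ⟨h0, b, ε, δ, hε, hδ0, hδ, hlin⟩ := hK
  have hmem : ∀ r, r ∈ M ↔ GradedRing.proj 𝒜 0 r = 0 := fun r =>
    HomogeneousIdeal.mem_irrelevant_iff 𝒜 r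
  have hM1 : ∀ r ∈ 𝒜 1, r ∈ M := by
    intro r hr
    rw [hmem, GradedRing.proj_apply, DirectSum.decompose_of_mem_ne 𝒜 hr one_ne_zero]
  have hscal : ∀ k : K, algebraMap K R k ∈ M → k = 0 := by
    intro k hk
    rw [hmem, GradedRing.proj_apply,
      DirectSum.decompose_of_mem_same 𝒜 (SetLike.algebraMap_mem_graded 𝒜 k)] at hk
    have h1 : C k ∈ I := by rw [hI, RingHom.mem_ker, aeval_C, hk]
    have h2 := hdeg _ h1 (by simp)
    simpa using h2
  have hone : (1 : R) ∉ M := by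
    intro h
    exact one_ne_zero (hscal 1 (by rwa [map_one]))
  have hdecomp : ∀ r : R, ∃ k : K, r - algebraMap K R k ∈ M := by
    intro r
    have h1 : GradedRing.proj 𝒜 0 r ∈ 𝒜 0 := by
      rw [GradedRing.proj_apply]; exact SetLike.coe_mem _
    rw [h0, Submodule.mem_one] at h1
    obtain ⟨k, hk⟩ := h1
    refine ⟨k, ?_⟩
    rw [hmem, map_sub, hk, sub_eq_zero]
    conv_rhs => rw [GradedRing.proj_apply]
    rw [DirectSum.decompose_of_mem_same 𝒜]
    rw [GradedRing.proj_apply]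
    exact SetLike.coe_mem _
  have happly : ∀ i v k, δ i v k = ∑ j, v j * δ i (Pi.single j 1) k := by
    intro i v k
    conv_lhs => rw [pi_eq_sum_univ' v, map_sum, Finset.sum_apply]
    refine Finset.sum_congr rfl fun j _ => ?_
    rw [map_smul, Pi.smul_apply, smul_eq_mul]
  have hkerε : ∀ v, ε v = 0 → ∀ k, v k ∈ M := by
    intro v hv k
    obtain ⟨u, rfl⟩ := (hδ0 v).1 hv
    rw [happly]
    exact Ideal.sum_mem _ fun j _ => Ideal.mul_mem_left _ _ (hM1 _ (hlin 0 j k))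
  have hεsmul : ∀ r ∈ M, ∀ v, ε (r • v) = 0 := by
    intro r hr v
    rw [map_smul]
    obtain ⟨s, hs⟩ := Submodule.Quotient.mk_surjective M (ε v)
    rw [← hs, ← Submodule.Quotient.mk_smul, Submodule.Quotient.mk_eq_zero, smul_eq_mul]
    exact Ideal.mul_mem_right _ _ hr
  have hεsingle : ∀ k, ∃ c : K, ε (Pi.single k 1) = Submodule.Quotient.mk (algebraMap K R c) := by
    intro k
    obtain ⟨s, hs⟩ := Submodule.Quotient.mk_surjective M (ε (Pi.single k 1))
    obtain ⟨c, hc⟩ := hdecomp s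
    exact ⟨c, by rw [← hs, Submodule.Quotient.eq]; exact hc⟩
  choose c hc using hεsingle
  have hc0 : ∀ k, c k ≠ 0 := by
    intro k hk
    have h1 : ε (Pi.single k 1) = 0 := by rw [hc, hk, map_zero]; rfl
    have h2 := hkerε _ h1 k
    rw [Pi.single_eq_same] at h2
    exact hone h2
  -- the first free module has rank one, since the residue field is one-dimensional
  have hsub : ∀ k l : Fin (b 0), k = l := by
    intro k l
    by_contra hkl
    have h1 : ε (algebraMap K R (c l) • Pi.single k 1 -
        algebraMap K R (c k) • Pi.single l 1) = 0 := by
      rw [map_sub, map_smul, map_smul, hc, hc, ← Submodule.Quotient.mk_smul,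
        ← Submodule.Quotient.mk_smul, smul_eq_mul, smul_eq_mul, mul_comm, sub_self]
    have h2 := hkerε _ h1 k
    rw [Pi.sub_apply, Pi.smul_apply, Pi.smul_apply, Pi.single_eq_same, Pi.single_eq_of_ne hkl,
      smul_zero, sub_zero, smul_eq_mul, mul_one] at h2
    exact hc0 l (hscal _ h2)
  have hne : Nonempty (Fin (b 0)) := by
    by_contra hemp
    rw [not_nonempty_iff] at hemp
    obtain ⟨v, hv⟩ := hε (Submodule.Quotient.mk 1)
    rw [Subsingleton.elim v 0, map_zero, eq_comm, Submodule.Quotient.mk_eq_zero] at hv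
    exact hone hv
  obtain ⟨k₀⟩ := hne
  choose ℓ hℓ1 hℓ using fun j => exists_isHomogeneous_aeval_eq hy hsurj (hlin 0 j k₀)
  choose t ht1 ht using fun l j => exists_isHomogeneous_aeval_eq hy hsurj (hlin 1 l j)
  -- in an equation with linear coefficients, the other factors can be replaced by their components
  have hcoeff : ∀ {d n : ℕ} {v : R} {u s : Fin n → R}, v ∈ 𝒜 (d + 1) → (∀ j, s j ∈ 𝒜 1) →
      v = ∑ j, u j * s j → v = ∑ j, (DirectSum.decompose 𝒜 (u j) d : R) * s j := by
    intro d n v u s hv hs h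
    rw [← DirectSum.decompose_of_mem_same 𝒜 hv]
    conv_lhs => rw [h, DirectSum.decompose_sum, DFinsupp.finsetSum_apply,
      AddSubmonoidClass.coe_finsetSum]
    exact Finset.sum_congr rfl fun j _ => DirectSum.coe_decompose_mul_add_of_right_mem 𝒜 (hs j)
  -- the entries of the first differential span the linear forms
  have hX : ∀ i, X i ∈ Submodule.span K (Set.range ℓ) := by
    intro i
    have h1 : ε (Pi.single k₀ (y i)) = 0 := by
      have := hεsmul (y i) (hM1 _ (hy i)) (Pi.single k₀ 1)
      rwa [← Pi.single_smul, smul_eq_mul, mul_one] at this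
    obtain ⟨u, hu⟩ := (hδ0 _).1 h1
    have h2 : y i = ∑ j, u j * δ 0 (Pi.single j 1) k₀ := by
      rw [← happly, hu, Pi.single_eq_same]
    have h3 := hcoeff (d := 0) (hy i) (fun j => hlin 0 j k₀) h2
    have h4 : ∀ j, ∃ a : K, (DirectSum.decompose 𝒜 (u j) 0 : R) = algebraMap K R a := by
      intro j
      have : (DirectSum.decompose 𝒜 (u j) 0 : R) ∈ 𝒜 0 := SetLike.coe_mem _
      obtain ⟨a, ha⟩ := Submodule.mem_one.1 (h0.le this)
      exact ⟨a, ha.symm⟩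
    choose a ha using h4
    have h5 : X i - ∑ j, a j • ℓ j = 0 := by
      refine hdeg _ ?_ ?_
      · rw [hI, RingHom.mem_ker, map_sub, map_sum, aeval_X, h3, sub_eq_zero]
        refine Finset.sum_congr rfl fun j _ => ?_
        rw [map_smul, hℓ, ha, Algebra.smul_def]
      · refine lt_of_le_of_lt (IsHomogeneous.totalDegree_le (n := 1) ?_) one_lt_two
        refine (isHomogeneous_X K i).sub (IsHomogeneous.sum _ _ _ fun j _ => ?_)
        exact (homogeneousSubmodule σ K 1).smul_mem _ (hℓ1 j)
    rw [sub_eq_zero.1 h5]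
    exact Submodule.sum_mem _ fun j _ => Submodule.smul_mem _ _ (Submodule.subset_span ⟨j, rfl⟩)
  -- the quadratic relations given by the linear syzygies
  set q : Fin (b 2) → MvPolynomial σ K := fun l => ∑ j, t l j * ℓ j with hq
  have hqQ : ∀ l, q l ∈ Q := by
    intro l
    refine Ideal.subset_span ⟨?_, IsHomogeneous.sum _ _ _ fun j _ => (ht1 l j).mul (hℓ1 j)⟩
    rw [hI, RingHom.mem_ker, hq, map_sum]
    have h1 : δ 0 (δ 1 (Pi.single l 1)) k₀ = 0 := by
      rw [(hδ 0 _).2 ⟨_, rfl⟩]; rfl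
    rw [happly] at h1
    rw [← h1]
    exact Finset.sum_congr rfl fun j _ => by rw [map_mul, ht, hℓ]
  induction d using Nat.strong_induction_on generalizing f with
  | _ d ih =>
  rcases lt_trichotomy d 2 with h2 | rfl | h2
  · rw [hdeg f hf (hd.totalDegree_le.trans_lt h2)]
    exact zero_mem _
  · exact Ideal.subset_span ⟨hf, hd⟩
  obtain ⟨d, rfl⟩ : ∃ n, d = n + 1 + 1 := ⟨d - 2, by omega⟩
  obtain ⟨g, hg, hfg⟩ := exists_eq_sum_mul hX hd
  have hker : δ 0 (fun j => aeval y (g j)) = 0 := by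
    ext k
    rw [hsub k k₀, happly, Pi.zero_apply]
    have : aeval y f = 0 := hf
    rw [← this, hfg, map_sum]
    exact Finset.sum_congr rfl fun j _ => by rw [map_mul, hℓ]
  obtain ⟨u, hu⟩ := (hδ 0 _).1 hker
  have hu' : ∀ j, aeval y (g j) =
      ∑ l, (DirectSum.decompose 𝒜 (u l) d : R) * δ 1 (Pi.single l 1) j := by
    intro j
    refine hcoeff (aeval_mem_grading hy (hg j)) (fun l => hlin 1 l j) ?_
    rw [← happly, hu]
  choose h hh hhu using fun l => exists_isHomogeneous_aeval_eq (K := K) hy hsurj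
    (SetLike.coe_mem (DirectSum.decompose 𝒜 (u l) d))
  -- the syzygy given by `f` is a combination of linear syzygies, up to relations of lower degree
  have hrest : ∀ j, g j - ∑ l, h l * t l j ∈ Q := by
    intro j
    refine ih (d + 1) (by omega) ?_ ?_
    swap
    · rw [hI, RingHom.mem_ker, map_sub, map_sum, hu', sub_eq_zero]
      exact Finset.sum_congr rfl fun l _ => by rw [map_mul, hhu, ht]
    · exact (hg j).sub (IsHomogeneous.sum _ _ _ fun l _ => (hh l).mul (ht1 l j))
  have hfin : f = ∑ j, (g j - ∑ l, h l * t l j) * ℓ j + ∑ l, h l * q l := by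
    rw [hfg, hq]
    simp only [sub_mul, Finset.sum_sub_distrib, Finset.sum_mul, Finset.mul_sum, mul_assoc]
    rw [Finset.sum_comm (s := Finset.univ (α := Fin (b 2)))]
    simp
  rw [hfin]
  exact add_mem (Ideal.sum_mem _ fun j _ => Ideal.mul_mem_right _ _ (hrest j))
    (Ideal.sum_mem _ fun l _ => Ideal.mul_mem_left _ _ (hqQ l))

end KoszulRelations

/-! ### Doubly lexical orderings of chordal bipartite graphs -/

section DoublyLexical

/-- `v 0, …, v (L - 1)` is a chordless cycle of `G`. Distinctness of the vertices is not required;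
it is automatic for `L ≥ 5`. -/
def IsChordlessCycle {α : Type*} (G : SimpleGraph α) (L : ℕ) (v : ℕ → α) : Prop :=
  ∀ s < L, ∀ t < L, G.Adj (v s) (v t) ↔
    s + 1 = t ∨ t + 1 = s ∨ (s + 1 = L ∧ t = 0) ∨ (t + 1 = L ∧ s = 0)

/-- The bipartite graph of a relation `E` between rows and columns. -/
def bipartiteGraph {ρ κ : Type*} (E : ρ → κ → Prop) : SimpleGraph (ρ ⊕ κ) where
  Adj
    | .inl r, .inr c => E r c
    | .inr c, .inl r => E r c
    | _, _ => False
  symm := ⟨by rintro (r | c) (r' | c') h <;> exact h⟩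
  loopless := ⟨by rintro (r | c) h <;> exact h⟩

variable {ρ κ : Type*}

@[simp] theorem bipartiteGraph_inl_inr (E : ρ → κ → Prop) (r : ρ) (c : κ) :
    (bipartiteGraph E).Adj (.inl r) (.inr c) ↔ E r c := Iff.rfl

@[simp] theorem bipartiteGraph_inr_inl (E : ρ → κ → Prop) (r : ρ) (c : κ) :
    (bipartiteGraph E).Adj (.inr c) (.inl r) ↔ E r c := Iff.rfl

@[simp] theorem bipartiteGraph_inl_inl (E : ρ → κ → Prop) (r r' : ρ) :
    ¬ (bipartiteGraph E).Adj (.inl r) (.inl r') := id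

@[simp] theorem bipartiteGraph_inr_inr (E : ρ → κ → Prop) (c c' : κ) :
    ¬ (bipartiteGraph E).Adj (.inr c) (.inr c') := id

/-- `f` and `g` order the rows of the relation `E` lexicographically, the last column being the most
significant one. -/
def RowsLex (E : ρ → κ → Prop) (f : ρ → ℕ) (g : κ → ℕ) : Prop :=
  ∀ i i', f i < f i' → (∃ j, E i j ∧ ¬ E i' j) →
    ∃ j, ¬ E i j ∧ E i' j ∧ ∀ k, g j < g k → (E i k ↔ E i' k)

/-- A maximal weighted sum has its larger weights at the larger summands. -/
theorem le_of_forall_sum_le [Fintype ρ] (a : ρ → ℕ) {p : ℕ} (f : ρ ≃ Fin p)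
    (hf : ∀ f' : ρ ≃ Fin p, ∑ k, 2 ^ (f' k : ℕ) * a k ≤ ∑ k, 2 ^ (f k : ℕ) * a k)
    {i i' : ρ} (h : f i < f i') : a i ≤ a i' := by
  classical
  have hne : i ≠ i' := by rintro rfl; exact lt_irrefl _ h
  have h1 := hf ((Equiv.swap i i').trans f)
  rw [← Finset.add_sum_erase _ _ (Finset.mem_univ i),
    ← Finset.add_sum_erase (a := i') _ _ (by simp [hne.symm]),
    ← Finset.add_sum_erase (Finset.univ) (fun k => 2 ^ (f k : ℕ) * a k) (Finset.mem_univ i),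
    ← Finset.add_sum_erase (a := i') (Finset.univ.erase i) (fun k => 2 ^ (f k : ℕ) * a k)
      (by simp [hne.symm])] at h1
  have h2 : ∑ k ∈ (Finset.univ.erase i).erase i', 2 ^ (((Equiv.swap i i').trans f) k : ℕ) * a k
      = ∑ k ∈ (Finset.univ.erase i).erase i', 2 ^ (f k : ℕ) * a k := by
    refine Finset.sum_congr rfl fun k hk => ?_
    simp only [Finset.mem_erase] at hk
    rw [Equiv.trans_apply, Equiv.swap_apply_of_ne_of_ne hk.2.1 hk.1]
  rw [h2] at h1
  simp only [Equiv.trans_apply, Equiv.swap_apply_left, Equiv.swap_apply_right] at h1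
  have h3 : 2 ^ (f i : ℕ) < 2 ^ (f i' : ℕ) := Nat.pow_lt_pow_right one_lt_two h
  by_contra! h4
  nlinarith

open Classical in
/-- The lexicographic order of the rows is the order of the numbers whose binary digits they are. -/
theorem rowsLex_of_sum_le [Fintype κ] {E : ρ → κ → Prop} {f : ρ → ℕ} {g : κ → ℕ}
    (hg : Function.Injective g)
    (h : ∀ i i', f i < f i' →
      ∑ j, (if E i j then 2 ^ g j else 0) ≤ ∑ j, (if E i' j then 2 ^ g j else 0)) :
    RowsLex E f g := by
  intro i i' hii' hne
  let s : ρ → Finset ℕ := fun i => (Finset.univ.filter (E i)).image g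
  have hs : ∀ i, ∑ k ∈ s i, 2 ^ k = ∑ j, if E i j then 2 ^ g j else 0 := by
    intro i
    rw [Finset.sum_image fun x _ y _ h => hg h, Finset.sum_filter]
  have hmem : ∀ i j, g j ∈ s i ↔ E i j := by
    intro i j
    simp [s, hg.eq_iff]
  have h1 : toColex (s i) ≤ toColex (s i') := by
    rw [← Finset.geomSum_le_geomSum_iff_toColex_le_toColex le_rfl, hs, hs]
    exact h i i' hii'
  have h2 : toColex (s i) ≠ toColex (s i') := by
    intro h2
    obtain ⟨j, hj, hj'⟩ := hne
    rw [← hmem, ← toColex_inj.1 h2, hmem] at hj'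
    exact hj' hj
  obtain ⟨a, ha, ha', hlt⟩ :=
    Finset.Colex.toColex_lt_toColex_iff_exists_forall_lt.1 (h1.lt_of_ne h2)
  obtain ⟨b, hb, hmax⟩ := Finset.exists_max_image (s i' \ s i) id ⟨a, by simp [ha, ha']⟩
  rw [Finset.mem_sdiff] at hb
  obtain ⟨j, -, rfl⟩ := Finset.mem_image.1 hb.1
  refine ⟨j, fun h => hb.2 ((hmem _ _).2 h), (hmem _ _).1 hb.1, fun k hk => ?_⟩
  rw [← hmem, ← hmem]
  by_contra hcon
  by_cases hki : g k ∈ s i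
  · have hki' : g k ∉ s i' := by tauto
    have h3 := hlt _ hki hki'
    have h4 := hmax a (by simp [ha, ha'])
    simp only [id] at h4
    omega
  · have hki' : g k ∈ s i' := by tauto
    have h4 := hmax (g k) (by simp [hki, hki'])
    simp only [id] at h4
    omega

/-- Every relation on finite sets has a doubly lexical ordering. It is found by maximizing
`∑ 2 ^ (f i + g j)` over the pairs `(i, j)` in the relation. -/
theorem exists_rowsLex [Finite ρ] [Finite κ] (E : ρ → κ → Prop) :
    ∃ (f : ρ → ℕ) (g : κ → ℕ), Function.Injective f ∧ Function.Injective g ∧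
      RowsLex E f g ∧ RowsLex (fun c r => E r c) g f := by
  classical
  have := Fintype.ofFinite ρ
  have := Fintype.ofFinite κ
  let Φ : (ρ ≃ Fin (Fintype.card ρ)) × (κ ≃ Fin (Fintype.card κ)) → ℕ := fun p =>
    ∑ i, ∑ j, if E i j then 2 ^ (p.1 i : ℕ) * 2 ^ (p.2 j : ℕ) else 0
  have : Nonempty ((ρ ≃ Fin (Fintype.card ρ)) × (κ ≃ Fin (Fintype.card κ))) :=
    ⟨⟨Fintype.equivFin ρ, Fintype.equivFin κ⟩⟩
  obtain ⟨⟨f, g⟩, hmax⟩ := Finite.exists_max Φ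
  have h1 : ∀ f g, Φ (f, g) = ∑ i, 2 ^ (f i : ℕ) * ∑ j, if E i j then 2 ^ (g j : ℕ) else 0 := by
    intro f g
    simp only [Φ, Finset.mul_sum, mul_ite, mul_zero]
  have h2 : ∀ f g, Φ (f, g) = ∑ j, 2 ^ (g j : ℕ) * ∑ i, if E i j then 2 ^ (f i : ℕ) else 0 := by
    intro f g
    simp only [Φ, Finset.mul_sum, mul_ite, mul_zero]
    rw [Finset.sum_comm]
    simp only [mul_comm]
  have hf : Function.Injective fun i => (f i : ℕ) := Fin.val_injective.comp f.injective
  have hg : Function.Injective fun j => (g j : ℕ) := Fin.val_injective.comp g.injective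
  refine ⟨fun i => f i, fun j => g j, hf, hg, ?_, ?_⟩
  · refine rowsLex_of_sum_le hg fun i i' h => ?_
    refine le_of_forall_sum_le (fun i => ∑ j, if E i j then 2 ^ (g j : ℕ) else 0) f ?_ h
    intro f'
    rw [← h1, ← h1]
    exact hmax (f', g)
  · refine rowsLex_of_sum_le hf fun j j' h => ?_
    refine le_of_forall_sum_le (fun j => ∑ i, if E i j then 2 ^ (f i : ℕ) else 0) g ?_ h
    intro g'
    rw [← h2, ← h2]
    exact hmax (f, g')

/-- A ladder: the rows `r 0, …, r n` and the columns `c 0, …, c n` induce two paths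
`r 0, c 1, r 2, …` and `c 0, r 1, c 2, …` with the single edge `r 0, c 0` between them. -/
structure Ladder (E : ρ → κ → Prop) (f : ρ → ℕ) (g : κ → ℕ) (n : ℕ) (r : ℕ → ρ) (c : ℕ → κ) :
    Prop where
  row_lt : ∀ i < n, f (r i) < f (r (i + 1))
  col_lt : ∀ i < n, g (c i) < g (c (i + 1))
  edge : ∀ i ≤ n, ∀ j ≤ n, E (r i) (c j) ↔ i + 1 = j ∨ j + 1 = i ∨ (i = 0 ∧ j = 0)
  /-- Beyond the column `c (i + 2)`, which is the last one in which they differ, the rows `r i` and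
  `r (i + 1)` agree. -/
  row_agree : ∀ i, i + 2 ≤ n → ∀ k, g (c (i + 2)) < g k → (E (r i) k ↔ E (r (i + 1)) k)
  /-- The same with rows and columns interchanged. -/
  col_agree : ∀ j, j + 2 ≤ n → ∀ k, f (r (j + 2)) < f k → (E k (c j) ↔ E k (c (j + 1)))

namespace Ladder

variable {E : ρ → κ → Prop} {f : ρ → ℕ} {g : κ → ℕ} {n : ℕ} {r : ℕ → ρ} {c : ℕ → κ}

theorem swap (h : Ladder E f g n r c) : Ladder (fun c r => E r c) g f n c r where
  row_lt := h.col_lt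
  col_lt := h.row_lt
  edge i hi j hj := by rw [h.edge j hj i hi]; tauto
  row_agree := h.col_agree
  col_agree := h.row_agree

theorem col_le (h : Ladder E f g n r c) {i : ℕ} (hi : i ≤ n) : g (c i) ≤ g (c n) := by
  induction hi using Nat.decreasingInduction with
  | self => exact le_rfl
  | of_succ k hk ih => exact (h.col_lt k hk).le.trans ih

/-- The next column of a ladder is the last one in which its last two rows differ. -/
theorem exists_next_col (h : Ladder E f g n r c) (hn : 1 ≤ n) (hg : Function.Injective g)
    (hE : RowsLex E f g) : ∃ d, g (c n) < g d ∧ (∀ i ≤ n, E (r i) d ↔ i = n) ∧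
      ∀ k, g d < g k → (E (r (n - 1)) k ↔ E (r n) k) := by
  obtain ⟨n, rfl⟩ : ∃ k, n = k + 1 := ⟨n - 1, by omega⟩
  rw [Nat.add_sub_cancel]
  have h1 : E (r n) (c (n + 1)) := by rw [h.edge _ (by omega) _ le_rfl]; omega
  have h2 : ¬ E (r (n + 1)) (c (n + 1)) := by rw [h.edge _ le_rfl _ le_rfl]; omega
  obtain ⟨d, hd1, hd2, hd3⟩ := hE _ _ (h.row_lt n (by omega)) ⟨_, h1, h2⟩
  have hlt : g (c (n + 1)) < g d := by
    rcases lt_trichotomy (g (c (n + 1))) (g d) with h' | h' | h'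
    · exact h'
    · rw [hg h'] at h2; exact absurd hd2 h2
    · exact absurd ((hd3 _ h').1 h1) h2
  have hno : ∀ i ≤ n, ¬ E (r i) d := by
    intro i hi
    induction hi using Nat.decreasingInduction with
    | self => exact hd1
    | of_succ k hk ih =>
      rwa [h.row_agree k (by omega) d (lt_of_le_of_lt (h.col_le (by omega)) hlt)]
  refine ⟨d, hlt, fun i hi => ⟨fun hi' => ?_, ?_⟩, hd3⟩
  · by_contra hne
    exact hno i (by omega) hi'
  · rintro rfl
    exact hd2

/-- A ladder whose last row and column are adjacent is a chordless cycle. -/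
theorem exists_isChordlessCycle
    (h : ∀ i ≤ n, ∀ j ≤ n, E (r i) (c j) ↔
      i + 1 = j ∨ j + 1 = i ∨ (i = 0 ∧ j = 0) ∨ (i = n ∧ j = n)) :
    ∃ v, IsChordlessCycle (bipartiteGraph E) (2 * n + 2) v := by
  refine ⟨fun t => if t ≤ n then (if t % 2 = 0 then .inl (r t) else .inr (c t)) else
    (if t % 2 = 0 then .inl (r (2 * n + 1 - t)) else .inr (c (2 * n + 1 - t))), ?_⟩
  intro s hs t ht
  dsimp only
  split_ifs <;> simp only [bipartiteGraph_inl_inl, bipartiteGraph_inr_inr, bipartiteGraph_inl_inr,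
    bipartiteGraph_inr_inl, false_iff]
  all_goals first
    | omega
    | (rw [h _ (by omega) _ (by omega)]; omega)

end Ladder

/-- A relation without chordless cycles of length at least six has an ordering without submatrix
`1 1 / 1 0`: in a doubly lexical ordering, such a submatrix starts an infinite ladder. -/
theorem exists_gammaFree [Finite ρ] [Finite κ] (E : ρ → κ → Prop)
    (hE : ∀ L, 6 ≤ L → ∀ v, ¬ IsChordlessCycle (bipartiteGraph E) L v) :
    ∃ (f : ρ → ℕ) (g : κ → ℕ), Function.Injective f ∧ Function.Injective g ∧
      ∀ i i' j j', f i < f i' → g j < g j' → E i j → E i j' → E i' j → E i' j' := by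
  classical
  obtain ⟨f, g, hf, hg, hrow, hcol⟩ := exists_rowsLex E
  refine ⟨f, g, hf, hg, fun i i' j j' hi hj h1 h2 h3 => ?_⟩
  by_contra h4
  have key : ∀ n, 1 ≤ n → ∃ r c, Ladder E f g n r c := by
    intro n hn
    induction n, hn using Nat.le_induction with
    | base =>
      refine ⟨fun k => if k = 0 then i else i', fun k => if k = 0 then j else j',
        ?_, ?_, ?_, ?_, ?_⟩
      · intro k hk
        simpa [show k = 0 by omega] using hi
      · intro k hk
        simpa [show k = 0 by omega] using hj
      · intro a ha b hb
        interval_cases a <;> interval_cases b <;> simp [h1, h2, h3, h4]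
      · intro k hk; omega
      · intro k hk; omega
    | succ n hn ih =>
      obtain ⟨r, c, h⟩ := ih
      obtain ⟨d, hd1, hd2, hd3⟩ := h.exists_next_col hn hg hrow
      obtain ⟨q, hq1, hq2, hq3⟩ := h.swap.exists_next_col hn hf hcol
      -- the new row and column are not adjacent, as the ladder would close to a chordless cycle
      have hdq : ¬ E q d := by
        intro hdq
        obtain ⟨v, hv⟩ := Ladder.exists_isChordlessCycle (E := E) (n := n + 1)
          (r := fun k => if k ≤ n then r k else q) (c := fun k => if k ≤ n then c k else d) (by
            intro a ha b hb
            split_ifs with h1 h2 h2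
            · rw [h.edge a h1 b h2]; omega
            · rw [hd2 a h1]; omega
            · rw [hq2 b h2]; omega
            · simp only [hdq, true_iff]; omega)
        exact hE _ (by omega) v hv
      refine ⟨fun k => if k ≤ n then r k else q, fun k => if k ≤ n then c k else d,
        ?_, ?_, ?_, ?_, ?_⟩
      · intro k hk
        rcases Nat.lt_succ_iff_lt_or_eq.1 hk with hk | rfl
        · rw [if_pos hk.le, if_pos (by omega)]
          exact h.row_lt k hk
        · rw [if_pos le_rfl, if_neg (by omega)]
          exact hq1
      · intro k hk
        rcases Nat.lt_succ_iff_lt_or_eq.1 hk with hk | rfl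
        · rw [if_pos hk.le, if_pos (by omega)]
          exact h.col_lt k hk
        · rw [if_pos le_rfl, if_neg (by omega)]
          exact hd1
      · intro a ha b hb
        split_ifs with h1 h2 h2
        · rw [h.edge a h1 b h2]
        · rw [hd2 a h1]; omega
        · rw [hq2 b h2]; omega
        · simp only [hdq, false_iff]; omega
      · intro k hk m hm
        rw [if_pos (by omega), if_pos (by omega)]
        rcases Nat.le_succ_iff.1 hk with hk | hk
        · rw [if_pos hk] at hm
          exact h.row_agree k hk m hm
        · rw [if_neg (by omega)] at hm
          have := hd3 m hm
          rwa [show n - 1 = k by omega, show n = k + 1 by omega] at this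
      · intro k hk m hm
        rw [if_pos (by omega), if_pos (by omega)]
        rcases Nat.le_succ_iff.1 hk with hk | hk
        · rw [if_pos hk] at hm
          exact h.col_agree k hk m hm
        · rw [if_neg (by omega)] at hm
          have := hq3 m hm
          rwa [show n - 1 = k by omega, show n = k + 1 by omega] at this
  -- the rows of a ladder are distinct
  have := Fintype.ofFinite ρ
  obtain ⟨r, c, h⟩ := key (Fintype.card ρ + 1) (by omega)
  have hmono : ∀ a b, a < b → b ≤ Fintype.card ρ + 1 → f (r a) < f (r b) := by
    intro a b hab hb
    induction b, hab using Nat.le_induction with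
    | base => exact h.row_lt a (by omega)
    | succ b hab ih => exact (ih (by omega)).trans (h.row_lt b (by omega))
  have hinj : Function.Injective fun k : Fin (Fintype.card ρ + 1) => r k := by
    intro a b hab
    dsimp only at hab
    rcases lt_trichotomy a b with h' | h' | h'
    · exact absurd (hmono a b h' (by omega)) (by rw [hab]; exact lt_irrefl _)
    · exact h'
    · exact absurd (hmono b a h' (by omega)) (by rw [hab]; exact lt_irrefl _)
  have := Fintype.card_le_of_injective _ hinj
  simp at this

end DoublyLexical

/-! ### Quadratic Gröbner bases of edge ideals of bipartite graphs -/

section EdgeIdeal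

variable {σ : Type u} {ρ κ : Type*} {row : σ → ρ} {col : σ → κ}

theorem mapDomain_apply_ne_zero_iff {τ : Type*} {h : σ → τ} {a : σ →₀ ℕ} {r : τ} :
    mapDomain h a r ≠ 0 ↔ ∃ t, a t ≠ 0 ∧ h t = r := by
  classical
  rw [← Finsupp.mem_support_iff, Finsupp.mapDomain_support_of_subsingletonAddUnits]
  simp

/-- Two multisets of edges of a bipartite graph are in the same fiber if every vertex has the same
degree in both. An edge `s` joins `row s` and `col s`. -/
def SameFiber (row : σ → ρ) (col : σ → κ) (a b : σ →₀ ℕ) : Prop :=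
  mapDomain row a = mapDomain row b ∧ mapDomain col a = mapDomain col b

namespace SameFiber

variable {a b c : σ →₀ ℕ}

theorem symm (h : SameFiber row col a b) : SameFiber row col b a := ⟨h.1.symm, h.2.symm⟩

theorem trans (h : SameFiber row col a b) (h' : SameFiber row col b c) : SameFiber row col a c :=
  ⟨h.1.trans h'.1, h.2.trans h'.2⟩

theorem degree_eq (h : SameFiber row col a b) : a.degree = b.degree := by
  rw [← Finsupp.degree_mapDomain row a, h.1, Finsupp.degree_mapDomain]

theorem add_left (h : SameFiber row col a b) (c : σ →₀ ℕ) :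
    SameFiber row col (c + a) (c + b) := by
  simp only [SameFiber, Finsupp.mapDomain_add, h.1, h.2, and_self]

theorem of_add_left (h : SameFiber row col (c + a) (c + b)) : SameFiber row col a b := by
  simpa only [SameFiber, Finsupp.mapDomain_add, add_right_inj] using h

theorem exists_row (h : SameFiber row col a b) {s : σ} (hs : a s ≠ 0) :
    ∃ t, b t ≠ 0 ∧ row t = row s := by
  rw [← mapDomain_apply_ne_zero_iff, ← h.1, mapDomain_apply_ne_zero_iff]
  exact ⟨s, hs, rfl⟩

theorem exists_col (h : SameFiber row col a b) {s : σ} (hs : a s ≠ 0) :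
    ∃ t, b t ≠ 0 ∧ col t = col s := by
  rw [← mapDomain_apply_ne_zero_iff, ← h.2, mapDomain_apply_ne_zero_iff]
  exact ⟨s, hs, rfl⟩

end SameFiber

/-- A multiset of edges is sorted if it does not contain edges `s` and `t`, the row of `s` being
the smaller one and its column the larger one, such that the row of `s` and the column of `t` are
joined by an edge. -/
def Sorted (row : σ → ρ) (col : σ → κ) (f : ρ → ℕ) (g : κ → ℕ) (a : σ →₀ ℕ) : Prop :=
  ∀ s t u, a s ≠ 0 → a t ≠ 0 → f (row s) < f (row t) → g (col t) < g (col s) →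
    row u = row s → col u ≠ col t

namespace Sorted

variable {f : ρ → ℕ} {g : κ → ℕ} {a b : σ →₀ ℕ}

theorem of_le (h : Sorted row col f g a) (hab : b ≤ a) : Sorted row col f g b := by
  have : ∀ s, b s ≠ 0 → a s ≠ 0 := fun s hs h0 => hs (Nat.le_zero.1 (h0 ▸ hab s))
  exact fun s t u hs ht => h s t u (this s hs) (this t ht)

/-- The edge from the first row in use to the first column in use that can be reached from there
belongs to every sorted multiset. -/
theorem apply_ne_zero (h : Sorted row col f g a)
    (hinj : ∀ s t, row s = row t → col s = col t → s = t)
    (hf : Function.Injective f) (hg : Function.Injective g) {s₁ : σ}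
    (h1 : ∀ t, a t ≠ 0 → f (row s₁) ≤ f (row t))
    (h2 : ∀ t, a t ≠ 0 → ∀ u, row u = row s₁ → col u = col t → g (col s₁) ≤ g (col t))
    (h3 : ∃ t, a t ≠ 0 ∧ row t = row s₁) (h4 : ∃ t, a t ≠ 0 ∧ col t = col s₁) : a s₁ ≠ 0 := by
  obtain ⟨s, hs, hsr⟩ := h3
  obtain ⟨t, ht, htc⟩ := h4
  rcases (h2 s hs s hsr rfl).eq_or_lt with h5 | h5
  · rwa [hinj s₁ s hsr.symm (hg h5)]
  rcases (h1 t ht).eq_or_lt with h6 | h6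
  · rwa [hinj s₁ t (hf h6) htc.symm]
  · exact absurd htc.symm (h s t s₁ hs ht (hsr ▸ h6) (htc ▸ h5) hsr.symm)

/-- A fiber contains at most one sorted multiset. -/
theorem eq_of_sameFiber [Finite σ] (hinj : ∀ s t, row s = row t → col s = col t → s = t)
    (hf : Function.Injective f) (hg : Function.Injective g) (ha : Sorted row col f g a)
    (hb : Sorted row col f g b) (hab : SameFiber row col a b) : a = b := by
  induction hn : a.degree generalizing a b with
  | zero =>
    have hb0 := hab.degree_eq
    rw [hn, eq_comm, Finsupp.degree_eq_zero_iff] at hb0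
    rw [Finsupp.degree_eq_zero_iff] at hn
    rw [hn, hb0]
  | succ n ih =>
    have hne : {s | a s ≠ 0}.Nonempty := by
      by_contra! h0
      have : a = 0 := by
        ext s
        by_contra hs
        exact (Set.eq_empty_iff_forall_notMem.1 h0 s) hs
      simp [this] at hn
    obtain ⟨s₀, hs₀, hmin₀⟩ := Set.exists_min_image _ (fun s => f (row s)) (Set.toFinite _) hne
    obtain ⟨s₁, ⟨hr, hc⟩, hmin₁⟩ := Set.exists_min_image
      {s | row s = row s₀ ∧ ∃ t, a t ≠ 0 ∧ col t = col s} (fun s => g (col s))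
      (Set.toFinite _) ⟨s₀, rfl, s₀, hs₀, rfl⟩
    have h1 : ∀ t, a t ≠ 0 → f (row s₁) ≤ f (row t) := fun t ht => by rw [hr]; exact hmin₀ t ht
    have h2 : ∀ t, a t ≠ 0 → ∀ u, row u = row s₁ → col u = col t → g (col s₁) ≤ g (col t) :=
      fun t ht u hu huc => huc ▸ hmin₁ u ⟨hu.trans hr, t, ht, huc.symm⟩
    have h3 : ∃ t, a t ≠ 0 ∧ row t = row s₁ := ⟨s₀, hs₀, hr.symm⟩
    have hsa : a s₁ ≠ 0 := ha.apply_ne_zero hinj hf hg h1 h2 h3 hc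
    have hsb : b s₁ ≠ 0 := by
      refine hb.apply_ne_zero hinj hf hg ?_ ?_ ?_ ?_
      · intro t ht
        obtain ⟨t', ht', h⟩ := hab.symm.exists_row ht
        exact h ▸ h1 t' ht'
      · intro t ht u hu huc
        obtain ⟨t', ht', h⟩ := hab.symm.exists_col ht
        exact h ▸ h2 t' ht' u hu (huc.trans h.symm)
      · exact hab.exists_row hsa
      · exact hab.exists_col hsa
    have hsplit : ∀ c : σ →₀ ℕ, c s₁ ≠ 0 → c = single s₁ 1 + (c - single s₁ 1) := fun c hc =>
      (add_tsub_cancel_of_le (Finsupp.single_le_iff.2 (Nat.one_le_iff_ne_zero.2 hc))).symm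
    rw [hsplit a hsa, hsplit b hsb] at hab
    have hd : (a - single s₁ 1).degree = n := by
      have := congrArg Finsupp.degree (hsplit a hsa)
      rw [map_add, Finsupp.degree_single, hn] at this
      omega
    rw [hsplit a hsa, hsplit b hsb,
      ih (ha.of_le tsub_le_self) (hb.of_le tsub_le_self) hab.of_add_left hd]

end Sorted

open MvPolynomial

/-- If the vertices of a bipartite graph can be ordered such that its biadjacency matrix has no
submatrix with exactly one zero, at the bottom right, then sorting is a quadratic Gröbner basis: the
toric ideal has the Gröbner basis of the binomials `y s * y t - y s' * y t'`, where `s, t` are the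
antidiagonal and `s', t'` the diagonal of a `2 × 2` submatrix. -/
theorem hasQuadraticGroebnerBasis_of_gammaFree {K : Type v} [Field K] {N : Type w}
    [AddCommMonoid N] [Finite σ] {I : Ideal (MvPolynomial σ K)} {e : (σ →₀ ℕ) →+ N}
    (hI : IsToricFor I e) (he : ∀ a b, e a = e b ↔ SameFiber row col a b)
    (hinj : ∀ s t, row s = row t → col s = col t → s = t) {f : ρ → ℕ} {g : κ → ℕ}
    (hf : Function.Injective f) (hg : Function.Injective g)
    (hfg : ∀ s t u, f (row s) < f (row t) → g (col t) < g (col s) → row u = row s → col u = col t →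
      ∃ u', row u' = row t ∧ col u' = col s) :
    HasQuadraticGroebnerBasis I := by
  classical
  -- the variables are ordered by their rows, and within a row by descending columns
  let F : σ → ℕ ×ₗ ℕᵒᵈ := fun s => toLex (f (row s), OrderDual.toDual (g (col s)))
  have hF : Function.Injective F := by
    intro s t h
    have h1 := congrArg ofLex h
    simp only [F, ofLex_toLex, Prod.mk.injEq, OrderDual.toDual_inj] at h1
    exact hinj s t (hf h1.1) (hg h1.2)
  let _ : LinearOrder σ := LinearOrder.lift' F hF
  have hlt : ∀ s t, s < t ↔ f (row s) < f (row t) ∨ f (row s) = f (row t) ∧ g (col t) < g (col s) :=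
    fun s t => Prod.Lex.toLex_lt_toLex
  let m : MonomialOrder.{u, u} σ := MonomialOrder.lex
  -- sorting a pair of edges decreases the monomial
  have hstep : ∀ s t u u', f (row s) < f (row t) → g (col t) < g (col s) → row u = row s →
      col u = col t → row u' = row t → col u' = col s →
      m.toSyn (single u 1 + single u' 1) < m.toSyn (single s 1 + single t 1) := by
    intro s t u u' h1 h2 h3 h4 h5 h6
    have hst : s < t := (hlt s t).2 (Or.inl h1)
    have hsu : s < u := (hlt s u).2 (Or.inr ⟨by rw [h3], by rw [h4]; exact h2⟩)
    have hsu' : s < u' := (hlt s u').2 (Or.inl (by rw [h5]; exact h1))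
    refine MonomialOrder.lex_lt_iff.2 (Finsupp.Lex.lt_iff.2 ⟨s, fun j hj => ?_, ?_⟩)
    · simp [hj.ne', (hj.trans hst).ne', (hj.trans hsu).ne',
        (hj.trans hsu').ne']
    · simp [hst.ne', hsu.ne', hsu'.ne']
  have hfib : ∀ s t u u', row u = row s → col u = col t → row u' = row t → col u' = col s →
      SameFiber row col (single s 1 + single t 1) (single u 1 + single u' 1) := by
    intro s t u u' h3 h4 h5 h6
    constructor <;> simp only [Finsupp.mapDomain_add, Finsupp.mapDomain_single, h3, h4, h5, h6]
    rw [add_comm]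
  -- an exponent that is not sorted is not minimal in its fiber
  have hred : ∀ a, ¬ Sorted row col f g a → ∃ s t u u' c, f (row s) < f (row t) ∧
      g (col t) < g (col s) ∧ row u = row s ∧ col u = col t ∧ row u' = row t ∧ col u' = col s ∧
      a = c + (single s 1 + single t 1) := by
    intro a ha
    simp only [Sorted, not_forall, not_not] at ha
    obtain ⟨s, t, u, hs, ht, h1, h2, h3, h4⟩ := ha
    obtain ⟨u', h5, h6⟩ := hfg s t u h1 h2 h3 h4
    refine ⟨s, t, u, u', a - (single s 1 + single t 1), h1, h2, h3, h4, h5, h6, ?_⟩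
    refine (tsub_add_cancel_of_le fun x => ?_).symm
    have hst : s ≠ t := by rintro rfl; exact lt_irrefl _ h1
    by_cases hxs : s = x
    · subst hxs; simpa [Finsupp.single_apply, hst.symm] using Nat.one_le_iff_ne_zero.2 hs
    · by_cases hxt : t = x
      · subst hxt; simpa [Finsupp.single_apply, hst] using Nat.one_le_iff_ne_zero.2 ht
      · simp [hxs, hxt]
  -- a sorted exponent is the minimum of its fiber
  have hmin : ∀ a, Sorted row col f g a → ∀ b, SameFiber row col a b → m.toSyn a ≤ m.toSyn b := by
    intro a ha b
    induction hb : m.toSyn b using WellFoundedLT.induction generalizing b with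
    | ind x ih =>
      subst hb
      intro hab
      by_cases hsb : Sorted row col f g b
      · rw [ha.eq_of_sameFiber hinj hf hg hsb hab]
      obtain ⟨s, t, u, u', c, h1, h2, h3, h4, h5, h6, rfl⟩ := hred b hsb
      have hlt' : m.toSyn (c + (single u 1 + single u' 1)) <
          m.toSyn (c + (single s 1 + single t 1)) := by
        rw [map_add, map_add m.toSyn c]
        exact add_lt_add_right (hstep s t u u' h1 h2 h3 h4 h5 h6) _
      exact (ih _ hlt' _ rfl (hab.trans ((hfib s t u u' h3 h4 h5 h6).add_left c))).trans hlt'.le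
  let B : Set (MvPolynomial σ K) := {p | ∃ s t u u', f (row s) < f (row t) ∧
      g (col t) < g (col s) ∧ row u = row s ∧ col u = col t ∧ row u' = row t ∧ col u' = col s ∧
      p = binomial K (single s 1 + single t 1) (single u 1 + single u' 1)}
  have hBI : B ⊆ I := by
    rintro _ ⟨s, t, u, u', -, -, h3, h4, h5, h6, rfl⟩
    exact hI.binomial_mem_iff.2 ((he _ _).2 (hfib s t u u' h3 h4 h5 h6))
  refine ⟨m, B, ⟨?_, hBI, le_antisymm (Ideal.span_mono (Set.image_mono hBI)) ?_⟩, ?_⟩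
  · refine (Set.finite_range fun p : σ × σ × σ × σ => binomial K (single p.1 1 + single p.2.1 1)
      (single p.2.2.1 1 + single p.2.2.2 1)).subset ?_
    rintro _ ⟨s, t, u, u', -, -, -, -, -, -, rfl⟩
    exact ⟨(s, t, u, u'), rfl⟩
  · rw [Ideal.span_le]
    rintro _ ⟨p, hp, rfl⟩
    by_cases hp0 : p = 0
    · rw [hp0, MonomialOrder.leadingTerm_zero]; exact zero_mem _
    obtain ⟨b, hb, hba, hab⟩ := hI.exists_ne_mem_support hp (m.degree_mem_support hp0)
    have hns : ¬ Sorted row col f g (m.degree p) := fun hs =>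
      hba (m.toSyn.injective ((m.le_degree hb).antisymm (hmin _ hs b ((he _ _).1 hab.symm))))
    obtain ⟨s, t, u, u', c, h1, h2, h3, h4, h5, h6, heq⟩ := hred _ hns
    have hlead : m.leadingTerm (binomial K (single s 1 + single t 1) (single u 1 + single u' 1))
        = monomial (single s 1 + single t 1) 1 := by
      have h7 := hstep s t u u' h1 h2 h3 h4 h5 h6
      have h8 : m.toSyn (m.degree (monomial (single u 1 + single u' 1) (1 : K))) <
          m.toSyn (m.degree (monomial (single s 1 + single t 1) (1 : K))) := by
        rw [m.degree_monomial, m.degree_monomial, if_neg one_ne_zero, if_neg one_ne_zero]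
        exact h7
      rw [binomial, MonomialOrder.leadingTerm, m.leadingCoeff_sub_of_lt h8, m.degree_sub_of_lt h8,
        m.leadingCoeff_monomial, m.degree_monomial, if_neg one_ne_zero]
    have : m.leadingTerm p = monomial c (m.leadingCoeff p) *
        m.leadingTerm (binomial K (single s 1 + single t 1) (single u 1 + single u' 1)) := by
      rw [hlead, monomial_mul, mul_one, ← heq, MonomialOrder.leadingTerm]
    rw [this]
    exact Ideal.mul_mem_left _ _
      (Ideal.subset_span ⟨_, ⟨s, t, u, u', h1, h2, h3, h4, h5, h6, rfl⟩, rfl⟩)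
  · rintro _ ⟨s, t, u, u', -, -, -, -, -, -, rfl⟩
    have : (single s 1 + single t 1 : σ →₀ ℕ).degree = 2 := by simp
    exact this ▸ isHomogeneous_binomial (by simp)

end EdgeIdeal

/-! ### Alternating cycles and the degrees of generators -/

section AlternatingCycle

variable {σ : Type u} {ρ κ : Type*} {row : σ → ρ} {col : σ → κ}

theorem sum_single_le {ι : Type*} {T : Finset ι} {s : ι → σ} (hs : Set.InjOn s T) {a : σ →₀ ℕ}
    (ha : ∀ i ∈ T, a (s i) ≠ 0) : ∑ i ∈ T, single (s i) 1 ≤ a := by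
  classical
  intro x
  rw [Finsupp.finsetSum_apply]
  by_cases hx : ∃ i ∈ T, s i = x
  · obtain ⟨i, hi, rfl⟩ := hx
    rw [Finset.sum_eq_single_of_mem i hi, Finsupp.single_eq_same]
    · exact Nat.one_le_iff_ne_zero.2 (ha i hi)
    · exact fun j hj hji => Finsupp.single_eq_of_ne' fun h => hji (hs hj hi h)
  · push Not at hx
    rw [Finset.sum_eq_zero fun i hi => Finsupp.single_eq_of_ne' (hx i hi)]
    exact Nat.zero_le _

theorem degree_sum_single {ι : Type*} (T : Finset ι) (s : ι → σ) :
    (∑ i ∈ T, single (s i) 1 : σ →₀ ℕ).degree = T.card := by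
  simp

theorem sameFiber_of_alternating {l : ℕ} {s t : ℕ → σ} (hcol : ∀ i, col (t i) = col (s i))
    (hrow : ∀ i, row (t i) = row (s (i + 1))) (hper : s l = s 0) :
    SameFiber row col (∑ i ∈ Finset.range l, single (s i) 1)
      (∑ i ∈ Finset.range l, single (t i) 1) := by
  constructor
  · simp only [Finsupp.mapDomain_finsetSum, Finsupp.mapDomain_single, hrow]
    have h1 := Finset.sum_range_succ (fun i => single (row (s i)) (1 : ℕ)) l
    rw [Finset.sum_range_succ', hper] at h1
    exact (add_right_cancel h1).symm
  · simp only [Finsupp.mapDomain_finsetSum, Finsupp.mapDomain_single, hcol]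

/-- A closed walk whose edges belong alternately to the multisets `a` and `b`: the edge `s i` of `a`
meets the edge `t i` of `b` in a column, which meets the edge `s (i + 1)` in a row. The walk has
period `l`, and no row or column is repeated within a period. -/
structure AlternatingCycle (row : σ → ρ) (col : σ → κ) (a b : σ →₀ ℕ) (l : ℕ) (s t : ℕ → σ) :
    Prop where
  pos : 0 < l
  left_ne_zero : ∀ i, a (s i) ≠ 0
  right_ne_zero : ∀ i, b (t i) ≠ 0
  col_eq : ∀ i, col (t i) = col (s i)
  row_eq : ∀ i, row (t i) = row (s (i + 1))
  periodic : ∀ i, s (i + l) = s i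
  injOn : Set.InjOn s (Set.Iio l)
  row_inj : ∀ i j, row (s i) = row (s j) → s i = s j
  col_inj : ∀ i j, col (s i) = col (s j) → s i = s j

namespace AlternatingCycle

variable {a b : σ →₀ ℕ} {l : ℕ} {s t : ℕ → σ}

theorem injOn_window (h : AlternatingCycle row col a b l s t) (i : ℕ) :
    Set.InjOn (fun u => s (i + u)) (Set.Iio l) := by
  have hmod : ∀ p, s (p % l) = s p := by
    intro p
    conv_rhs => rw [← Nat.mod_add_div p l]
    induction p / l with
    | zero => simp
    | succ n ih => rw [Nat.mul_succ, ← add_assoc, h.periodic, ih]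
  intro u hu u' hu' huu
  simp only [Set.mem_Iio] at hu hu'
  have h1 : s ((i + u) % l) = s ((i + u') % l) := by rw [hmod, hmod]; exact huu
  have h2 : i + u ≡ i + u' [MOD l] :=
    h.injOn (Set.mem_Iio.2 (Nat.mod_lt _ h.pos)) (Set.mem_Iio.2 (Nat.mod_lt _ h.pos)) h1
  exact (Nat.ModEq.add_left_cancel' i h2).eq_of_lt_of_lt hu hu'

/-- A chord `x` from the row of `s i` to the column of `s (i + d)` closes a part of an alternating
cycle to a shorter cycle. -/
theorem sameFiber_chord (h : AlternatingCycle row col a b l s t) {i d : ℕ} {x : σ}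
    (hr : row x = row (s i)) (hc : col x = col (s (i + d))) :
    SameFiber row col (∑ u ∈ Finset.range (d + 1), single (s (i + u)) 1)
      (single x 1 + ∑ u ∈ Finset.range d, single (t (i + u)) 1) := by
  constructor
  · simp only [Finsupp.mapDomain_add, Finsupp.mapDomain_finsetSum, Finsupp.mapDomain_single,
      h.row_eq, hr]
    rw [Finset.sum_range_succ', add_comm, add_zero]
    rfl
  · simp only [Finsupp.mapDomain_add, Finsupp.mapDomain_finsetSum, Finsupp.mapDomain_single,
      h.col_eq, hc]
    rw [Finset.sum_range_succ, add_comm]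

/-- An alternating cycle is chordless, or it has a chord `x`. -/
theorem exists_chord (h : AlternatingCycle row col a b l s t)
    (hE : ∀ v,
      ¬ IsChordlessCycle (bipartiteGraph fun r c => ∃ s, row s = r ∧ col s = c) (2 * l) v) :
    ∃ x i d, 1 ≤ d ∧ d + 1 < l ∧ row x = row (s i) ∧ col x = col (s (i + d)) := by
  by_contra! hno
  -- the row of `s i` and the column of `s j` are joined only if they are neighbors in the cycle
  have key : ∀ i < l, ∀ j < l, (∃ x, row x = row (s i) ∧ col x = col (s j)) →
      j = i ∨ j + 1 = i ∨ (i = 0 ∧ j + 1 = l) := by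
    rintro i hi j hj ⟨x, hr, hc⟩
    by_contra! hcon
    rcases lt_or_gt_of_ne hcon.1 with hlt | hlt
    · refine hno x i (j + l - i) (by omega) (by omega) hr ?_
      rw [show i + (j + l - i) = j + l by omega, h.periodic, hc]
    · refine hno x i (j - i) (by omega) ?_ hr ?_
      · by_contra h1
        exact hcon.2.2 (by omega) (by omega)
      · rw [show i + (j - i) = j by omega, hc]
  have key' : ∀ i < l, ∀ j < l, (∃ x, row x = row (s i) ∧ col x = col (s j)) ↔
      j = i ∨ j + 1 = i ∨ (i = 0 ∧ j + 1 = l) := by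
    refine fun i hi j hj => ⟨key i hi j hj, ?_⟩
    rintro (rfl | rfl | ⟨rfl, hj⟩)
    · exact ⟨s j, rfl, rfl⟩
    · exact ⟨t j, h.row_eq j, h.col_eq j⟩
    · refine ⟨t j, ?_, h.col_eq j⟩
      rw [h.row_eq, hj, ← h.periodic 0, zero_add]
  refine hE (fun m => if m % 2 = 0 then .inl (row (s (m / 2))) else .inr (col (s (m / 2)))) ?_
  intro p hp q hq
  beta_reduce
  obtain ⟨i, hi | hi⟩ := p.even_or_odd' <;> obtain ⟨j, hj | hj⟩ := q.even_or_odd'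
  · rw [if_pos (by omega), if_pos (by omega)]
    simp only [bipartiteGraph_inl_inl, false_iff]
    omega
  · rw [if_pos (by omega), if_neg (by omega), bipartiteGraph_inl_inr, show p / 2 = i by omega,
      show q / 2 = j by omega, key' i (by omega) j (by omega)]
    omega
  · rw [if_neg (by omega), if_pos (by omega), bipartiteGraph_inr_inl, show p / 2 = i by omega,
      show q / 2 = j by omega, key' j (by omega) i (by omega)]
    omega
  · rw [if_neg (by omega), if_neg (by omega)]
    simp only [bipartiteGraph_inr_inr, false_iff]
    omega

end AlternatingCycle

/-- Two nonempty multisets of edges with the same degrees contain an alternating cycle: walking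
alternately along edges of `a` and of `b`, one eventually returns to an earlier edge. -/
theorem SameFiber.exists_alternatingCycle [Finite σ] {a b : σ →₀ ℕ} (h : SameFiber row col a b)
    (ha : a ≠ 0) : ∃ l s t, AlternatingCycle row col a b l s t := by
  obtain ⟨x, hx⟩ := Finsupp.ne_iff.1 ha
  rw [Finsupp.zero_apply] at hx
  have hT : ∀ c : κ, ∃ t, (∃ s, a s ≠ 0 ∧ col s = c) → b t ≠ 0 ∧ col t = c := by
    intro c
    by_cases hc : ∃ s, a s ≠ 0 ∧ col s = c
    · obtain ⟨s, hs, rfl⟩ := hc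
      obtain ⟨t, ht⟩ := h.exists_col hs
      exact ⟨t, fun _ => ht⟩
    · exact ⟨x, fun h => absurd h hc⟩
  have hS : ∀ r : ρ, ∃ s, (∃ t, b t ≠ 0 ∧ row t = r) → a s ≠ 0 ∧ row s = r := by
    intro r
    by_cases hr : ∃ t, b t ≠ 0 ∧ row t = r
    · obtain ⟨t, ht, rfl⟩ := hr
      obtain ⟨s, hs⟩ := h.symm.exists_row ht
      exact ⟨s, fun _ => hs⟩
    · exact ⟨x, fun h => absurd h hr⟩
  choose T hT using hT
  choose S hS using hS
  -- the step from an edge of `a` to the next one; it depends only on the column of the edge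
  let F : σ → σ := fun s => S (row (T (col s)))
  have hTa : ∀ s, a s ≠ 0 → b (T (col s)) ≠ 0 ∧ col (T (col s)) = col s := fun s hs =>
    hT _ ⟨s, hs, rfl⟩
  have hFa : ∀ s, a s ≠ 0 → a (F s) ≠ 0 ∧ row (F s) = row (T (col s)) := fun s hs =>
    hS _ ⟨_, (hTa s hs).1, rfl⟩
  have hiter : ∀ i, a (F^[i] x) ≠ 0 := by
    intro i
    induction i with
    | zero => exact hx
    | succ i ih => rw [Function.iterate_succ_apply']; exact (hFa _ ih).1
  obtain ⟨p, q, hpq, heq⟩ := Finite.exists_ne_map_eq_of_infinite fun i => F^[i] x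
  wlog hlt : p < q generalizing p q
  · exact this q p hpq.symm heq.symm (lt_of_le_of_ne (not_lt.1 hlt) hpq.symm)
  -- `y` is a periodic point
  set y := F^[p] x with hy
  have hper : y ∈ Function.periodicPts F := by
    refine ⟨q - p, by omega, ?_⟩
    change F^[q - p] y = y
    rw [hy, ← Function.iterate_add_apply, show q - p + p = q by omega]
    exact heq.symm
  have hya : ∀ i, a (F^[i] y) ≠ 0 := fun i => by
    rw [hy, ← Function.iterate_add_apply]; exact hiter _
  set l := Function.minimalPeriod F y with hl
  have hl0 : 0 < l := Function.minimalPeriod_pos_of_mem_periodicPts hper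
  have hperiodic : ∀ i, F^[i + l] y = F^[i] y := fun i => Function.iterate_add_minimalPeriod_eq
  have hback : ∀ i, F (F^[i + (l - 1)] y) = F^[i] y := fun i => by
    rw [← Function.iterate_succ_apply' F, show (i + (l - 1)).succ = i + l by omega, hperiodic]
  refine ⟨l, fun i => F^[i] y, fun i => T (col (F^[i] y)), hl0, hya, fun i => (hTa _ (hya i)).1,
    fun i => (hTa _ (hya i)).2, fun i => ?_, hperiodic,
    Function.iterate_injOn_Iio_minimalPeriod, fun i j hij => ?_, fun i j hij => ?_⟩
  · rw [Function.iterate_succ_apply']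
    exact (hFa _ (hya i)).2.symm
  · have h1 : ∀ i, S (row (F^[i] y)) = F^[i] y := by
      intro i
      conv_lhs => rw [← hback i, (hFa _ (hya _)).2]
      exact hback i
    rw [← h1 i, ← h1 j]
    exact congrArg S hij
  · have h1 : F (F^[i] y) = F (F^[j] y) := congrArg (fun c => S (row (T c))) hij
    have h2 := congrArg (fun z => F^[l - 1] z) h1
    simp only [← Function.iterate_succ_apply' F, ← Function.iterate_add_apply] at h2
    rw [show l - 1 + i.succ = i + l by omega, show l - 1 + j.succ = j + l by omega, hperiodic,
      hperiodic] at h2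
    exact h2

/-- If `a` has more than `k` edges, then a proper part of `a` can be replaced by edges one of which
belongs to `b`: the part is an alternating cycle or is cut off from one by a chord. -/
theorem SameFiber.exists_exchange [Finite σ] {k : ℕ}
    (hE : ∀ L, 2 * k < L → ∀ v,
      ¬ IsChordlessCycle (bipartiteGraph fun r c => ∃ s, row s = r ∧ col s = c) L v)
    {a b : σ →₀ ℕ} (h : SameFiber row col a b) (ha : k < a.degree) :
    ∃ o n t, o ≤ a ∧ SameFiber row col o n ∧ o.degree < a.degree ∧ n t ≠ 0 ∧ b t ≠ 0 := by
  obtain ⟨l, s, t, hst⟩ := h.exists_alternatingCycle (by rintro rfl; simp at ha)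
  have hinj : Set.InjOn s (Finset.range l) := by simpa using hst.injOn
  have hle := sum_single_le hinj fun i _ => hst.left_ne_zero i
  have hdeg := Finsupp.degree_mono hle
  rw [degree_sum_single, Finset.card_range] at hdeg
  rcases hdeg.lt_or_eq with hlt | heq
  · refine ⟨_, _, t 0, hle, sameFiber_of_alternating hst.col_eq hst.row_eq
      (by simpa using hst.periodic 0), ?_, ?_, hst.right_ne_zero 0⟩
    · rwa [degree_sum_single, Finset.card_range]
    · rw [Finsupp.finsetSum_apply]
      exact (Finset.sum_pos' (fun _ _ => Nat.zero_le _)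
        ⟨0, Finset.mem_range.2 hst.pos, by simp⟩).ne'
  · obtain ⟨x, i, d, hd1, hd, hr, hc⟩ := hst.exists_chord (hE _ (by omega))
    refine ⟨_, _, t i, sum_single_le ((hst.injOn_window i).mono ?_) fun u _ => hst.left_ne_zero _,
      hst.sameFiber_chord hr hc, ?_, ?_, hst.right_ne_zero i⟩
    · intro u hu
      simp only [Finset.coe_range, Set.mem_Iio] at hu ⊢
      omega
    · rw [degree_sum_single, Finset.card_range]
      omega
    · rw [Finsupp.add_apply, Finsupp.finsetSum_apply]
      exact (add_pos_of_nonneg_of_pos (Nat.zero_le _) (Finset.sum_pos' (fun _ _ => Nat.zero_le _)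
        ⟨0, Finset.mem_range.2 hd1, by simp⟩)).ne'

/-- If there are no chordless cycles of length greater than `2 * k`, then the fibers are connected
by moves of degree at most `k`. -/
theorem SameFiber.induction [Finite σ] {k : ℕ}
    (hE : ∀ L, 2 * k < L → ∀ v,
      ¬ IsChordlessCycle (bipartiteGraph fun r c => ∃ s, row s = r ∧ col s = c) L v)
    {R : (σ →₀ ℕ) → (σ →₀ ℕ) → Prop} (hadd : ∀ a b c, R a b → R (c + a) (c + b))
    (htrans : ∀ a b c, R a b → R b c → R a c)
    (hbase : ∀ a b, SameFiber row col a b → a.degree ≤ k → R a b)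
    {a b : σ →₀ ℕ} (h : SameFiber row col a b) : R a b := by
  induction hn : a.degree using Nat.strong_induction_on generalizing a b with
  | _ n ih =>
    subst hn
    rcases le_or_gt a.degree k with hak | hak
    · exact hbase a b h hak
    have hsub : ∀ {c : σ →₀ ℕ} {t : σ}, c t ≠ 0 → ∃ c', c = single t 1 + c' := fun hc =>
      ⟨_, (add_tsub_cancel_of_le (Finsupp.single_le_iff.2 (Nat.one_le_iff_ne_zero.2 hc))).symm⟩
    -- exponents with a common variable
    have hshare : ∀ c t, c.degree = a.degree → SameFiber row col c b → c t ≠ 0 → b t ≠ 0 →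
        R c b := by
      intro c t hc hcb hct hbt
      obtain ⟨c', rfl⟩ := hsub hct
      obtain ⟨b', rfl⟩ := hsub hbt
      refine hadd _ _ _ (ih c'.degree ?_ hcb.of_add_left rfl)
      rw [map_add, Finsupp.degree_single] at hc
      omega
    obtain ⟨o, n, t, hoa, hon, hdeg, hnt, hbt⟩ := h.exists_exchange hE hak
    obtain ⟨c, rfl⟩ := exists_add_of_le hoa
    rw [add_comm o c] at *
    have h1 := hon.add_left c
    refine htrans _ _ _ (hadd _ _ c (ih _ hdeg hon rfl)) (hshare (c + n) t h1.symm.degree_eq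
      (h1.symm.trans h) ?_ hbt)
    rw [Finsupp.add_apply]
    omega

open MvPolynomial

/-- A toric ideal of a bipartite graph without chordless cycles of length greater than `2 * k` is
generated in degrees at most `k`. -/
theorem le_span_binomial_of_not_isChordlessCycle {K : Type v} [Field K] {N : Type w}
    [AddCommMonoid N] [Finite σ] {I : Ideal (MvPolynomial σ K)} {e : (σ →₀ ℕ) →+ N}
    (hI : IsToricFor I e) (he : ∀ a b, e a = e b ↔ SameFiber row col a b) {k : ℕ}
    (hE : ∀ L, 2 * k < L → ∀ v,
      ¬ IsChordlessCycle (bipartiteGraph fun r c => ∃ s, row s = r ∧ col s = c) L v) :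
    I ≤ Ideal.span {f | ∃ a b, e a = e b ∧ a.degree ≤ k ∧ f = binomial K a b} := by
  rw [← hI.span_binomial_eq, Ideal.span_le]
  rintro _ ⟨a, b, -, h, rfl⟩
  refine SameFiber.induction (R := fun a b => binomial K a b ∈ Ideal.span
    {f | ∃ a b, e a = e b ∧ a.degree ≤ k ∧ f = binomial K a b}) hE ?_ ?_ ?_ ((he a b).1 h)
  · intro a b c h
    rw [binomial_add_left]
    exact Ideal.mul_mem_left _ _ h
  · intro a b c h h'
    rw [← binomial_add_binomial a b c]
    exact add_mem h h'
  · exact fun a b h hd => Ideal.subset_span ⟨a, b, (he a b).2 h, hd, rfl⟩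

/-- The edges `s i` and `t i` of a chordless cycle of length `2 * k` form the only two elements of
their fiber: a multiset of edges with the degrees of `∑ i, s i` that contains one of the `s i`
contains all of them. -/
theorem eq_sum_of_sameFiber {k : ℕ} {s t : ℕ → σ} (hcol : ∀ i, col (t i) = col (s i))
    (hper : ∀ i, s (i + k) = s i) (hinj : Set.InjOn (fun i => col (s i)) (Set.Iio k))
    (hne : ∀ i, s i ≠ t i)
    (hchord : ∀ x i j, row x = row (s (i + 1)) → col x = col (s j) → x = s (i + 1) ∨ x = t i)
    {b : σ →₀ ℕ} (hb : SameFiber row col (∑ i ∈ Finset.range k, single (s i) 1) b) {i₀ : ℕ}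
    (hi₀ : b (s i₀) ≠ 0) : ∑ i ∈ Finset.range k, single (s i) 1 = b := by
  classical
  set o : σ →₀ ℕ := ∑ i ∈ Finset.range k, single (s i) 1 with ho
  have hsinj : Set.InjOn s (Finset.range k) := by
    intro i hi j hj h
    simp only [Finset.coe_range] at hi hj
    exact hinj hi hj (congrArg col h)
  have hk : 0 < k := by
    by_contra h
    obtain rfl : k = 0 := by omega
    have h1 := hb.degree_eq
    rw [ho, Finset.sum_range_zero, map_zero, eq_comm, Finsupp.degree_eq_zero_iff] at h1
    simp [h1] at hi₀
  have hmod : ∀ p m, s (p + k * m) = s p := by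
    intro p m
    induction m with
    | zero => simp
    | succ n ih => rw [Nat.mul_succ, ← add_assoc, hper, ih]
  have hmod' : ∀ p, s (p % k) = s p := fun p => by
    rw [← hmod (p % k) (p / k), Nat.mod_add_div]
  have hos : ∀ i, o (s i) ≠ 0 := by
    intro i
    rw [← hmod', ho, Finsupp.finsetSum_apply]
    exact (Finset.sum_pos' (fun _ _ => Nat.zero_le _)
      ⟨i % k, Finset.mem_range.2 (Nat.mod_lt _ hk), by simp⟩).ne'
  have hstep : ∀ i, b (s i) ≠ 0 → b (s (i + 1)) ≠ 0 := by
    intro i hi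
    obtain ⟨u, hu, hur⟩ := hb.exists_row (hos (i + 1))
    obtain ⟨v, hv, hvc⟩ := hb.symm.exists_col hu
    obtain ⟨j, hj⟩ : ∃ j, s j = v := by
      rw [ho, Finsupp.finsetSum_apply] at hv
      obtain ⟨j, -, hj⟩ := Finset.exists_ne_zero_of_sum_ne_zero hv
      exact ⟨j, by_contra fun h => hj (Finsupp.single_eq_of_ne' h)⟩
    rcases hchord u i j hur (by rw [← hvc, hj]) with rfl | rfl
    · exact hu
    -- otherwise the column of `s i` would have degree at least two in `b`
    exfalso
    have h1 : ∑ x ∈ {s i, t i}, single x 1 ≤ b :=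
      sum_single_le (s := id) (Set.injOn_id _) (by simp [hi, hu])
    rw [Finset.sum_pair (hne i)] at h1
    obtain ⟨c, hc⟩ := exists_add_of_le h1
    have h2 : mapDomain col o (col (s i)) = 1 := by
      simp only [ho, Finsupp.mapDomain_finsetSum, Finsupp.mapDomain_single, Finsupp.finsetSum_apply]
      rw [Finset.sum_eq_single_of_mem (i % k) (Finset.mem_range.2 (Nat.mod_lt _ hk)), hmod',
        Finsupp.single_eq_same]
      intro j hj hji
      refine Finsupp.single_eq_of_ne' fun h =>
        hji (hinj (Finset.mem_range.1 hj) (Nat.mod_lt _ hk) ?_)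
      simp only [hmod', h]
    rw [hb.2, hc] at h2
    simp only [Finsupp.mapDomain_add, Finsupp.mapDomain_single, hcol, Finsupp.add_apply,
      Finsupp.single_eq_same] at h2
    omega
  have hall : ∀ i, b (s i) ≠ 0 := by
    have h1 : ∀ n, b (s (i₀ + n)) ≠ 0 := by
      intro n
      induction n with
      | zero => exact hi₀
      | succ n ih => exact hstep _ ih
    intro i
    rw [← hmod i i₀]
    obtain ⟨n, hn⟩ := Nat.exists_eq_add_of_le (show i₀ ≤ i + k * i₀ from
      (Nat.le_mul_of_pos_left i₀ hk).trans (Nat.le_add_left _ _))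
    rw [hn]
    exact h1 n
  obtain ⟨c, hc⟩ := exists_add_of_le (sum_single_le hsinj fun i _ => hall i : o ≤ b)
  have h1 := hb.degree_eq
  rw [hc, map_add, left_eq_add, Finsupp.degree_eq_zero_iff] at h1
  rw [hc, h1, add_zero]

/-- The binomial of a chordless cycle of length `2 * k` is not in the ideal generated by the
elements of `I` of degree less than `k`: the coefficient of the monomial `∏ i, y (s i)` vanishes on
it. -/
theorem not_le_span_of_chordless {K : Type v} [Field K] {N : Type w}
    [AddCommMonoid N] {I : Ideal (MvPolynomial σ K)} {e : (σ →₀ ℕ) →+ N}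
    (hI : IsToricFor I e) (he : ∀ a b, e a = e b ↔ SameFiber row col a b) {k : ℕ} (hk : 0 < k)
    {s t : ℕ → σ} (hcol : ∀ i, col (t i) = col (s i)) (hrow : ∀ i, row (t i) = row (s (i + 1)))
    (hper : ∀ i, s (i + k) = s i) (hinj : Set.InjOn (fun i => col (s i)) (Set.Iio k))
    (hne : ∀ i, s i ≠ t i)
    (hchord : ∀ x i j, row x = row (s (i + 1)) → col x = col (s j) → x = s (i + 1) ∨ x = t i) :
    ¬ I ≤ Ideal.span {f ∈ I | f.totalDegree < k} := by
  classical
  intro hle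
  set o : σ →₀ ℕ := ∑ i ∈ Finset.range k, single (s i) 1 with ho
  set n : σ →₀ ℕ := ∑ i ∈ Finset.range k, single (t i) 1 with hn
  have hon : SameFiber row col o n :=
    sameFiber_of_alternating hcol hrow (by simpa using hper 0)
  have hne' : n ≠ o := by
    intro h
    have h1 : o (s 0) ≠ 0 := by
      rw [ho, Finsupp.finsetSum_apply]
      exact (Finset.sum_pos' (fun _ _ => Nat.zero_le _)
        ⟨0, Finset.mem_range.2 hk, by simp⟩).ne'
    rw [← h, hn, Finsupp.finsetSum_apply] at h1
    obtain ⟨j, hj, hj'⟩ := Finset.exists_ne_zero_of_sum_ne_zero h1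
    have h2 : t j = s 0 := by_contra fun h => hj' (Finsupp.single_eq_of_ne' h)
    have h3 : j = 0 := hinj (Finset.mem_range.1 hj) hk (by simp only [← hcol j, h2])
    subst h3
    exact hne 0 h2.symm
  have hcoeff : ∀ f ∈ Ideal.span {f ∈ I | f.totalDegree < k}, ∀ p, coeff o (p * f) = 0 := by
    intro f hf
    induction hf using Submodule.span_induction with
    | zero => simp
    | add f g _ _ hf hg => intro p; rw [mul_add, coeff_add, hf, hg, add_zero]
    | smul q f _ ih => intro p; rw [smul_eq_mul, ← mul_assoc, ih]
    | mem f hf =>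
      intro p
      rw [coeff_mul]
      refine Finset.sum_eq_zero fun x hx => ?_
      rw [Finset.HasAntidiagonal.mem_antidiagonal] at hx
      by_contra h
      have hxf := mem_support_iff.2 (right_ne_zero_of_mul h)
      have h1 : x.2.degree < k := (le_totalDegree hxf).trans_lt hf.2
      -- the complementary factor of `o` is not constant, so `x.2` is alone in its fiber
      have h2 : x.1 ≠ 0 := by
        intro h2
        rw [h2, zero_add] at hx
        rw [hx, ho, degree_sum_single, Finset.card_range] at h1
        exact lt_irrefl _ h1
      obtain ⟨y, hy⟩ := Finsupp.ne_iff.1 h2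
      rw [Finsupp.zero_apply] at hy
      obtain ⟨i, rfl⟩ : ∃ i, s i = y := by
        have h3 : o y ≠ 0 := by rw [← hx, Finsupp.add_apply]; omega
        rw [ho, Finsupp.finsetSum_apply] at h3
        obtain ⟨i, -, hi⟩ := Finset.exists_ne_zero_of_sum_ne_zero h3
        exact ⟨i, by_contra fun h => hi (Finsupp.single_eq_of_ne' h)⟩
      obtain ⟨b, -, hb, hbe⟩ := hI.exists_ne_mem_support hf.1 hxf
      have h4 := ((he _ _).1 hbe.symm).add_left x.1
      rw [hx] at h4
      have h5 := eq_sum_of_sameFiber hcol hper hinj hne hchord h4 (i₀ := i)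
        (by rw [Finsupp.add_apply]; omega)
      rw [← ho, ← hx] at h5
      exact hb (add_left_cancel h5).symm
  have h1 := hcoeff _ (hle (hI.binomial_mem_iff.2 ((he _ _).2 hon))) 1
  rw [one_mul] at h1
  simp [binomial, coeff_monomial, hne'] at h1

end AlternatingCycle

/-! ### Toric ideals of lattice polytopes -/

section LatticePolytope

open MvPolynomial

variable {V : Type u} (K : Type v) [Field K] (P : Set (V → ℝ))

/-- The exponent `(∑ a, α a • a, ∑ a, α a)` of the image of the monomial `y^α` in the toric ring. -/
def exponent : (latticePoints P →₀ ℕ) →+ (V → ℤ) × ℕ :=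
  Finsupp.liftAddHom fun a => multiplesHom _ (a.1, 1)

@[simp] theorem exponent_single (a : latticePoints P) : exponent P (single a 1) = (a.1, 1) := by
  simp [exponent]

theorem exponent_snd (α : latticePoints P →₀ ℕ) : (exponent P α).2 = α.degree := by
  induction α using Finsupp.induction_linear with
  | zero => simp
  | add α β hα hβ => rw [map_add, Prod.snd_add, hα, hβ, map_add]
  | single a n => simp [exponent]

theorem degree_eq_of_exponent_eq {α β : latticePoints P →₀ ℕ} (h : exponent P α = exponent P β) :
    α.degree = β.degree := by
  rw [← exponent_snd, h, exponent_snd]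

/-- The generator `X^a t` of the toric ring. -/
def toricGenerator (a : latticePoints P) : toricRing K P :=
  ⟨laurentMonomial K a.1, Algebra.subset_adjoin (Set.mem_image_of_mem _ a.2)⟩

theorem toricIdeal_eq_ker :
    toricIdeal K P = RingHom.ker (aeval (R := K) (toricGenerator K P)) := rfl

theorem coe_mon_toricGenerator (α : latticePoints P →₀ ℕ) :
    ((mon (toricGenerator K P) α : toricRing K P) : LaurentRing K V) =
      AddMonoidAlgebra.single (exponent P α) 1 := by
  induction α using Finsupp.induction_linear with
  | zero => simp [mon_zero, AddMonoidAlgebra.one_def]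
  | add α β hα hβ =>
    rw [mon_add, MulMemClass.coe_mul, hα, hβ, map_add, AddMonoidAlgebra.single_mul_single, one_mul]
  | single a n =>
    rw [mon, Finsupp.prod_single_index (h := fun i n => toricGenerator K P i ^ n) (pow_zero _),
      SubmonoidClass.coe_pow]
    simp [toricGenerator, laurentMonomial, exponent, AddMonoidAlgebra.single_pow]

theorem isToricFor_toricIdeal : IsToricFor (toricIdeal K P) (exponent P) := by
  classical
  intro f
  have hval : ((aeval (R := K) (toricGenerator K P) f : toricRing K P) : LaurentRing K V) =
      ∑ b ∈ f.support, AddMonoidAlgebra.single (exponent P b) (f.coeff b) := by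
    conv_lhs => rw [f.as_sum]
    rw [map_sum, AddSubmonoidClass.coe_finsetSum]
    refine Finset.sum_congr rfl fun b _ => ?_
    rw [show monomial b (f.coeff b) = f.coeff b • monomial b (1 : K) by
      rw [smul_monomial, smul_eq_mul, mul_one], map_smul, aeval_monomial_one, SetLike.val_smul,
      coe_mon_toricGenerator, AddMonoidAlgebra.smul_single, smul_eq_mul, mul_one]
  have hcoeff : ∀ z, (∑ b ∈ f.support, AddMonoidAlgebra.single (exponent P b) (f.coeff b)).coeff z =
      ∑ b ∈ f.support with exponent P b = z, f.coeff b := by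
    intro z
    rw [AddMonoidAlgebra.coeff_sum, Finsupp.finsetSum_apply, Finset.sum_filter]
    exact Finset.sum_congr rfl fun b _ => by
      rw [AddMonoidAlgebra.coeff_single, Finsupp.single_apply]
  rw [toricIdeal_eq_ker, RingHom.mem_ker, ← ZeroMemClass.coe_eq_zero, hval,
    ← AddMonoidAlgebra.coeff_inj, Finsupp.ext_iff]
  simp only [hcoeff, AddMonoidAlgebra.coeff_zero, Finsupp.zero_apply]
  constructor
  · intro h a
    convert h (exponent P a)
  · intro h z
    by_cases hz : ∃ a, exponent P a = z
    · obtain ⟨a, rfl⟩ := hz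
      convert h a
    · rw [Finset.filter_false_of_mem fun b _ hb => hz ⟨b, hb⟩, Finset.sum_empty]

theorem toricGenerator_mem_toricGrading (a : latticePoints P) :
    toricGenerator K P a ∈ toricGrading K P 1 :=
  AddMonoidAlgebra.single_mem_gradeBy (AddMonoidHom.snd (V → ℤ) ℕ) (a.1, 1) 1

theorem surjective_aeval_toricGenerator :
    Function.Surjective (aeval (R := K) (toricGenerator K P)) := by
  rw [← AlgHom.range_eq_top, ← Algebra.adjoin_range_eq_range_aeval, eq_top_iff]
  rintro ⟨x, hx⟩ -
  have h1 : toricRing K P ≤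
      (Algebra.adjoin K (Set.range (toricGenerator K P))).map (toricRing K P).val := by
    refine Algebra.adjoin_le ?_
    rintro _ ⟨a, ha, rfl⟩
    exact ⟨toricGenerator K P ⟨a, ha⟩, Algebra.subset_adjoin ⟨_, rfl⟩, rfl⟩
  obtain ⟨y, hy, hyx⟩ := h1 hx
  have : y = ⟨x, hx⟩ := Subtype.ext hyx
  exact this ▸ hy

theorem eq_zero_of_mem_toricIdeal {f : MvPolynomial (latticePoints P) K} (hf : f ∈ toricIdeal K P)
    (hd : f.totalDegree < 2) : f = 0 := by
  refine (isToricFor_toricIdeal K P).eq_zero_of_totalDegree_le_one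
    (fun _ _ => degree_eq_of_exponent_eq P) (fun a b h => ?_) hf hd
  rw [exponent_single, exponent_single, Prod.mk.injEq] at h
  exact Subtype.ext h.1

end LatticePolytope

/-! ### Induced cycles -/

section InducedCycles

variable {V : Type u} {H : SimpleGraph V}

theorem cycleGraph_adj_mk {l i j : ℕ} (hl : 2 ≤ l) (hi : i < l) (hj : j < l) :
    (SimpleGraph.cycleGraph l).Adj ⟨i, hi⟩ ⟨j, hj⟩ ↔
      i + 1 = j ∨ j + 1 = i ∨ (i + 1 = l ∧ j = 0) ∨ (j + 1 = l ∧ i = 0) := by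
  have key : ∀ {i j : ℕ} (hi : i < l) (hj : j < l),
      ((⟨i, hi⟩ - ⟨j, hj⟩ : Fin l) : ℕ) = if j ≤ i then i - j else l - j + i := by
    intro i j hi hj
    rw [Fin.sub_def]
    simp only
    split_ifs with h
    · rw [show l - j + i = (i - j) + l by omega, Nat.add_mod_right, Nat.mod_eq_of_lt (by omega)]
    · exact Nat.mod_eq_of_lt (by omega)
  rw [SimpleGraph.cycleGraph_adj', key, key]
  split_ifs <;> omega

/-- An induced cycle, as a periodic sequence of vertices. -/
theorem exists_periodic_of_mem_inducedCycleLengths {l : ℕ} (hl : l ∈ inducedCycleLengths H) :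
    ∃ w : ℕ → V, (∀ m n, w m = w n ↔ m ≡ n [MOD l]) ∧
      ∀ m n, H.Adj (w m) (w n) ↔ m + 1 ≡ n [MOD l] ∨ n + 1 ≡ m [MOD l] := by
  obtain ⟨h3, ⟨φ⟩⟩ := hl
  have hpos : 0 < l := by omega
  refine ⟨fun m => φ ⟨m % l, Nat.mod_lt _ hpos⟩, fun m n => ?_, fun m n => ?_⟩
  · rw [φ.injective.eq_iff, Fin.mk.injEq, Nat.ModEq]
  · have hmod : ∀ m n, m + 1 ≡ n [MOD l] ↔
        m % l + 1 = n % l ∨ (m % l + 1 = l ∧ n % l = 0) := by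
      intro m n
      have hm := Nat.mod_lt m hpos
      have hn := Nat.mod_lt n hpos
      rw [Nat.ModEq, Nat.add_mod, Nat.mod_eq_of_lt (show 1 < l by omega)]
      by_cases h : m % l + 1 = l
      · rw [h, Nat.mod_self]; omega
      · rw [Nat.mod_eq_of_lt (by omega)]; omega
    rw [φ.map_adj_iff, cycleGraph_adj_mk (by omega), hmod, hmod]
    omega

theorem IsChordlessCycle.mem_inducedCycleLengths {l : ℕ} (hl : 5 ≤ l) {v : ℕ → V}
    (hv : IsChordlessCycle H l v) : l ∈ inducedCycleLengths H := by
  have hinj : ∀ s < l, ∀ t < l, v s = v t → s = t := by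
    intro s hs t ht hst
    -- the two neighbours of `v s` are the two neighbours of `v t`
    have key : ∀ p < l, (s + 1 = p ∨ p + 1 = s ∨ (s + 1 = l ∧ p = 0) ∨ (p + 1 = l ∧ s = 0)) ↔
        (t + 1 = p ∨ p + 1 = t ∨ (t + 1 = l ∧ p = 0) ∨ (p + 1 = l ∧ t = 0)) := fun p hp => by
      rw [← hv s hs p hp, hst, hv t ht p hp]
    have h1 : ∃ p < l, s + 1 = p ∨ (s + 1 = l ∧ p = 0) := by
      rcases Nat.lt_or_ge (s + 1) l with h | h
      · exact ⟨s + 1, h, by omega⟩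
      · exact ⟨0, by omega, by omega⟩
    have h2 : ∃ p < l, p + 1 = s ∨ (p + 1 = l ∧ s = 0) := by
      rcases Nat.eq_zero_or_pos s with h | h
      · exact ⟨l - 1, by omega, by omega⟩
      · exact ⟨s - 1, by omega, by omega⟩
    obtain ⟨p, hp, hsp⟩ := h1
    obtain ⟨q, hq, hsq⟩ := h2
    have h3 := (key p hp).1 (by omega)
    have h4 := (key q hq).1 (by omega)
    clear key
    omega
  refine ⟨by omega, ⟨⟨⟨fun i => v i, fun i j h => Fin.ext (hinj i i.2 j j.2 h)⟩, ?_⟩⟩⟩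
  rintro ⟨i, hi⟩ ⟨j, hj⟩
  rw [cycleGraph_adj_mk (by omega), ← hv i hi j hj]
  rfl

/-- A cycle of minimal length is induced. -/
theorem nonempty_inducedCycleLengths (hH : ¬ H.IsAcyclic) : (inducedCycleLengths H).Nonempty := by
  classical
  have hex : ∃ l, 3 ≤ l ∧ SimpleGraph.IsContained (SimpleGraph.cycleGraph l) H := by
    rw [SimpleGraph.isAcyclic_iff_free_cycleGraph] at hH
    push Not at hH
    obtain ⟨n, hn, h⟩ := hH
    exact ⟨n, hn, h⟩
  obtain ⟨hl, ⟨φ⟩⟩ := Nat.find_spec hex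
  have hmin := fun m => Nat.find_min hex (m := m)
  set l := Nat.find hex
  have hchord : ∀ i j (hi : i < l) (hj : j < l), i < j → H.Adj (φ ⟨i, hi⟩) (φ ⟨j, hj⟩) →
      (SimpleGraph.cycleGraph l).Adj ⟨i, hi⟩ ⟨j, hj⟩ := by
    intro i j hi hj hij hadj
    rw [cycleGraph_adj_mk (by omega)]
    by_contra hcon
    -- the chord closes the path from `i` to `j`
    refine hmin (j - i + 1) (by omega) ⟨by omega, ⟨⟨⟨fun p => φ ⟨i + p, by omega⟩, ?_⟩, ?_⟩⟩⟩
    · rintro ⟨p, hp⟩ ⟨q, hq⟩ hpq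
      rw [cycleGraph_adj_mk (by omega)] at hpq
      change H.Adj (φ ⟨i + p, by omega⟩) (φ ⟨i + q, by omega⟩)
      rcases hpq with h | h | ⟨h1, h2⟩ | ⟨h1, h2⟩
      · exact φ.toHom.map_adj ((cycleGraph_adj_mk (by omega) _ _).2 (by omega))
      · exact φ.toHom.map_adj ((cycleGraph_adj_mk (by omega) _ _).2 (by omega))
      · obtain rfl : p = j - i := by omega
        subst h2
        convert hadj.symm using 3 <;> omega
      · obtain rfl : q = j - i := by omega
        subst h2
        convert hadj using 3 <;> omega
    · intro p q hpq
      have := φ.injective hpq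
      simp only [Fin.mk.injEq] at this
      exact Fin.ext (by omega)
  refine ⟨l, hl, ⟨⟨⟨φ, φ.injective⟩, ?_⟩⟩⟩
  rintro ⟨i, hi⟩ ⟨j, hj⟩
  refine ⟨fun hadj => ?_, fun hadj => φ.toHom.map_adj hadj⟩
  rcases lt_trichotomy i j with h | rfl | h
  · exact hchord i j hi hj h hadj
  · exact absurd rfl hadj.ne
  · exact (hchord j i hj hi h hadj.symm).symm

theorem inducedCycleLengths_eq_empty (hH : H.IsAcyclic) : inducedCycleLengths H = ∅ := by
  rw [Set.eq_empty_iff_forall_notMem]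
  rintro l ⟨hl, h⟩
  exact SimpleGraph.isAcyclic_iff_free_cycleGraph.1 hH l hl h.isContained

theorem bddAbove_inducedCycleLengths [Finite V] : BddAbove (inducedCycleLengths H) := by
  refine ⟨Nat.card V, ?_⟩
  rintro l ⟨-, ⟨φ⟩⟩
  simpa using Nat.card_le_card_of_injective φ φ.injective

/-- The length of an induced cycle of a bipartite graph is even. -/
theorem exists_eq_two_mul {p : V → Prop} (hp : ∀ i j, H.Adj i j → (p i ↔ ¬ p j)) {l : ℕ}
    (hl : l ∈ inducedCycleLengths H) : ∃ k, 2 ≤ k ∧ l = 2 * k := by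
  obtain ⟨w, -, hw⟩ := exists_periodic_of_mem_inducedCycleLengths hl
  have h3 := hl.1
  have hstep : ∀ m, p (w (2 * m)) ↔ p (w 0) := by
    intro m
    induction m with
    | zero => rfl
    | succ m ih =>
      have h1 := hp _ _ ((hw (2 * m) (2 * m + 1)).2 (Or.inl rfl))
      have h2 := hp _ _ ((hw (2 * m + 1) (2 * m + 2)).2 (Or.inl rfl))
      rw [show 2 * (m + 1) = 2 * m + 2 by ring]
      tauto
  obtain ⟨k, hk | hk⟩ := l.even_or_odd'
  · exact ⟨k, by omega, hk⟩
  · have h1 := hp _ _ ((hw (2 * k) 0).2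
      (Or.inl (by rw [← hk]; exact Nat.modEq_zero_iff_dvd.2 dvd_rfl)))
    have h2 := hstep k
    tauto

end InducedCycles

/-! ### The stable set polytope of the complement of a bipartite graph -/

section StableSets

variable {V : Type u} {G : SimpleGraph V}

theorem indicator_mem_latticePoints {W : Set V} (hW : G.IsIndepSet W) :
    W.indicator (fun _ => (1 : ℤ)) ∈ latticePoints (stableSetPolytope G) := by
  refine subset_convexHull ℝ _ ⟨W, hW, ?_⟩
  ext i
  by_cases hi : i ∈ W <;> simp [hi]

/-- The lattice point of a stable set. -/
def stablePoint (W : Set V) (hW : G.IsIndepSet W) : latticePoints (stableSetPolytope G) :=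
  ⟨W.indicator fun _ => 1, indicator_mem_latticePoints hW⟩

@[simp] theorem stablePoint_apply_eq_one {W : Set V} (hW : G.IsIndepSet W) {i : V} :
    (stablePoint W hW).1 i = 1 ↔ i ∈ W := by
  by_cases hi : i ∈ W <;> simp [stablePoint, hi]

theorem isIndepSet_pair {i j : V} (h : Gᶜ.Adj i j) : G.IsIndepSet {i, j} := by
  rw [SimpleGraph.compl_adj] at h
  rintro x (rfl | rfl) y (rfl | rfl) hxy
  · exact absurd rfl hxy
  · exact h.2
  · exact fun h' => h.2 h'.symm
  · exact absurd rfl hxy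

/-- The stable set polytope satisfies the edge inequalities, so its lattice points have coordinates
`0` and `1`, and the coordinates `1` form a stable set. -/
theorem latticePoints_spec {a : V → ℤ} (ha : a ∈ latticePoints (stableSetPolytope G)) :
    (∀ i, a i = 0 ∨ a i = 1) ∧ ∀ i j, a i = 1 → a j = 1 → i ≠ j → Gᶜ.Adj i j := by
  have h : stableSetPolytope G ⊆
      {x | (∀ i, 0 ≤ x i ∧ x i ≤ 1) ∧ ∀ i j, G.Adj i j → x i + x j ≤ 1} := by
    classical
    refine convexHull_min ?_ ?_
    · rintro _ ⟨W, hW, rfl⟩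
      refine ⟨fun i => ?_, fun i j hij => ?_⟩
      · by_cases hi : i ∈ W <;> simp [hi]
      · by_cases hi : i ∈ W
        · have hj : j ∉ W := fun hj => hW hi hj hij.ne hij
          simp [hi, hj]
        · by_cases hj : j ∈ W <;> simp [hi, hj]
    · intro x hx y hy s t hs ht hst
      refine ⟨fun i => ⟨?_, ?_⟩, fun i j hij => ?_⟩ <;>
        simp only [Pi.add_apply, Pi.smul_apply, smul_eq_mul]
      · have := mul_nonneg hs (hx.1 i).1
        have := mul_nonneg ht (hy.1 i).1
        linarith
      · have := mul_le_mul_of_nonneg_left (hx.1 i).2 hs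
        have := mul_le_mul_of_nonneg_left (hy.1 i).2 ht
        linarith
      · have := mul_le_mul_of_nonneg_left (hx.2 i j hij) hs
        have := mul_le_mul_of_nonneg_left (hy.2 i j hij) ht
        linarith
  obtain ⟨h1, h2⟩ := h ha
  refine ⟨fun i => ?_, fun i j hi hj hij => ?_⟩
  · have h3 : (0 : ℝ) ≤ a i ∧ (a i : ℝ) ≤ 1 := h1 i
    norm_cast at h3
    omega
  · rw [SimpleGraph.compl_adj]
    refine ⟨hij, fun hadj => ?_⟩
    have h3 : (a i : ℝ) + a j ≤ 1 := h2 i j hadj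
    norm_cast at h3
    omega

open Classical in
/-- The element of `{i | p i}` at which the vector `a` takes the value `1`. There is at most one if
`p` is a color class of the complement of `G` and `a` a lattice point of the stable set polytope. -/
def part (p : V → Prop) (a : latticePoints (stableSetPolytope G)) : Option V :=
  if h : ∃ i, p i ∧ a.1 i = 1 then some h.choose else none

variable {p : V → Prop}

theorem part_eq_some_iff (hp : ∀ i j, Gᶜ.Adj i j → p i → ¬ p j)
    {a : latticePoints (stableSetPolytope G)} {i : V} : part p a = some i ↔ p i ∧ a.1 i = 1 := by
  rw [part]
  split_ifs with h
  · rw [Option.some_inj]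
    refine ⟨fun hi => hi ▸ h.choose_spec, fun hi => ?_⟩
    by_contra hne
    exact hp _ _ ((latticePoints_spec a.2).2 _ _ h.choose_spec.2 hi.2 hne) h.choose_spec.1 hi.1
  · refine iff_of_false (by simp) fun hi => h ⟨i, hi⟩

open Classical in
theorem apply_eq_ite (hp : ∀ i j, Gᶜ.Adj i j → p i → ¬ p j)
    (a : latticePoints (stableSetPolytope G)) {i : V} (hi : p i) :
    a.1 i = if part p a = some i then 1 else 0 := by
  split_ifs with h
  · exact ((part_eq_some_iff hp).1 h).2
  · exact ((latticePoints_spec a.2).1 i).resolve_right fun h1 =>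
      h ((part_eq_some_iff hp).2 ⟨hi, h1⟩)

theorem exponent_fst_eq (hp : ∀ i j, Gᶜ.Adj i j → p i → ¬ p j)
    (α : latticePoints (stableSetPolytope G) →₀ ℕ) {i : V} (hi : p i) :
    (exponent _ α).1 i = (mapDomain (part p) α (some i) : ℤ) := by
  classical
  induction α using Finsupp.induction_linear with
  | zero => simp
  | add α β hα hβ =>
    rw [map_add, Prod.fst_add, Pi.add_apply, hα, hβ, Finsupp.mapDomain_add, Finsupp.add_apply,
      Nat.cast_add]
  | single a n =>
    rw [Finsupp.mapDomain_single, Finsupp.single_apply, exponent, Finsupp.liftAddHom_apply_single]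
    have h1 := apply_eq_ite hp a hi
    split_ifs at h1 ⊢ <;> simp [h1]

theorem mapDomain_part_some_of_not (hp : ∀ i j, Gᶜ.Adj i j → p i → ¬ p j)
    (α : latticePoints (stableSetPolytope G) →₀ ℕ) {i : V} (hi : ¬ p i) :
    mapDomain (part p) α (some i) = 0 := by
  by_contra h
  obtain ⟨a, -, ha⟩ := mapDomain_apply_ne_zero_iff.1 h
  exact hi ((part_eq_some_iff hp).1 ha).1

theorem eq_of_degree_eq_of_some_eq [Finite V] {f g : Option V →₀ ℕ} (hd : f.degree = g.degree)
    (h : ∀ i, f (some i) = g (some i)) : f = g := by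
  have := Fintype.ofFinite V
  rw [Finsupp.degree_eq_sum, Finsupp.degree_eq_sum, Fintype.sum_option, Fintype.sum_option,
    Finset.sum_congr rfl fun i _ => h i] at hd
  ext (_ | i)
  · exact add_right_cancel hd
  · exact h i

theorem mapDomain_part_eq [Finite V] (hp : ∀ i j, Gᶜ.Adj i j → p i → ¬ p j)
    {α β : latticePoints (stableSetPolytope G) →₀ ℕ} (h : exponent _ α = exponent _ β) :
    mapDomain (part p) α = mapDomain (part p) β := by
  refine eq_of_degree_eq_of_some_eq ?_ fun i => ?_
  · rw [Finsupp.degree_mapDomain, Finsupp.degree_mapDomain, degree_eq_of_exponent_eq _ h]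
  · by_cases hi : p i
    · have h1 := exponent_fst_eq hp α hi
      rw [h, exponent_fst_eq hp β hi] at h1
      exact_mod_cast h1.symm
    · rw [mapDomain_part_some_of_not hp α hi, mapDomain_part_some_of_not hp β hi]

-- `p` and its negation are the color classes of the complement of `G`.
variable (hp : ∀ i j, Gᶜ.Adj i j → (p i ↔ ¬ p j))
include hp

theorem not_of_adj : ∀ i j, Gᶜ.Adj i j → p i → ¬ p j := fun i j h => (hp i j h).1

theorem of_not_adj : ∀ i j, Gᶜ.Adj i j → ¬ p i → ¬ ¬ p j := fun i j h hi =>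
  not_not.2 ((hp j i h.symm).2 hi)

/-- The toric ideal of the stable set polytope is that of a bipartite graph: a stable set of `G` is
an edge of the complement of `G`, extended by a vertex `none` in each color class that is joined to
all vertices of the other class. -/
theorem exponent_eq_iff_sameFiber [Finite V] (α β : latticePoints (stableSetPolytope G) →₀ ℕ) :
    exponent _ α = exponent _ β ↔ SameFiber (part p) (part fun i => ¬ p i) α β := by
  refine ⟨fun h => ⟨mapDomain_part_eq (not_of_adj hp) h, mapDomain_part_eq (of_not_adj hp) h⟩,
    fun h => Prod.ext (funext fun i => ?_) ?_⟩
  · by_cases hi : p i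
    · rw [exponent_fst_eq (not_of_adj hp) α hi, exponent_fst_eq (not_of_adj hp) β hi, h.1]
    · rw [exponent_fst_eq (of_not_adj hp) α hi, exponent_fst_eq (of_not_adj hp) β hi, h.2]
  · rw [exponent_snd, exponent_snd, h.degree_eq]

theorem part_injective (a b : latticePoints (stableSetPolytope G)) (h : part p a = part p b)
    (h' : part (fun i => ¬ p i) a = part (fun i => ¬ p i) b) : a = b := by
  refine Subtype.ext (funext fun i => ?_)
  by_cases hi : p i
  · rw [apply_eq_ite (not_of_adj hp) a hi, apply_eq_ite (not_of_adj hp) b hi, h]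
  · rw [apply_eq_ite (of_not_adj hp) a hi, apply_eq_ite (of_not_adj hp) b hi, h']

theorem finite_latticePoints [Finite V] : Finite (latticePoints (stableSetPolytope G)) :=
  Finite.of_injective (fun a => (part p a, part (fun i => ¬ p i) a)) fun a b h =>
    part_injective hp a b (congrArg Prod.fst h) (congrArg Prod.snd h)

/-- The lattice point of an edge of the complement. -/
theorem exists_part_eq_some {i j : V} (h : Gᶜ.Adj i j) (hi : p i) :
    ∃ a : latticePoints (stableSetPolytope G),
      part p a = some i ∧ part (fun i => ¬ p i) a = some j := by
  refine ⟨stablePoint _ (isIndepSet_pair h), ?_, ?_⟩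
  · rw [part_eq_some_iff (not_of_adj hp), stablePoint_apply_eq_one]
    exact ⟨hi, Or.inl rfl⟩
  · rw [part_eq_some_iff (of_not_adj hp), stablePoint_apply_eq_one]
    exact ⟨(hp i j h).1 hi, Or.inr rfl⟩

theorem adj_of_part_eq_some {a : latticePoints (stableSetPolytope G)} {i j : V}
    (hi : part p a = some i) (hj : part (fun i => ¬ p i) a = some j) : Gᶜ.Adj i j := by
  rw [part_eq_some_iff (not_of_adj hp)] at hi
  rw [part_eq_some_iff (of_not_adj hp)] at hj
  exact (latticePoints_spec a.2).2 i j hi.2 hj.2 (by rintro rfl; exact hj.1 hi.1)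

end StableSets

/-! ### Chordless cycles and induced cycles -/

section Cycles

variable {V : Type u} {G : SimpleGraph V} {p : V → Prop}

theorem part_stablePoint_eq_none (hp : ∀ i j, Gᶜ.Adj i j → p i → ¬ p j) {W : Set V}
    (hW : G.IsIndepSet W) (h : ∀ i ∈ W, ¬ p i) : part p (stablePoint W hW) = none := by
  rw [Option.eq_none_iff_forall_ne_some]
  intro i hi
  rw [part_eq_some_iff hp, stablePoint_apply_eq_one] at hi
  exact h i hi.2 hi.1

theorem exists_part_eq_none {q : V → Prop} (hp : ∀ i j, Gᶜ.Adj i j → p i → ¬ p j)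
    (hq : ∀ i j, Gᶜ.Adj i j → q i → ¬ q j) (hqp : ∀ i, q i → ¬ p i)
    (a : latticePoints (stableSetPolytope G)) :
    ∃ b : latticePoints (stableSetPolytope G), part p b = none ∧ part q b = part q a := by
  cases h : part q a with
  | none =>
    have h0 : G.IsIndepSet ∅ := Set.pairwise_empty _
    exact ⟨stablePoint ∅ h0, part_stablePoint_eq_none hp h0 (by simp),
      part_stablePoint_eq_none hq h0 (by simp)⟩
  | some j =>
    have h1 : G.IsIndepSet {j} := Set.pairwise_singleton _ _
    have hj := ((part_eq_some_iff hq).1 h).1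
    refine ⟨stablePoint {j} h1, part_stablePoint_eq_none hp h1 ?_, ?_⟩
    · rintro i rfl
      exact hqp i hj
    · rw [part_eq_some_iff hq, stablePoint_apply_eq_one]
      exact ⟨hj, rfl⟩

variable (G p) in
/-- The bipartite graph whose edges are the lattice points of the stable set polytope. -/
def stableGraph : SimpleGraph (Option V ⊕ Option V) :=
  bipartiteGraph fun r c => ∃ a : latticePoints (stableSetPolytope G),
    part p a = r ∧ part (fun i => ¬ p i) a = c

variable (hp : ∀ i j, Gᶜ.Adj i j → (p i ↔ ¬ p j))
include hp

/-- The vertices `none` are joined to all vertices of the other side that have an edge. -/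
theorem stableGraph_adj_of_none {x y z : Option V ⊕ Option V}
    (hx : x = .inl none ∨ x = .inr none) (hxy : x.isLeft ≠ y.isLeft)
    (hyz : (stableGraph G p).Adj y z) : (stableGraph G p).Adj x y := by
  rcases hx with rfl | rfl <;> rcases y with y | y <;> rcases z with z | z <;>
    simp only [Sum.isLeft_inl, Sum.isLeft_inr, ne_eq, not_true_eq_false] at hxy
  · obtain ⟨a, -, rfl⟩ := hyz
    obtain ⟨b, hb, hb'⟩ := exists_part_eq_none (not_of_adj hp) (of_not_adj hp) (fun i hi => hi) a
    exact ⟨b, hb, hb'⟩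
  · exact absurd hyz (by simp [stableGraph])
  · exact absurd hyz (by simp [stableGraph])
  · obtain ⟨a, rfl, -⟩ := hyz
    obtain ⟨b, hb, hb'⟩ := exists_part_eq_none (of_not_adj hp) (not_of_adj hp)
      (fun i hi => not_not.2 hi) a
    exact ⟨b, hb', hb⟩

omit hp in
theorem isLeft_ne_of_stableGraph_adj {x y : Option V ⊕ Option V} (h : (stableGraph G p).Adj x y) :
    x.isLeft ≠ y.isLeft := by
  rcases x with x | x <;> rcases y with y | y
  · exact absurd h (by simp [stableGraph])
  · simp
  · simp
  · exact absurd h (by simp [stableGraph])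

/-- The graph induced on the vertices of `G` is the complement of `G`. -/
theorem stableGraph_adj_iff {x y x' y' : Option V ⊕ Option V} {i j : V}
    (hx : Sum.elim id id x = some i) (hy : Sum.elim id id y = some j)
    (hxx : (stableGraph G p).Adj x x') (hyy : (stableGraph G p).Adj y y') :
    (stableGraph G p).Adj x y ↔ Gᶜ.Adj i j := by
  have key : ∀ {x x' : Option V ⊕ Option V} {i : V}, Sum.elim id id x = some i →
      (stableGraph G p).Adj x x' → (x = .inl (some i) ∧ p i) ∨ (x = .inr (some i) ∧ ¬ p i) := by
    rintro (x | x) (x' | x') i hx h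
    · exact absurd h (by simp [stableGraph])
    · obtain ⟨a, ha, -⟩ := h
      obtain rfl : x = some i := hx
      exact Or.inl ⟨rfl, ((part_eq_some_iff (not_of_adj hp)).1 ha).1⟩
    · obtain ⟨a, -, ha⟩ := h
      obtain rfl : x = some i := hx
      exact Or.inr ⟨rfl, ((part_eq_some_iff (of_not_adj hp)).1 ha).1⟩
    · exact absurd h (by simp [stableGraph])
  rcases key hx hxx with ⟨rfl, hi⟩ | ⟨rfl, hi⟩ <;> rcases key hy hyy with ⟨rfl, hj⟩ | ⟨rfl, hj⟩
  · exact iff_of_false id fun h => (hp i j h).1 hi hj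
  · exact ⟨fun ⟨a, h1, h2⟩ => adj_of_part_eq_some hp h1 h2, fun h => exists_part_eq_some hp h hi⟩
  · exact ⟨fun ⟨a, h1, h2⟩ => (adj_of_part_eq_some hp h1 h2).symm,
      fun h => exists_part_eq_some hp h.symm hj⟩
  · exact iff_of_false id fun h => hi ((hp i j h).2 hj)

/-- Chordless cycles of length at least five avoid the vertices `none`, which are joined to all
vertices of the other side, so they are induced cycles of the complement of `G`. -/
theorem mem_inducedCycleLengths_of_isChordlessCycle {l : ℕ} (hl : 5 ≤ l)
    {v : ℕ → Option V ⊕ Option V} (hv : IsChordlessCycle (stableGraph G p) l v) :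
    l ∈ inducedCycleLengths Gᶜ := by
  have hnext : ∀ s < l, ∃ t < l, s + 1 = t ∨ (s + 1 = l ∧ t = 0) := by
    intro s hs
    rcases Nat.lt_or_ge (s + 1) l with h | h
    · exact ⟨s + 1, h, by omega⟩
    · exact ⟨0, by omega, by omega⟩
  have hadj : ∀ s < l, ∃ t < l, (stableGraph G p).Adj (v s) (v t) := by
    intro s hs
    obtain ⟨t, ht, hst⟩ := hnext s hs
    exact ⟨t, ht, (hv s hs t ht).2 (by omega)⟩
  have hsome : ∀ s < l, ∃ i, Sum.elim id id (v s) = some i := by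
    intro s hs
    obtain ⟨t, ht, hst⟩ := hnext s hs
    obtain ⟨t', ht', htt'⟩ := hnext t ht
    obtain ⟨t'', ht'', htt''⟩ := hnext t' ht'
    have h1 := isLeft_ne_of_stableGraph_adj ((hv s hs t ht).2 (by omega))
    have h2 := isLeft_ne_of_stableGraph_adj ((hv t ht t' ht').2 (by omega))
    have h3 := (hv t' ht' t'' ht'').2 (by omega)
    have h4 := isLeft_ne_of_stableGraph_adj h3
    rw [← Option.ne_none_iff_exists']
    intro h
    -- otherwise `v s` and `v (s + 3)` would be joined by a chord
    have h5 : v s = .inl none ∨ v s = .inr none := by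
      revert h
      rcases v s with x | x <;> simp
    have h6 : (v s).isLeft ≠ (v t'').isLeft := by
      revert h1 h2 h4
      cases (v s).isLeft <;> cases (v t).isLeft <;> cases (v t').isLeft <;>
        cases (v t'').isLeft <;> simp
    have h7 := (hv s hs t'' ht'').1 (stableGraph_adj_of_none hp h5 h6 h3.symm)
    omega
  obtain ⟨i₀, -⟩ := hsome 0 (by omega)
  have hsome' : ∀ s, ∃ i, s < l → Sum.elim id id (v s) = some i := fun s => by
    by_cases hs : s < l
    · obtain ⟨i, hi⟩ := hsome s hs
      exact ⟨i, fun _ => hi⟩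
    · exact ⟨i₀, fun h => absurd h hs⟩
  choose w hw using hsome'
  refine IsChordlessCycle.mem_inducedCycleLengths hl (v := w) fun s hs t ht => ?_
  obtain ⟨s', -, hs'⟩ := hadj s hs
  obtain ⟨t', -, ht'⟩ := hadj t ht
  rw [← stableGraph_adj_iff hp (hw s hs) (hw t ht) hs' ht', hv s hs t ht]

end Cycles

/-! ### The toric ideal of the stable set polytope -/

section StableSetIdeal

open MvPolynomial

variable {K : Type v} [Field K] {V : Type u} [Finite V] {G : SimpleGraph V} {p : V → Prop}

/-- If the complement of `G` has no edges, then the stable set polytope is a simplex: its lattice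
points are zero and the unit vectors, which have no relations. -/
theorem toricIdeal_eq_bot (hG : Gᶜ = ⊥) : toricIdeal K (stableSetPolytope G) = ⊥ := by
  have hp : ∀ i j, Gᶜ.Adj i j → (True ↔ ¬ True) := fun i j h => by simp [hG] at h
  refine eq_bot_iff.2 fun f hf => ?_
  by_contra hne
  obtain ⟨α, hα⟩ := Finset.nonempty_iff_ne_empty.2 (mt support_eq_empty.1 hne)
  obtain ⟨β, -, hβα, h⟩ := (isToricFor_toricIdeal K _).exists_ne_mem_support hf hα
  refine hβα ?_
  have h1 := ((exponent_eq_iff_sameFiber (p := fun _ => True) hp _ _).1 h).1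
  refine Finsupp.mapDomain_injective
    (fun a b hab => part_injective (p := fun _ => True) hp a b hab ?_) h1
  have h2 : ∀ a : latticePoints (stableSetPolytope G), part (fun _ => ¬ True) a = none :=
    fun a => by rw [part, dif_neg (by simp)]
  rw [h2, h2]

variable (hp : ∀ i j, Gᶜ.Adj i j → (p i ↔ ¬ p j))
include hp

theorem toricIdeal_ne_bot (hG : Gᶜ ≠ ⊥) : toricIdeal K (stableSetPolytope G) ≠ ⊥ := by
  obtain ⟨i, j, hij⟩ := SimpleGraph.ne_bot_iff_exists_adj.1 hG
  wlog hi : p i generalizing i j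
  · exact this j i hij.symm ((hp j i hij.symm).2 hi)
  have hj := (hp i j hij).1 hi
  obtain ⟨a, hai, haj⟩ := exists_part_eq_some hp hij hi
  obtain ⟨b, hb, hbj⟩ := exists_part_eq_none (not_of_adj hp) (of_not_adj hp) (fun i hi => hi) a
  obtain ⟨c, hc, hci⟩ := exists_part_eq_none (of_not_adj hp) (not_of_adj hp)
    (fun i hi => not_not.2 hi) a
  obtain ⟨d, hd, hdc⟩ := exists_part_eq_none (not_of_adj hp) (of_not_adj hp) (fun i hi => hi) c
  -- the relation between the stable sets `{i, j}`, `∅`, `{i}` and `{j}`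
  have hmem : binomial K (single a 1 + single d 1) (single b 1 + single c 1) ∈
      toricIdeal K (stableSetPolytope G) := by
    rw [(isToricFor_toricIdeal K _).binomial_mem_iff, exponent_eq_iff_sameFiber hp]
    constructor <;>
      simp only [Finsupp.mapDomain_add, Finsupp.mapDomain_single, hb, hbj, hc, hci, hd, hdc]
    exact add_comm _ _
  intro h
  rw [h, Submodule.mem_bot] at hmem
  refine binomial_ne_zero (fun h1 => ?_) hmem
  have h2 := DFunLike.congr_fun h1 a
  have hab : a ≠ b := by rintro rfl; simp [hb] at hai
  have hac : a ≠ c := by rintro rfl; simp [hc] at haj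
  simp [hab, hac] at h2

/-- An induced cycle of length `2 * k` of the complement of `G` gives a generator of degree `k`. -/
theorem not_le_span_of_mem_inducedCycleLengths {k : ℕ} (hk : 2 ≤ k)
    (hl : 2 * k ∈ inducedCycleLengths Gᶜ) :
    ¬ toricIdeal K (stableSetPolytope G) ≤
      Ideal.span {f ∈ toricIdeal K (stableSetPolytope G) | f.totalDegree < k} := by
  obtain ⟨w, hw0, hw, hinj⟩ : ∃ w : ℕ → V, p (w 0) ∧
      (∀ m n, Gᶜ.Adj (w m) (w n) ↔ m + 1 ≡ n [MOD 2 * k] ∨ n + 1 ≡ m [MOD 2 * k]) ∧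
      ∀ m n, w m = w n ↔ m ≡ n [MOD 2 * k] := by
    obtain ⟨w, hinj, hw⟩ := exists_periodic_of_mem_inducedCycleLengths hl
    by_cases h0 : p (w 0)
    · exact ⟨w, h0, hw, hinj⟩
    · refine ⟨fun m => w (m + 1), ?_, fun m n => ?_, fun m n => ?_⟩
      · exact not_not.1 (mt (hp _ _ ((hw 0 1).2 (Or.inl rfl))).2 h0)
      · rw [hw]
        exact or_congr ⟨.add_right_cancel' 1, .add_right 1⟩
          ⟨.add_right_cancel' 1, .add_right 1⟩
      · rw [hinj]
        exact ⟨.add_right_cancel' 1, .add_right 1⟩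
  have hadj : ∀ m, Gᶜ.Adj (w m) (w (m + 1)) := fun m => (hw _ _).2 (Or.inl rfl)
  have heven : ∀ m, p (w (2 * m)) := by
    intro m
    induction m with
    | zero => exact hw0
    | succ m ih => exact not_not.1 (mt (hp _ _ (hadj (2 * m + 1))).2 ((hp _ _ (hadj (2 * m))).1 ih))
  have hs : ∀ m, ∃ a : latticePoints (stableSetPolytope G),
      part p a = some (w (2 * m)) ∧ part (fun i => ¬ p i) a = some (w (2 * m + 1)) :=
    fun m => exists_part_eq_some hp (hadj _) (heven m)
  have ht : ∀ m, ∃ a : latticePoints (stableSetPolytope G),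
      part p a = some (w (2 * (m + 1))) ∧ part (fun i => ¬ p i) a = some (w (2 * m + 1)) :=
    fun m => exists_part_eq_some hp (hadj (2 * m + 1)).symm (heven (m + 1))
  choose s hsr hsc using hs
  choose t htr htc using ht
  refine not_le_span_of_chordless (isToricFor_toricIdeal K _) (exponent_eq_iff_sameFiber hp)
    (by omega) (s := s) (t := t) (fun i => by rw [htc, hsc]) (fun i => by rw [htr, hsr])
    (fun i => ?_) ?_ (fun i h => ?_) ?_
  · refine part_injective hp _ _ ?_ ?_
    · rw [hsr, hsr, Option.some_inj, hinj, Nat.mul_add]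
      exact Nat.add_modEq_right
    · rw [hsc, hsc, Option.some_inj, hinj, Nat.mul_add, Nat.add_right_comm]
      exact Nat.add_modEq_right
  · intro i hi j hj hij
    simp only [Set.mem_Iio] at hi hj
    simp only [hsc, Option.some_inj, hinj] at hij
    have := hij.eq_of_lt_of_lt (by omega) (by omega)
    omega
  · have h1 := hsr i
    rw [h, htr, Option.some_inj, hinj, Nat.mul_add] at h1
    have h2 : 2 * 1 ≡ 0 [MOD 2 * k] := Nat.ModEq.add_left_cancel' (2 * i) h1
    have := h2.eq_of_lt_of_lt (by omega) (by omega)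
    omega
  · intro x i j hr hc
    rw [hsr] at hr
    rw [hsc] at hc
    rcases (hw _ _).1 (adj_of_part_eq_some hp hr hc) with h | h
    · left
      refine part_injective hp _ _ (by rw [hr, hsr]) ?_
      rw [hc, hsc, Option.some_inj, hinj]
      exact h.symm
    · right
      refine part_injective hp _ _ (by rw [hr, htr]) ?_
      rw [hc, htc, Option.some_inj, hinj]
      exact Nat.ModEq.add_right_cancel' 1 h

/-- The toric ideal is generated in degrees at most `k` if the complement of `G` has no induced
cycles of length greater than `2 * k`. -/
theorem toricIdeal_le_span {k : ℕ} (hk : 2 ≤ k) (h : ∀ l ∈ inducedCycleLengths Gᶜ, l ≤ 2 * k) :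
    toricIdeal K (stableSetPolytope G) ≤ Ideal.span {f | ∃ a b,
      exponent _ a = exponent _ b ∧ a.degree ≤ k ∧ f = binomial K a b} := by
  have := finite_latticePoints hp
  refine le_span_binomial_of_not_isChordlessCycle (isToricFor_toricIdeal K _)
    (exponent_eq_iff_sameFiber hp) fun L hL v hv => ?_
  have := h L (mem_inducedCycleLengths_of_isChordlessCycle hp (by omega) hv)
  omega

theorem muEq_two (hG : Gᶜ ≠ ⊥) (h : ∀ l ∈ inducedCycleLengths Gᶜ, l ≤ 4) :
    MuEq (toricIdeal K (stableSetPolytope G)) 2 := by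
  have := finite_latticePoints hp
  refine (isToricFor_toricIdeal K _).muEq (fun _ _ => degree_eq_of_exponent_eq _)
    (toricIdeal_le_span hp le_rfl h) fun hle => toricIdeal_ne_bot (K := K) hp hG ?_
  rw [eq_bot_iff]
  refine hle.trans (Ideal.span_le.2 ?_)
  rintro f ⟨hf, hd⟩
  exact eq_zero_of_mem_toricIdeal K _ hf hd

theorem muEq_of_isGreatest {k : ℕ} (hk : IsGreatest (inducedCycleLengths Gᶜ) (2 * k)) :
    MuEq (toricIdeal K (stableSetPolytope G)) k := by
  have := finite_latticePoints hp
  have hk2 : 2 ≤ k := by have := hk.1.1; omega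
  exact (isToricFor_toricIdeal K _).muEq (fun _ _ => degree_eq_of_exponent_eq _)
    (toricIdeal_le_span hp hk2 fun l hl => hk.2 hl)
    (not_le_span_of_mem_inducedCycleLengths hp hk2 hk.1)

theorem exists_isGreatest (hG : ¬ Gᶜ.IsAcyclic) :
    ∃ k, IsGreatest (inducedCycleLengths Gᶜ) (2 * k) := by
  have h := Nat.sSup_mem (nonempty_inducedCycleLengths hG) bddAbove_inducedCycleLengths
  obtain ⟨k, -, hk⟩ := exists_eq_two_mul hp h
  exact ⟨k, hk ▸ ⟨h, fun l hl => le_csSup bddAbove_inducedCycleLengths hl⟩⟩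

theorem hasQuadraticGroebnerBasis (h : ∀ l ∈ inducedCycleLengths Gᶜ, l = 4) :
    HasQuadraticGroebnerBasis (toricIdeal K (stableSetPolytope G)) := by
  have := finite_latticePoints hp
  obtain ⟨f, g, hf, hg, hfg⟩ := exists_gammaFree
    (fun r c => ∃ a : latticePoints (stableSetPolytope G),
      part p a = r ∧ part (fun i => ¬ p i) a = c) fun L hL v hv => by
    have := h L (mem_inducedCycleLengths_of_isChordlessCycle hp (by omega) hv)
    omega
  exact hasQuadraticGroebnerBasis_of_gammaFree (isToricFor_toricIdeal K _)
    (exponent_eq_iff_sameFiber hp) (part_injective hp) hf hg fun s t u h1 h2 h3 h4 =>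
    hfg _ _ _ _ h1 h2 ⟨u, h3, h4⟩ ⟨s, rfl, rfl⟩ ⟨t, rfl, rfl⟩

/-- A quadratic Gröbner basis gives a quadratic straightening law, hence a linear resolution. -/
theorem isKoszul_of_hasQuadraticGroebnerBasis
    (h : HasQuadraticGroebnerBasis (toricIdeal K (stableSetPolytope G))) :
    IsKoszul (toricGrading K (stableSetPolytope G)) := by
  have := finite_latticePoints hp
  obtain ⟨m, B, hB, hB2⟩ := h
  obtain ⟨S⟩ := hB.exists_quadraticStraightening (surjective_aeval_toricGenerator K _) hB2
  exact S.isKoszul _ (toricGenerator_mem_toricGrading K _)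

omit hp [Finite V] in
theorem isGeneratedByQuadraticBinomials_of_isKoszul
    (h : IsKoszul (toricGrading K (stableSetPolytope G))) :
    IsGeneratedByQuadraticBinomials (toricIdeal K (stableSetPolytope G)) := by
  have hI := isToricFor_toricIdeal K (stableSetPolytope G)
  have he := fun α β => degree_eq_of_exponent_eq (stableSetPolytope G) (α := α) (β := β)
  refine ⟨{f | ∃ α β, α ≠ β ∧ exponent _ α = exponent _ β ∧ α.degree = 2 ∧ f = binomial K α β},
    ⟨?_, le_antisymm ?_ ?_⟩, ?_⟩
  · rintro _ ⟨α, β, hne, -, -, rfl⟩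
    exact ⟨α, β, hne, rfl⟩
  · rw [Ideal.span_le]
    rintro _ ⟨α, β, -, h, -, rfl⟩
    exact hI.binomial_mem_iff.2 h
  · conv_lhs => rw [← hI.span_binomial_eq]
    rw [Ideal.span_le]
    rintro _ ⟨α, β, -, hαβ, rfl⟩
    refine Ideal.span_le.2 ?_ (h.ker_le_span _ (toricGenerator_mem_toricGrading K _)
      (surjective_aeval_toricGenerator K _) (fun f => eq_zero_of_mem_toricIdeal K _)
      (hI.binomial_mem_iff.2 hαβ) (isHomogeneous_binomial (he _ _ hαβ)))
    rintro f ⟨hf, hf2⟩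
    exact Submodule.span_le_restrictScalars K _ _ (hI.mem_span_binomial_of_isHomogeneous he hf hf2)
  · rintro _ ⟨α, β, -, hαβ, hα, rfl⟩
    exact hα ▸ isHomogeneous_binomial (he _ _ hαβ)

theorem eq_four_of_isGeneratedByQuadraticBinomials
    (h : IsGeneratedByQuadraticBinomials (toricIdeal K (stableSetPolytope G))) :
    ∀ l ∈ inducedCycleLengths Gᶜ, l = 4 := by
  intro l hl
  obtain ⟨k, hk, rfl⟩ := exists_eq_two_mul hp hl
  by_contra hne
  obtain ⟨S, hS, hS2⟩ := h
  refine not_le_span_of_mem_inducedCycleLengths (K := K) hp hk hl ?_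
  conv_lhs => rw [← hS.2]
  refine Ideal.span_mono fun f hf => ⟨?_, (hS2 f hf).totalDegree_le.trans_lt (by omega)⟩
  rw [← hS.2]
  exact Ideal.subset_span hf

omit hp [Finite V] in
theorem isGeneratedByQuadraticBinomials_of_muEq {d : ℕ} (hd : d ≤ 2)
    (h : MuEq (toricIdeal K (stableSetPolytope G)) d) :
    IsGeneratedByQuadraticBinomials (toricIdeal K (stableSetPolytope G)) := by
  rcases h with ⟨h, -⟩ | ⟨-, ⟨S, hS⟩, h⟩
  · rw [h]
    exact ⟨∅, ⟨by simp, by simp⟩, by simp⟩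
  refine ⟨S, hS.1, fun f hf => ?_⟩
  have hI := isToricFor_toricIdeal K (stableSetPolytope G)
  have hfI : f ∈ toricIdeal K (stableSetPolytope G) := by
    rw [← hS.1.2]; exact Ideal.subset_span hf
  obtain ⟨α, β, hne, hαβ, rfl⟩ := hI.exists_of_isBinomial (hS.1.1 f hf) hfI
  have h1 := isHomogeneous_binomial (K := K) (degree_eq_of_exponent_eq _ hαβ)
  have h2 := h1.totalDegree (binomial_ne_zero hne)
  have h3 : α.degree ≤ 2 := h2 ▸ ((h S hS).2 ⟨_, hf, rfl⟩).trans hd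
  have h4 : ¬ α.degree < 2 := fun h4 =>
    binomial_ne_zero hne (eq_zero_of_mem_toricIdeal K _ hfI (h2.trans_lt h4))
  rwa [show α.degree = 2 by omega] at h1

end StableSetIdeal

end StableSetToric

end

theorem mainTheorem3 {K : Type*} [Field K] {V : Type*} [Finite V] (G : SimpleGraph V)
    (hG : Gᶜ.IsBipartite) :
    -- the three cases of the formula for `μ(I_{Q_G})`
    (Gᶜ = ⊥ →
      StableSetToric.MuEq (StableSetToric.toricIdeal K (StableSetToric.stableSetPolytope G)) 0) ∧
    (¬ Gᶜ.IsAcyclic →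
      ∃ k : ℕ, IsGreatest (StableSetToric.inducedCycleLengths Gᶜ) (2 * k) ∧
        StableSetToric.MuEq
          (StableSetToric.toricIdeal K (StableSetToric.stableSetPolytope G)) k) ∧
    (Gᶜ ≠ ⊥ → Gᶜ.IsAcyclic →
      StableSetToric.MuEq (StableSetToric.toricIdeal K (StableSetToric.stableSetPolytope G)) 2) ∧
    -- the equivalent conditions; the first two are the two forms of condition (i)
    List.TFAE [
      ∃ d ≤ 2,
        StableSetToric.MuEq (StableSetToric.toricIdeal K (StableSetToric.stableSetPolytope G)) d,
      StableSetToric.IsGeneratedByQuadraticBinomials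
        (StableSetToric.toricIdeal K (StableSetToric.stableSetPolytope G)),
      StableSetToric.IsKoszul
        (StableSetToric.toricGrading K (StableSetToric.stableSetPolytope G)),
      StableSetToric.HasQuadraticGroebnerBasis
        (StableSetToric.toricIdeal K (StableSetToric.stableSetPolytope G)),
      ∀ l ∈ StableSetToric.inducedCycleLengths Gᶜ, l = 4] := by
  obtain ⟨c⟩ := hG
  have hp : ∀ i j, Gᶜ.Adj i j → (c i = 0 ↔ ¬ c j = 0) := by
    intro i j h
    have := c.valid h
    revert this
    generalize c i = x
    generalize c j = y
    revert x y
    decide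
  refine ⟨fun h => Or.inl ⟨StableSetToric.toricIdeal_eq_bot h, rfl⟩, fun h => ?_,
    fun h h' => ?_, ?_⟩
  · obtain ⟨k, hk⟩ := StableSetToric.exists_isGreatest hp h
    exact ⟨k, hk, StableSetToric.muEq_of_isGreatest hp hk⟩
  · refine StableSetToric.muEq_two hp h fun l hl => ?_
    rw [StableSetToric.inducedCycleLengths_eq_empty h'] at hl
    exact absurd hl (Set.notMem_empty l)
  · tfae_have 5 → 4 := StableSetToric.hasQuadraticGroebnerBasis hp
    tfae_have 4 → 3 := StableSetToric.isKoszul_of_hasQuadraticGroebnerBasis hp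
    tfae_have 3 → 2 := StableSetToric.isGeneratedByQuadraticBinomials_of_isKoszul
    tfae_have 2 → 5 := StableSetToric.eq_four_of_isGeneratedByQuadraticBinomials hp
    tfae_have 1 → 2 := fun ⟨d, hd, h⟩ =>
      StableSetToric.isGeneratedByQuadraticBinomials_of_muEq hd h
    tfae_have 5 → 1 := fun h => by
      by_cases hbot : Gᶜ = ⊥
      · exact ⟨0, by omega, Or.inl ⟨StableSetToric.toricIdeal_eq_bot hbot, rfl⟩⟩
      · exact ⟨2, le_rfl, StableSetToric.muEq_two hp hbot fun l hl => (h l hl).le⟩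
    tfae_finish
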